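/- Let $(\mathcal K,[\cdot,\cdot])$ be a complex Krein space, ${}^*$ the adjoint with respect to $[\cdot,\cdot]$ on $\mathcal K$ (and to the given inner products on Hilbert spaces), and let $N$ be a bounded linear normal operator on $\mathcal K$ ($NN^*=N^*N$) with real part $A=\frac{N+N^*}{2}$ and imaginary part $B=\frac{N-N^*}{2i}$. Let $p,q\in\mathbb R[z]\setminus\{0\}$ be definitizing polynomials for $A$ and $B$, that is, $[p(A)x,x]\ge 0$ and $[q(B)x,x]\ge 0$ for all $x\in\mathcal K$. *Setting.* Let $\mathcal V,\mathcal V_1,\mathcal V_2$ be Hilbert spaces and $T:\mathcal V\to\mathcal K$, $T_j:\mathcal V_j\to\mathcal K$ ($j=1,2$) bounded linear injections with $T_1T_1^*=p(A)$, $T_2T_2^*=q(B)$, $TT^*=p(A)+q(B)$ (such spaces exist and are unique up to unitary equivalence). Let $R_j:\mathcal V_j\to\mathcal V$ be the adjoint of the continuous extension to $\mathcal V$ of $T^*x\mapsto T_j^*x$, so that $T_j=TR_j$. For $C$ commuting with $TT^*$ let $\Theta(C)=T^{-1}CT$, a bounded operator on $\mathcal V$. Then $\Theta(N)$ is normal on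 the Hilbert space $\mathcal V$; let $E$ be its spectral measure. Let $\mathfrak d_p(w),\mathfrak d_q(w)$ be the multiplicities of $w\in\mathbb C$ as a zero of $p$, $q$, let $Z=\{x+iy:\ x,y\in\mathbb R,\ p(x)=0=q(y)\}$ and $Z^i=\{(\alpha,\beta)\in\mathbb C^2: p(\alpha)=0=q(\beta)\}\setminus\mathbb R^2$. For $w\in Z$ write $m=\mathfrak d_p(\operatorname{Re}w)$ and $n=\mathfrak d_q(\operatorname{Im}w)$. *Functions.* Let $\mathcal M_N$ be the set of functions $\phi$ on $(\sigma(\Theta(N))\cup Z)\,\dot\cup\, Z^i$ such that $\phi(z)\in\mathbb C$ for $z\in\sigma(\Theta(N))\setminus Z$; $\phi(w)=(\phi(w)_{k,l})$ is a family of complex numbers indexed by $(k,l)\in(\{0,\dots,m-1\}\times\{0,\dots,n-1\})\cup\{(m,0),(0,n)\}$ for $w\in Z$; and $\phi(\alpha,\beta)$ is a family indexed by $\{0,\dots,\mathfrak d_p(\alpha)-1\}\times\{0,\dots,\mathfrak d_q(\beta)-1\}$ for $(\alpha,\beta)\in Z^i$. Let $\mathcal F_N$ be the set of all $\phi\in\mathcal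 M_N$ that are Borel measurable and bounded on $\sigma(\Theta(N))\setminus Z$ and such that for each $w\in\sigma(\Theta(N))\cap Z$ the quotient $$\frac{\phi(z)-\sum_{k=0}^{m-1}\sum_{l=0}^{n-1}\phi(w)_{k,l}\operatorname{Re}(z-w)^k\operatorname{Im}(z-w)^l}{\max(|\operatorname{Re}(z-w)|^{m},|\operatorname{Im}(z-w)|^{n})}$$ is bounded for $z\in\sigma(\Theta(N))\setminus Z$ in some neighbourhood of $w$. A polynomial $s\in\mathbb C[z,w]$ gives $s_N\in\mathcal M_N$ with $s_N(z)=s(\operatorname{Re}z,\operatorname{Im}z)$ on $\sigma(\Theta(N))\setminus Z$ and with entries $\frac1{k!\,l!}\frac{\partial^{k+l}s}{\partial z^k\partial w^l}$, evaluated at $(\operatorname{Re}w,\operatorname{Im}w)$ for $w\in Z$ and at $(\alpha,\beta)$ for $(\alpha,\beta)\in Z^i$. Here $p$ and $q$ are regarded as the polynomials $p(z)$ and $q(w)$ of $\mathbb C[z,w]$, which defines $p_N$ and $q_N$. *The operator $\phi(N)$.* For $\phi\in\mathcal F_N$ choose $s\in\mathbb C[z,w]$ and a function $g$ on $\sigma(\Theta(N))$,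 with values in $\mathbb C$ on $\sigma(\Theta(N))\setminus Z$, where it is bounded and Borel measurable, and with values $(g(w)_1,g(w)_2)\in\mathbb C^2$ on $\sigma(\Theta(N))\cap Z$, such that: all entries of $\phi-s_N$ with index $(k,l)$, $k<m$, $l<n$, vanish at each point of $Z$, and $\phi-s_N=0$ on $Z^i$; $\phi(z)=s_N(z)+(p(\operatorname{Re}z)+q(\operatorname{Im}z))\,g(z)$ on $\sigma(\Theta(N))\setminus Z$; and at each $w\in\sigma(\Theta(N))\cap Z$ the entries of $\phi-s_N$ with indices $(m,0)$ and $(0,n)$ are $(p_N+q_N)(w)_{m,0}\,g(w)_1$ and $(p_N+q_N)(w)_{0,n}\,g(w)_2$. Put $$\phi(N)=s(A,B)+T\Big(\int_{\sigma(\Theta(N))\setminus Z}g\,dE+\sum_{w\in\sigma(\Theta(N))\cap Z}\big(g(w)_1R_1R_1^*E\{w\}+g(w)_2R_2R_2^*E\{w\}\big)\Big)T^* .$$ **Lemma.** For every $\phi\in\mathcal F_N$ such $s,g$ exist and $\phi(N)$ does not depend on their choice. If $\phi\in\mathcal F_N$ vanishes on $$\sigma_N:=\big(\sigma(\Theta(N))\cup(Z\cap\sigma(N))\big)\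 \dot\cup\ \{(\alpha,\beta)\in Z^i:\ \alpha+i\beta\in\sigma(N)\text{ and }\bar\alpha+i\bar\beta\in\sigma(N)\},$$ then $\phi(N)=0$. Consequently, if $\phi,\psi\in\mathcal F_N$ coincide on $\sigma_N$, then $\phi(N)=\psi(N)$. -/

import Mathlib

open scoped ComplexOrder InnerProductSpace Topology CompactlySupported

noncomputable section

namespace KreinCalc

/-! ### Krein spaces -/

section Krein

variable {K : Type*} [NormedAddCommGroup K] [InnerProductSpace ℂ K] [CompleteSpace K]
variable {V : Type*} [NormedAddCommGroup V] [InnerProductSpace ℂ V] [CompleteSpace V]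

/-- A Krein space is presented as a Hilbert space `K` together with a fundamental symmetry, that is
a bounded operator `J` with `J = J†` and `J ^ 2 = 1`; the indefinite inner product is
`[x, y] = ⟨J x, y⟩`. Boundedness, spectra and Krein adjoints of operators do not depend on
the choice of the fundamental symmetry. -/
structure FundamentalSymmetry (K : Type*) [NormedAddCommGroup K] [InnerProductSpace ℂ K]
    [CompleteSpace K] where
  /-- the operator `J` -/
  op : K →L[ℂ] K
  isSelfAdjoint : IsSelfAdjoint op
  sq_eq_one : op * op = 1

/-- The Krein space inner product `[x, y]`, linear in `x` and conjugate linear in `y`. -/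
def FundamentalSymmetry.form (J : FundamentalSymmetry K) (x y : K) : ℂ := ⟪y, J.op x⟫_ℂ

/-- The Krein space adjoint of a bounded operator `C` on `K`. -/
def FundamentalSymmetry.adj (J : FundamentalSymmetry K) (C : K →L[ℂ] K) : K →L[ℂ] K :=
  J.op * ContinuousLinearMap.adjoint C * J.op

/-- The adjoint `K → V` of a bounded operator `T : V → K` from a Hilbert space `V` into the
Krein space `K`. -/
def FundamentalSymmetry.adjFrom (J : FundamentalSymmetry K) (T : V →L[ℂ] K) : K →L[ℂ] V :=
  (ContinuousLinearMap.adjoint T).comp J.op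

theorem FundamentalSymmetry.op_op (J : FundamentalSymmetry K) (x : K) : J.op (J.op x) = x := by
  have h := congrArg (fun S : K →L[ℂ] K => S x) J.sq_eq_one
  simpa using h

theorem FundamentalSymmetry.inner_op (J : FundamentalSymmetry K) (x y : K) :
    ⟪J.op x, y⟫_ℂ = ⟪x, J.op y⟫_ℂ := by
  have h := J.isSelfAdjoint.adjoint_eq
  rw [← ContinuousLinearMap.adjoint_inner_right, h]

/-- `[C x, y] = [x, C^* y]`. -/
theorem FundamentalSymmetry.form_adj (J : FundamentalSymmetry K) (C : K →L[ℂ] K) (x y : K) :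
    J.form (C x) y = J.form x (J.adj C y) := by
  simp only [form, adj, mul_apply_eq_comp]
  rw [J.inner_op, J.op_op, ContinuousLinearMap.adjoint_inner_left, ← J.inner_op]

/-- `[T v, x] = ⟨v, T^* x⟩`. -/
theorem FundamentalSymmetry.form_adjFrom (J : FundamentalSymmetry K) (T : V →L[ℂ] K) (v : V)
    (x : K) : J.form (T v) x = ⟪J.adjFrom T x, v⟫_ℂ := by
  simp only [form, adjFrom, ContinuousLinearMap.comp_apply]
  rw [ContinuousLinearMap.adjoint_inner_left, ← J.inner_op]

/-- The real part `(N + N^*) / 2`. -/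
def FundamentalSymmetry.rePart (J : FundamentalSymmetry K) (N : K →L[ℂ] K) : K →L[ℂ] K :=
  (1 / 2 : ℂ) • (N + J.adj N)

/-- The imaginary part `(N - N^*) / (2 i)`. -/
def FundamentalSymmetry.imPart (J : FundamentalSymmetry K) (N : K →L[ℂ] K) : K →L[ℂ] K :=
  (1 / (2 * Complex.I) : ℂ) • (N - J.adj N)

/-- A real polynomial, regarded as a complex one. -/
def cpoly (p : Polynomial ℝ) : Polynomial ℂ := p.map (algebraMap ℝ ℂ)

/-- `p(A)`. -/
def polyOp (p : Polynomial ℝ) (A : K →L[ℂ] K) : K →L[ℂ] K := Polynomial.aeval A (cpoly p)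

/-- `s(A, B)` for a polynomial `s` in two variables (and commuting `A`, `B`). -/
def polyOp₂ (s : MvPolynomial (Fin 2) ℂ) (A B : K →L[ℂ] K) : K →L[ℂ] K :=
  ∑ m ∈ s.support, s.coeff m • (A ^ m 0 * B ^ m 1)

/-- `p` is a definitizing polynomial for `A`: `p ≠ 0` and `[p(A) x, x] ≥ 0` for all `x`. -/
def FundamentalSymmetry.IsDefinitizing (J : FundamentalSymmetry K) (p : Polynomial ℝ)
    (A : K →L[ℂ] K) : Prop :=
  p ≠ 0 ∧ ∀ x : K, 0 ≤ J.form (polyOp p A x) x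

/-- A bounded normal definitizable operator on a Krein space, together with fixed definitizing
polynomials `p` and `q` for its real and imaginary part. -/
structure DefinitizableNormal (J : FundamentalSymmetry K) where
  /-- the operator -/
  N : K →L[ℂ] K
  /-- definitizing polynomial of the real part -/
  p : Polynomial ℝ
  /-- definitizing polynomial of the imaginary part -/
  q : Polynomial ℝ
  normal : N * J.adj N = J.adj N * N
  definitizing_re : J.IsDefinitizing p (J.rePart N)
  definitizing_im : J.IsDefinitizing q (J.imPart N)

/-- A Hilbert space `V` with a bounded linear injection `T : V → K` such that `T T^* = P`. For given
`P`, the pair `(V, T)` is unique up to unitary equivalence. One such pair is the completion of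
`K / ker P` with respect to `[P x, y]` together with the adjoint of the embedding of `K`. -/
structure HilbertFactor (J : FundamentalSymmetry K) (P : K →L[ℂ] K) (V : Type*)
    [NormedAddCommGroup V] [InnerProductSpace ℂ V] [CompleteSpace V] where
  /-- the injection -/
  T : V →L[ℂ] K
  injective : Function.Injective T
  factor : T.comp (J.adjFrom T) = P

/-- For every `P` with `[P x, x] ≥ 0` there is a pair `(V, T)` as above. -/
theorem HilbertFactor.exists_of_nonneg (J : FundamentalSymmetry K) (P : K →L[ℂ] K)
    (hP : ∀ x, 0 ≤ J.form (P x) x) :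
    ∃ (V : Submodule ℂ K) (_ : CompleteSpace V), Nonempty (HilbertFactor J P V) := by
  have hS : (0 : K →L[ℂ] K) ≤ P * J.op := by
    rw [ContinuousLinearMap.nonneg_iff_isPositive, ContinuousLinearMap.isPositive_iff_complex]
    intro x
    have h := hP (J.op x)
    simp only [FundamentalSymmetry.form] at h
    rw [J.inner_op, J.op_op] at h
    obtain ⟨h1, h2⟩ := Complex.le_def.mp h
    have h3 : ⟪(P * J.op) x, x⟫_ℂ = ⟪x, P (J.op x)⟫_ℂ := by
      rw [← inner_conj_symm, mul_apply_eq_comp, Complex.conj_eq_iff_im]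
      exact h2.symm
    rw [h3]
    exact ⟨Complex.ext rfl h2, h1⟩
  obtain ⟨G, hG, hGG⟩ : ∃ G : K →L[ℂ] K, IsSelfAdjoint G ∧ G * G = P * J.op :=
    ⟨CFC.sqrt (P * J.op), (CFC.sqrt_nonneg _).isSelfAdjoint, CFC.sqrt_mul_sqrt_self _ hS⟩
  have hadj : ContinuousLinearMap.adjoint G = G := hG.adjoint_eq
  let V : Submodule ℂ K := (LinearMap.ker (G : K →ₗ[ℂ] K))ᗮ
  have hV : CompleteSpace V := inferInstance
  have hmem : ∀ x, G x ∈ V := by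
    intro x
    rw [Submodule.mem_orthogonal]
    intro u hu
    have hu' : G u = 0 := hu
    rw [← hadj, ContinuousLinearMap.adjoint_inner_right, hu', inner_zero_left]
  refine ⟨V, hV, ⟨⟨G.comp V.subtypeL, ?_, ?_⟩⟩⟩
  · rw [injective_iff_map_eq_zero]
    intro v hv
    have h1 : (v : K) ∈ LinearMap.ker (G : K →ₗ[ℂ] K) := hv
    have h2 := Submodule.inner_right_of_mem_orthogonal h1 v.2
    exact Subtype.ext (inner_self_eq_zero.mp h2)
  · ext x
    have h3 : ((ContinuousLinearMap.adjoint (G.comp V.subtypeL)) (J.op x) : K) = G (J.op x) := by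
      have h4 : ContinuousLinearMap.adjoint (G.comp V.subtypeL) (J.op x) = ⟨G (J.op x), hmem _⟩ := by
        refine ext_inner_right ℂ fun w => ?_
        rw [ContinuousLinearMap.adjoint_inner_left, Submodule.coe_inner]
        change ⟪J.op x, G w⟫_ℂ = ⟪G (J.op x), (w : K)⟫_ℂ
        rw [← ContinuousLinearMap.adjoint_inner_left, hadj]
      rw [h4]
    have h5 := congrArg (fun S : K →L[ℂ] K => S (J.op x)) hGG
    simp only [mul_apply_eq_comp, J.op_op] at h5
    rw [← h5]
    simp only [FundamentalSymmetry.adjFrom, ContinuousLinearMap.comp_apply]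
    rw [← h3]
    rfl

end Krein

/-! ### The spectral measure of a normal operator on a Hilbert space -/

section Spectral

variable {V : Type*} [NormedAddCommGroup V] [InnerProductSpace ℂ V] [CompleteSpace V]

/-- The positive functional `f ↦ ⟨x, f(D) x⟩`, where `f(D)` is the continuous functional
calculus. -/
def scalarFunctional (D : V →L[ℂ] V) (x : V) : C_c(ℂ, ℝ) →ₚ[ℝ] ℝ where
  toFun f := (⟪x, cfc (fun z => (f z : ℂ)) D x⟫_ℂ).re
  map_add' f g := by
    have hf : Continuous fun z => (f z : ℂ) := Complex.continuous_ofReal.comp f.continuous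
    have hg : Continuous fun z => (g z : ℂ) := Complex.continuous_ofReal.comp g.continuous
    have h := cfc_add (a := D) (fun z => (f z : ℂ)) (fun z => (g z : ℂ))
      hf.continuousOn hg.continuousOn
    simp only [CompactlySupportedContinuousMap.coe_add, Pi.add_apply, Complex.ofReal_add]
    rw [h]
    simp
  map_smul' c f := by
    have hf : Continuous fun z => (f z : ℂ) := Complex.continuous_ofReal.comp f.continuous
    have h := cfc_const_mul (a := D) (c : ℂ) (fun z => (f z : ℂ)) hf.continuousOn
    simp only [CompactlySupportedContinuousMap.coe_smul, Pi.smul_apply, smul_eq_mul,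
      Complex.ofReal_mul]
    rw [h]
    simp
  monotone' f g hfg := by
    have hf : Continuous fun z => (f z : ℂ) := Complex.continuous_ofReal.comp f.continuous
    have hg : Continuous fun z => (g z : ℂ) := Complex.continuous_ofReal.comp g.continuous
    have h : cfc (fun z => (f z : ℂ)) D ≤ cfc (fun z => (g z : ℂ)) D :=
      cfc_mono (fun z _ => by exact_mod_cast hfg z) hf.continuousOn hg.continuousOn
    rw [ContinuousLinearMap.le_def] at h
    have h2 := h.inner_nonneg_right x
    have h3 := (Complex.le_def.mp h2).1
    simp only [sub_apply, inner_sub_right, Complex.sub_re,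
      Complex.zero_re] at h3
    simpa using h3

/-- The measure `⟨E(·) x, x⟩`, where `E` is the spectral measure of the normal operator `D`, obtained
from the Riesz representation theorem: it satisfies `∫ f d⟨E x, x⟩ = ⟨f(D) x, x⟩` for continuous `f`
with compact support. -/
def scalarMeasure (D : V →L[ℂ] V) (x : V) : MeasureTheory.Measure ℂ :=
  RealRMK.rieszMeasure (scalarFunctional D x)

/-- For a normal operator `D` with spectral measure `E` and a bounded Borel function `g`, the operator
`∫ g dE`, that is the unique bounded operator `X` with `⟨X x, x⟩ = ∫ g d⟨E x, x⟩` for all `x`. -/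
def spectralIntegral (D : V →L[ℂ] V) (g : ℂ → ℂ) : V →L[ℂ] V :=
  Classical.epsilon fun X : V →L[ℂ] V => ∀ x : V, ⟪x, X x⟫_ℂ = ∫ z, g z ∂(scalarMeasure D x)

/-- The spectral projection `E(Δ)` of the normal operator `D`. -/
def spectralProj (D : V →L[ℂ] V) (Δ : Set ℂ) : V →L[ℂ] V :=
  spectralIntegral D (Δ.indicator fun _ => 1)

end Spectral

/-! ### The function class -/

section Functions

/-- The algebra `(ℂ^m ⊗ ℂ^n) × ℂ²` (as a vector space); the entries of the last factor carry the
indices `(m, 0)` and `(0, n)`, respectively. -/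
abbrev AJet (m n : ℕ) : Type := (Fin m × Fin n → ℂ) × (ℂ × ℂ)

/-- The algebra `ℂ^m ⊗ ℂ^n` (as a vector space). -/
abbrev BJet (m n : ℕ) : Type := Fin m × Fin n → ℂ

/-- The multiplicity of `w ∈ ℂ` as a zero of the real polynomial `p`. -/
def mult (p : Polynomial ℝ) (w : ℂ) : ℕ := (cpoly p).rootMultiplicity w

/-- The set `Z^ℝ_p + i Z^ℝ_q`. -/
def crit (p q : Polynomial ℝ) : Set ℂ := {z | p.IsRoot z.re ∧ q.IsRoot z.im}

/-- The set `Z^i` of all pairs of complex zeros of `p` and `q` which are not both real. -/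
def nonrealPairs (p q : Polynomial ℝ) : Set (ℂ × ℂ) :=
  {ζ | (cpoly p).IsRoot ζ.1 ∧ (cpoly q).IsRoot ζ.2 ∧ ¬ (ζ.1.im = 0 ∧ ζ.2.im = 0)}

variable {p q : Polynomial ℝ} {σ : Set ℂ}

/-- Functions on the disjoint union of `σ ∪ (Z^ℝ_p + i Z^ℝ_q)` and `Z^i` with values in `ℂ` on
`σ \ (Z^ℝ_p + i Z^ℝ_q)` and with values in the appropriate spaces of jets on
`Z^ℝ_p + i Z^ℝ_q` and on `Z^i`. -/
@[ext]
structure MFun (p q : Polynomial ℝ) (σ : Set ℂ) where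
  /-- the restriction to `σ \ (Z^ℝ_p + i Z^ℝ_q)` -/
  reg : ↥(σ \ crit p q) → ℂ
  /-- the restriction to `Z^ℝ_p + i Z^ℝ_q` -/
  jet : ∀ z : crit p q, AJet (mult p (z : ℂ).re) (mult q (z : ℂ).im)
  /-- the restriction to `Z^i` -/
  nonreal : ∀ ζ : nonrealPairs p q, BJet (mult p (ζ : ℂ × ℂ).1) (mult q (ζ : ℂ × ℂ).2)

instance : Zero (MFun p q σ) := ⟨⟨fun _ => 0, fun _ => 0, fun _ => 0⟩⟩

instance : Sub (MFun p q σ) :=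
  ⟨fun φ ψ => ⟨fun z => φ.reg z - ψ.reg z, fun z => φ.jet z - ψ.jet z,
    fun ζ => φ.nonreal ζ - ψ.nonreal ζ⟩⟩

/-- The Taylor coefficient `(k! l!)⁻¹ ∂^{k+l} s / ∂z^k ∂w^l` at the point `(a, b)`. -/
def taylorCoeff (s : MvPolynomial (Fin 2) ℂ) (k l : ℕ) (a b : ℂ) : ℂ :=
  MvPolynomial.eval ![a, b]
      ((⇑(MvPolynomial.pderiv (R := ℂ) (0 : Fin 2)))^[k]
        ((⇑(MvPolynomial.pderiv (R := ℂ) (1 : Fin 2)))^[l] s))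
    / ((k.factorial : ℂ) * (l.factorial : ℂ))

/-- The element `s_N` given by a polynomial `s ∈ ℂ[z, w]`. -/
def MFun.ofPoly (p q : Polynomial ℝ) (σ : Set ℂ) (s : MvPolynomial (Fin 2) ℂ) : MFun p q σ where
  reg z := MvPolynomial.eval ![((z : ℂ).re : ℂ), ((z : ℂ).im : ℂ)] s
  jet z :=
    (fun kl => taylorCoeff s kl.1 kl.2 (z : ℂ).re (z : ℂ).im,
      taylorCoeff s (mult p (z : ℂ).re) 0 (z : ℂ).re (z : ℂ).im,
      taylorCoeff s 0 (mult q (z : ℂ).im) (z : ℂ).re (z : ℂ).im)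
  nonreal ζ := fun kl => taylorCoeff s kl.1 kl.2 (ζ : ℂ × ℂ).1 (ζ : ℂ × ℂ).2

/-- The polynomial `p(z) + q(w) ∈ ℂ[z, w]`. -/
def sumPoly (p q : Polynomial ℝ) : MvPolynomial (Fin 2) ℂ :=
  Polynomial.aeval (MvPolynomial.X 0) (cpoly p) + Polynomial.aeval (MvPolynomial.X 1) (cpoly q)

/-- The ideal `R`: the components with index `(k, l)`, `k < m`, `l < n`, vanish at all points
of `Z^ℝ_p + i Z^ℝ_q` and of `Z^i`. -/
def MFun.InR (φ : MFun p q σ) : Prop :=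
  (∀ z, (φ.jet z).1 = 0) ∧ ∀ ζ, φ.nonreal ζ = 0

/-- The class `F_N`. -/
structure MFun.InF (φ : MFun p q σ) : Prop where
  measurable : Measurable φ.reg
  bounded : ∃ C : ℝ, ∀ z, ‖φ.reg z‖ ≤ C
  growth : ∀ w : crit p q, (w : ℂ) ∈ σ → ∃ C : ℝ, ∃ U ∈ 𝓝 (w : ℂ),
    ∀ z : ↥(σ \ crit p q), (z : ℂ) ∈ U →
      ‖φ.reg z - ∑ k : Fin (mult p (w : ℂ).re), ∑ l : Fin (mult q (w : ℂ).im),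
          (φ.jet w).1 (k, l) * (((z : ℂ) - w).re : ℂ) ^ (k : ℕ) * (((z : ℂ) - w).im : ℂ) ^ (l : ℕ)‖
        / max (|((z : ℂ) - w).re| ^ mult p (w : ℂ).re) (|((z : ℂ) - w).im| ^ mult q (w : ℂ).im) ≤ C

/-- Functions on `σ` with values in `ℂ` on `σ \ (Z^ℝ_p + i Z^ℝ_q)` and with values in `ℂ²` on
`σ ∩ (Z^ℝ_p + i Z^ℝ_q)`. -/
structure GFun (p q : Polynomial ℝ) (σ : Set ℂ) where
  /-- the restriction to `σ \ (Z^ℝ_p + i Z^ℝ_q)` -/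
  reg : ↥(σ \ crit p q) → ℂ
  /-- the restriction to `σ ∩ (Z^ℝ_p + i Z^ℝ_q)` -/
  pair : ↥(σ ∩ crit p q) → ℂ × ℂ

/-- A decomposition of `φ`: `φ - s_N ∈ R`, `g` is bounded and measurable on
`σ \ (Z^ℝ_p + i Z^ℝ_q)`, and `φ = s_N + (p_N + q_N) · g` on `σ`, where at the points of
`σ ∩ (Z^ℝ_p + i Z^ℝ_q)` the product has the components
`(p_N + q_N)_{m,0} g₁` and `(p_N + q_N)_{0,n} g₂` at the indices `(m, 0)` and `(0, n)`, and zero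
components elsewhere. -/
structure IsDecomposition (φ : MFun p q σ) (s : MvPolynomial (Fin 2) ℂ) (g : GFun p q σ) :
    Prop where
  sub_mem : (φ - MFun.ofPoly p q σ s).InR
  measurable : Measurable g.reg
  bounded : ∃ C : ℝ, ∀ z, ‖g.reg z‖ ≤ C
  eq_reg : ∀ z, φ.reg z =
    (MFun.ofPoly p q σ s).reg z + (MFun.ofPoly p q σ (sumPoly p q)).reg z * g.reg z
  eq_jet : ∀ z : ↥(σ ∩ crit p q), φ.jet ⟨z, z.2.2⟩ =
    (MFun.ofPoly p q σ s).jet ⟨z, z.2.2⟩ +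
      (0, ((MFun.ofPoly p q σ (sumPoly p q)).jet ⟨z, z.2.2⟩).2.1 * (g.pair z).1,
          ((MFun.ofPoly p q σ (sumPoly p q)).jet ⟨z, z.2.2⟩).2.2 * (g.pair z).2)

/-- `φ` and `ψ` coincide on the subset `S` of the disjoint union of `ℂ` and `ℂ × ℂ`. -/
def MFun.EqOn (φ ψ : MFun p q σ) (S : Set (ℂ ⊕ ℂ × ℂ)) : Prop :=
  (∀ z : ↥(σ \ crit p q), Sum.inl (z : ℂ) ∈ S → φ.reg z = ψ.reg z) ∧
  (∀ z : crit p q, Sum.inl (z : ℂ) ∈ S → φ.jet z = ψ.jet z) ∧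
  ∀ ζ : nonrealPairs p q, Sum.inr (ζ : ℂ × ℂ) ∈ S → φ.nonreal ζ = ψ.nonreal ζ

end Functions

/-! ### The functional calculus -/

section Calculus

variable {K : Type*} [NormedAddCommGroup K] [InnerProductSpace ℂ K] [CompleteSpace K]
variable {V : Type*} [NormedAddCommGroup V] [InnerProductSpace ℂ V] [CompleteSpace V]
variable {V₁ : Type*} [NormedAddCommGroup V₁] [InnerProductSpace ℂ V₁] [CompleteSpace V₁]
variable {V₂ : Type*} [NormedAddCommGroup V₂] [InnerProductSpace ℂ V₂] [CompleteSpace V₂]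

/-- For injective `T : V → K` and `C` in the commutant of `T T^*`, the operator
`Θ(C) = T⁻¹ C T` on `V`, that is the unique bounded operator `D` with `T D = C T`. -/
def theta (T : V →L[ℂ] K) (C : K →L[ℂ] K) : V →L[ℂ] V :=
  Classical.epsilon fun D : V →L[ℂ] V => T.comp D = C.comp T

/-- The contraction `R_j : V_j → V` with `T_j = T R_j`, namely the adjoint of the continuous
extension to `V` of the mapping `T^* x ↦ T_j^* x`. -/
def transfer {W : Type*} [NormedAddCommGroup W] [InnerProductSpace ℂ W] [CompleteSpace W]
    (J : FundamentalSymmetry K) (T : V →L[ℂ] K) (S : W →L[ℂ] K) : W →L[ℂ] V :=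
  ContinuousLinearMap.adjoint
    (LinearMap.extendOfNorm (J.adjFrom S : K →ₗ[ℂ] W) (J.adjFrom T : K →ₗ[ℂ] V))

/-- The operator `R_j R_j^*` on `V`. -/
def transferSq {W : Type*} [NormedAddCommGroup W] [InnerProductSpace ℂ W] [CompleteSpace W]
    (J : FundamentalSymmetry K) (T : V →L[ℂ] K) (S : W →L[ℂ] K) : V →L[ℂ] V :=
  (transfer J T S).comp (ContinuousLinearMap.adjoint (transfer J T S))

/-- A normal definitizable operator `N` with Hilbert spaces `V`, `V₁`, `V₂` and injections
`T`, `T₁`, `T₂` into `K` such that `T T^* = p(A) + q(B)`, `T₁ T₁^* = p(A)` and `T₂ T₂^* = q(B)`. -/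
structure Model (J : FundamentalSymmetry K) (V V₁ V₂ : Type*)
    [NormedAddCommGroup V] [InnerProductSpace ℂ V] [CompleteSpace V]
    [NormedAddCommGroup V₁] [InnerProductSpace ℂ V₁] [CompleteSpace V₁]
    [NormedAddCommGroup V₂] [InnerProductSpace ℂ V₂] [CompleteSpace V₂]
    extends DefinitizableNormal J where
  /-- the factor of `p(A) + q(B)` -/
  fac : HilbertFactor J (polyOp p (J.rePart N) + polyOp q (J.imPart N)) V
  /-- the factor of `p(A)` -/
  fac₁ : HilbertFactor J (polyOp p (J.rePart N)) V₁
  /-- the factor of `q(B)` -/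
  fac₂ : HilbertFactor J (polyOp q (J.imPart N)) V₂

/-- Every normal definitizable operator admits Hilbert spaces and injections as above. -/
theorem exists_model (J : FundamentalSymmetry K) (D : DefinitizableNormal J) :
    ∃ (W W₁ W₂ : Submodule ℂ K) (_ : CompleteSpace W) (_ : CompleteSpace W₁)
      (_ : CompleteSpace W₂) (M : Model J W W₁ W₂), M.toDefinitizableNormal = D := by
  obtain ⟨W₁, i₁, ⟨f₁⟩⟩ := HilbertFactor.exists_of_nonneg J _ D.definitizing_re.2
  obtain ⟨W₂, i₂, ⟨f₂⟩⟩ := HilbertFactor.exists_of_nonneg J _ D.definitizing_im.2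
  obtain ⟨W, i, ⟨f⟩⟩ := HilbertFactor.exists_of_nonneg J
    (polyOp D.p (J.rePart D.N) + polyOp D.q (J.imPart D.N)) (fun x => by
      have h := add_nonneg (D.definitizing_re.2 x) (D.definitizing_im.2 x)
      simpa [FundamentalSymmetry.form, inner_add_right] using h)
  exact ⟨W, W₁, W₂, i, i₁, i₂, ⟨D, f, f₁, f₂⟩, rfl⟩

namespace Model

variable {J : FundamentalSymmetry K} (M : Model J V V₁ V₂)

/-- The operator `Θ(N)` on the Hilbert space `V`. -/
def thetaN : V →L[ℂ] V := theta M.fac.T M.N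

/-- The spectrum `σ(Θ(N))`. -/
def σΘ : Set ℂ := spectrum ℂ M.thetaN

/-- The functions on `(σ(Θ(N)) ∪ (Z^ℝ_p + i Z^ℝ_q)) ⊔ Z^i`. -/
abbrev Fun : Type := MFun M.p M.q M.σΘ

/-- The integral of `g` with respect to the spectral measure `E` of `Θ(N)`: the sum of
`∫ g dE` over `σ(Θ(N)) \ (Z^ℝ_p + i Z^ℝ_q)` and of
`g(w)₁ R₁ R₁^* E{w} + g(w)₂ R₂ R₂^* E{w}` over `w ∈ σ(Θ(N)) ∩ (Z^ℝ_p + i Z^ℝ_q)`. -/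
def integral (g : GFun M.p M.q M.σΘ) : V →L[ℂ] V :=
  spectralIntegral M.thetaN (Function.extend Subtype.val g.reg 0) +
    ∑ᶠ w : ↥(M.σΘ ∩ crit M.p M.q),
      ((g.pair w).1 • (transferSq J M.fac.T M.fac₁.T * spectralProj M.thetaN {(w : ℂ)}) +
        (g.pair w).2 • (transferSq J M.fac.T M.fac₂.T * spectralProj M.thetaN {(w : ℂ)}))

/-- `X = s(A, B) + T (∫ g dE) T^*` for some decomposition `(s, g)` of `φ`. -/
def IsValue (φ : M.Fun) (X : K →L[ℂ] K) : Prop :=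
  ∃ (s : MvPolynomial (Fin 2) ℂ) (g : GFun M.p M.q M.σΘ), IsDecomposition φ s g ∧
    X = polyOp₂ s (J.rePart M.N) (J.imPart M.N) +
      M.fac.T.comp ((M.integral g).comp (J.adjFrom M.fac.T))

/-- The operator `φ(N)`, that is the unique `X` as in `IsValue`. -/
def funCalc (φ : M.Fun) : K →L[ℂ] K := Classical.epsilon (M.IsValue φ)

/-- The set `σ_N`: the disjoint union of `σ(Θ(N)) ∪ ((Z^ℝ_p + i Z^ℝ_q) ∩ σ(N))` and of the set of all
`(α, β) ∈ Z^i` such that `α + i β` and `ᾱ + i β̄` belong to `σ(N)`. -/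
def sigmaN : Set (ℂ ⊕ ℂ × ℂ) :=
  Sum.inl '' (M.σΘ ∪ (crit M.p M.q ∩ spectrum ℂ M.N)) ∪
  Sum.inr '' {ζ | ζ ∈ nonrealPairs M.p M.q ∧ ζ.1 + Complex.I * ζ.2 ∈ spectrum ℂ M.N ∧
    (starRingEnd ℂ) ζ.1 + Complex.I * (starRingEnd ℂ) ζ.2 ∈ spectrum ℂ M.N}

end Model

end Calculus

end KreinCalc

end

namespace KreinCalc

/-! ### Polynomials in two variables -/

section Polynomials

open MvPolynomial

/-! Write `G₁ = R₁R₁^*`, `G₂ = R₂R₂^*`. The link between the two spaces is that `T` intertwines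
polynomials of `Θ(N)` and its adjoint with polynomials of `(A, B)` (`T_polyTheta`), that `T^*T` is
`p + q` evaluated on `V` (`adjFrom_T`), and that `T G₁ T^* = p(A)`, `T G₂ T^* = q(B)`. So `G₁` and
`G₂` behave like `p/(p+q)` and `q/(p+q)`. They are contractions, whence `|p|, |q| ≤ |p+q|` on
`σ(Θ(N))`: there `p + q` vanishes only on `Z` and can serve as a denominator.

Existence (`exists_isDecomposition`): Hermite interpolation supplies `s`, and `g = (φ - s)/(p + q)`
off `Z`. Near a critical point the growth condition bounds the numerator by the same maximum of
powers that bounds `|p + q|` from below; compactness of the spectrum does the rest.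

Independence (`value_eq_zero`): a difference of two decompositions of `φ` decomposes `0`. Then all
jets of `s` vanish at all pairs of complex zeros, so `s = u p(z) + v q(w)`, and the value is `T Y
T^*` with `Y = u(Θ)G₁ + v(Θ)G₂ + ∫ g dE`. Multiplied by `(p+q)(Θ)`, `Y` becomes the integral of `up
+ vq + (p+q)g = 0`; on each `E{w}`, `w` critical, it vanishes because the entries `(m,0)` and
`(0,n)` force `g(w) = (-u(w), -v(w))`. These two facts give `Y = 0`.

Vanishing on `σ_N` (`value_eq_zero_of_eqOn`): at a pair of zeros outside `σ_N`, `N - (α + iβ)` or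
its counterpart for `N^*` is invertible, and a high power of the corresponding linear polynomial
kills the jet there. The product `r` of these powers makes `(rs, rg)` a decomposition of `0`, so
`r(A,B)` times the value is `0`, and `r(A,B)` is invertible. -/

/-- The substitution `(z, w) ↦ (z + a, w + b)`. -/
noncomputable def shift (a b : ℂ) : MvPolynomial (Fin 2) ℂ →ₐ[ℂ] MvPolynomial (Fin 2) ℂ :=
  aeval ![X 0 + C a, X 1 + C b]

@[simp] theorem shift_X_zero (a b : ℂ) : shift a b (X 0) = X 0 + C a := by simp [shift]

@[simp] theorem shift_X_one (a b : ℂ) : shift a b (X 1) = X 1 + C b := by simp [shift]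

@[simp] theorem shift_C (a b c : ℂ) : shift a b (C c) = C c := by simp [shift]

theorem pderiv_shift (a b : ℂ) (i : Fin 2) (s : MvPolynomial (Fin 2) ℂ) :
    pderiv i (shift a b s) = shift a b (pderiv i s) := by
  induction s using MvPolynomial.induction_on with
  | C c => simp
  | add s t hs ht => simp [hs, ht]
  | mul_X s j hs =>
    rw [map_mul, pderiv_mul, pderiv_mul, map_add, map_mul, map_mul, hs]
    congr 2
    fin_cases i <;> fin_cases j <;> simp [pderiv_X]

theorem pderiv_iterate_shift (a b : ℂ) (i : Fin 2) (k : ℕ) (s : MvPolynomial (Fin 2) ℂ) :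
    (⇑(pderiv (R := ℂ) i))^[k] (shift a b s) = shift a b ((⇑(pderiv (R := ℂ) i))^[k] s) := by
  induction k with
  | zero => rfl
  | succ k ih => rw [Function.iterate_succ_apply', Function.iterate_succ_apply', ih, pderiv_shift]

/-- At `m i = 0` the rising factorial is `k!`, which cancels the denominator in `taylorCoeff`. -/
theorem coeff_pderiv_iterate (i : Fin 2) (k : ℕ) (s : MvPolynomial (Fin 2) ℂ) (m : Fin 2 →₀ ℕ) :
    coeff m ((⇑(pderiv (R := ℂ) i))^[k] s) =
      coeff (m + Finsupp.single i k) s * (m i + 1).ascFactorial k := by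
  induction k generalizing m with
  | zero => simp
  | succ k ih =>
    rw [Function.iterate_succ_apply', coeff_pderiv, ih]
    have h : m + Finsupp.single i 1 + Finsupp.single i k = m + Finsupp.single i (k + 1) := by
      rw [add_assoc, ← Finsupp.single_add, add_comm 1 k]
    have h' := Nat.succ_ascFactorial (m i + 1) k
    rw [h, Nat.ascFactorial_succ, ← h']
    simp
    ring

theorem eval_shift (a b x y : ℂ) (s : MvPolynomial (Fin 2) ℂ) :
    eval ![x, y] (shift a b s) = eval ![x + a, y + b] s := by
  induction s using MvPolynomial.induction_on with
  | C c => simp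
  | add s t hs ht => simp [hs, ht]
  | mul_X s j hs =>
    rw [map_mul, map_mul, map_mul, hs]
    fin_cases j <;> simp

/-- Derivatives commute with translation, so the expansion point can be moved to the origin, where
jet conditions become conditions on monomials. -/
theorem taylorCoeff_eq_coeff (s : MvPolynomial (Fin 2) ℂ) (k l : ℕ) (a b : ℂ) :
    taylorCoeff s k l a b = coeff (Finsupp.single 0 k + Finsupp.single 1 l) (shift a b s) := by
  have h := eval_shift a b 0 0 ((⇑(pderiv (R := ℂ) (0 : Fin 2)))^[k]
        ((⇑(pderiv (R := ℂ) (1 : Fin 2)))^[l] s))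
  have h0 : (![0, 0] : Fin 2 → ℂ) = 0 := by ext i; fin_cases i <;> rfl
  rw [← pderiv_iterate_shift, ← pderiv_iterate_shift, zero_add, zero_add, h0] at h
  rw [taylorCoeff, ← h]
  have h1 : ∀ t : MvPolynomial (Fin 2) ℂ, eval 0 t = coeff 0 t := fun t => by
    rw [← constantCoeff_eq, eval_zero]
  rw [h1, coeff_pderiv_iterate, coeff_pderiv_iterate]
  simp [Nat.one_ascFactorial]
  have := Nat.factorial_ne_zero k
  have := Nat.factorial_ne_zero l
  field_simp

theorem shift_neg_shift (a b : ℂ) (s : MvPolynomial (Fin 2) ℂ) :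
    shift (-a) (-b) (shift a b s) = s := by
  induction s using MvPolynomial.induction_on with
  | C c => simp
  | add s t hs ht => simp [hs, ht]
  | mul_X s j hs =>
    rw [map_mul, map_mul, hs]
    fin_cases j <;> simp

/-! ### Jet ideals at a point -/

/-- The ideal generated by `(z - a) ^ m` and `(w - b) ^ n`. -/
noncomputable def jetIdeal (a b : ℂ) (m n : ℕ) : Ideal (MvPolynomial (Fin 2) ℂ) :=
  Ideal.span {(X 0 - C a) ^ m, (X 1 - C b) ^ n}

theorem mem_jetIdeal {a b : ℂ} {m n : ℕ} {s : MvPolynomial (Fin 2) ℂ} :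
    s ∈ jetIdeal a b m n ↔ ∃ u v, u * (X 0 - C a) ^ m + v * (X 1 - C b) ^ n = s :=
  Ideal.mem_span_pair

theorem coeff_mul_X_pow_add (u v : MvPolynomial (Fin 2) ℂ) (m n k l : ℕ) :
    coeff (Finsupp.single 0 k + Finsupp.single 1 l) (u * X 0 ^ m + v * X 1 ^ n) =
      (if m ≤ k then coeff (Finsupp.single 0 (k - m) + Finsupp.single 1 l) u else 0) +
      (if n ≤ l then coeff (Finsupp.single 0 k + Finsupp.single 1 (l - n)) v else 0) := by
  rw [coeff_add, X_pow_eq_monomial, X_pow_eq_monomial, coeff_mul_monomial', coeff_mul_monomial']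
  congr 1
  · have h : Finsupp.single (0 : Fin 2) m ≤ Finsupp.single 0 k + Finsupp.single 1 l ↔ m ≤ k := by
      rw [Finsupp.single_le_iff]; simp
    simp only [h, mul_one]
    split_ifs with hm
    · congr 1
      ext i; fin_cases i <;> simp
    · rfl
  · have h : Finsupp.single (1 : Fin 2) n ≤ Finsupp.single 0 k + Finsupp.single 1 l ↔ n ≤ l := by
      rw [Finsupp.single_le_iff]; simp
    simp only [h, mul_one]
    split_ifs with hm
    · congr 1
      ext i; fin_cases i <;> simp
    · rfl

/-- Multiplication by a pure power only shifts one index. Both terms drop out for `k < m`, `l < n`;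
for positive `m`, `n`, the indices `(m, 0)` and `(0, n)` read off `u(a,b)` and `v(a,b)`. -/
theorem taylorCoeff_combination (u v : MvPolynomial (Fin 2) ℂ) (a b : ℂ) (m n k l : ℕ) :
    taylorCoeff (u * (X 0 - C a) ^ m + v * (X 1 - C b) ^ n) k l a b =
      (if m ≤ k then taylorCoeff u (k - m) l a b else 0) +
      (if n ≤ l then taylorCoeff v k (l - n) a b else 0) := by
  simp only [taylorCoeff_eq_coeff, map_add, map_mul, map_pow, map_sub, shift_X_zero, shift_X_one,
    shift_C, add_sub_cancel_right]
  exact coeff_mul_X_pow_add _ _ _ _ _ _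

theorem taylorCoeff_zero_zero (s : MvPolynomial (Fin 2) ℂ) (a b : ℂ) :
    taylorCoeff s 0 0 a b = eval ![a, b] s := by simp [taylorCoeff]

theorem taylorCoeff_sub (s t : MvPolynomial (Fin 2) ℂ) (k l : ℕ) (a b : ℂ) :
    taylorCoeff (s - t) k l a b = taylorCoeff s k l a b - taylorCoeff t k l a b := by
  simp [taylorCoeff_eq_coeff]

/-- After translation the ideal is monomial, so membership is tested monomial by monomial; the
hypothesis removes exactly those divisible by neither generator. -/
theorem mem_jetIdeal_iff {a b : ℂ} {m n : ℕ} {s : MvPolynomial (Fin 2) ℂ} :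
    s ∈ jetIdeal a b m n ↔ ∀ k < m, ∀ l < n, taylorCoeff s k l a b = 0 := by
  constructor
  · rintro h k hk l hl
    obtain ⟨u, v, rfl⟩ := mem_jetIdeal.mp h
    rw [taylorCoeff_combination, if_neg (by omega), if_neg (by omega), add_zero]
  · intro h
    have h1 : shift a b s ∈ Ideal.span {(X 0 : MvPolynomial (Fin 2) ℂ) ^ m, X 1 ^ n} := by
      rw [(shift a b s).as_sum]
      refine Ideal.sum_mem _ fun d hd => ?_
      have hd0 : d = Finsupp.single 0 (d 0) + Finsupp.single 1 (d 1) := by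
        ext i; fin_cases i <;> simp
      by_cases h0 : d 0 < m
      · by_cases h1 : d 1 < n
        · have h2 := h _ h0 _ h1
          rw [taylorCoeff_eq_coeff, ← hd0] at h2
          simp [h2]
        · refine Ideal.mem_of_dvd _ ?_ (Ideal.subset_span (Set.mem_insert_of_mem _ rfl))
          rw [X_pow_eq_monomial, monomial_dvd_monomial]
          refine ⟨Or.inr ?_, one_dvd _⟩
          rw [Finsupp.single_le_iff]; omega
      · refine Ideal.mem_of_dvd _ ?_ (Ideal.subset_span (Set.mem_insert _ _))
        rw [X_pow_eq_monomial, monomial_dvd_monomial]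
        refine ⟨Or.inr ?_, one_dvd _⟩
        rw [Finsupp.single_le_iff]; omega
    obtain ⟨u, v, huv⟩ := Ideal.mem_span_pair.mp h1
    refine mem_jetIdeal.mpr ⟨shift (-a) (-b) u, shift (-a) (-b) v, ?_⟩
    rw [← shift_neg_shift a b s, ← huv]
    simp [sub_eq_add_neg]

/-- The polynomial with Taylor coefficients `c k l`, `k < m`, `l < n`, at `(a, b)`. -/
noncomputable def taylorPoly (a b : ℂ) (m n : ℕ) (c : ℕ → ℕ → ℂ) : MvPolynomial (Fin 2) ℂ :=
  ∑ k ∈ Finset.range m, ∑ l ∈ Finset.range n, C (c k l) * (X 0 - C a) ^ k * (X 1 - C b) ^ l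

theorem taylorCoeff_taylorPoly (a b : ℂ) (m n : ℕ) (c : ℕ → ℕ → ℂ) {k l : ℕ} (hk : k < m)
    (hl : l < n) : taylorCoeff (taylorPoly a b m n c) k l a b = c k l := by
  have h : ∀ i j : ℕ, coeff (Finsupp.single 0 k + Finsupp.single 1 l)
      (C (c i j) * (X (0 : Fin 2)) ^ i * X 1 ^ j) = if i = k then if j = l then c i j else 0 else 0 := by
    intro i j
    rw [X_pow_eq_monomial, X_pow_eq_monomial, mul_assoc, monomial_mul, C_mul_monomial, coeff_monomial]
    have : (Finsupp.single (0 : Fin 2) i + Finsupp.single 1 j =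
        Finsupp.single 0 k + Finsupp.single 1 l) ↔ i = k ∧ j = l := by
      constructor
      · intro h
        have h0 := DFunLike.congr_fun h 0
        have h1 := DFunLike.congr_fun h 1
        simpa using And.intro h0 h1
      · rintro ⟨rfl, rfl⟩; rfl
    simp only [this, mul_one]
    split_ifs <;> simp_all
  simp only [taylorCoeff_eq_coeff, taylorPoly, map_sum, map_mul, map_pow, map_sub, shift_X_zero,
    shift_X_one, shift_C, add_sub_cancel_right, coeff_sum, h]
  simp [hk, hl]

theorem sub_taylorPoly_mem (s : MvPolynomial (Fin 2) ℂ) (a b : ℂ) (m n : ℕ) :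
    s - taylorPoly a b m n (fun k l => taylorCoeff s k l a b) ∈ jetIdeal a b m n := by
  rw [mem_jetIdeal_iff]
  intro k hk l hl
  rw [taylorCoeff_sub, taylorCoeff_taylorPoly _ _ _ _ _ hk hl, sub_self]

/-! ### Gluing jets at different zeros (Chinese remainder argument) -/

/-- Polynomials which form a partition of unity with respect to the zeros of `p`. -/
theorem exists_partition (p : Polynomial ℂ) (hp : p ≠ 0) : ∃ e : ℂ → Polynomial ℂ,
    p ∣ 1 - ∑ α ∈ p.roots.toFinset, e α ∧
    (∀ α, p ∣ e α * (Polynomial.X - Polynomial.C α) ^ p.rootMultiplicity α) ∧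
    ∀ α α', α' ∈ p.roots.toFinset → α' ≠ α →
      (Polynomial.X - Polynomial.C α') ^ p.rootMultiplicity α' ∣ e α := by
  classical
  set S := p.roots.toFinset
  let f : ℂ → Polynomial ℂ := fun α => (Polynomial.X - Polynomial.C α) ^ p.rootMultiplicity α
  have hprod : p = Polynomial.C p.leadingCoeff * ∏ α ∈ S, f α := by
    have h := (IsAlgClosed.splits p).eq_prod_roots
    conv_lhs => rw [h]
    rw [Finset.prod_multiset_map_count]
    simp only [Polynomial.count_roots, f, S]
  have hlc : IsUnit (Polynomial.C p.leadingCoeff) :=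
    Polynomial.isUnit_C.mpr (isUnit_iff_ne_zero.mpr (Polynomial.leadingCoeff_ne_zero.mpr hp))
  have hdvd : ∀ t, p ∣ t ↔ ∏ α ∈ S, f α ∣ t := fun t => by
    conv_lhs => rw [hprod]
    exact hlc.mul_left_dvd
  -- Bézout for the pairwise coprime prime powers of `p`; it needs at least one root.
  have hco : (Finset.univ : Finset S).Nonempty → ∃ μ : S → Polynomial ℂ,
      ∑ i : S, μ i * ∏ j ∈ ({i}ᶜ : Finset S), f j = 1 := by
    intro hne
    have : Nonempty S := ⟨hne.choose⟩
    refine exists_sum_eq_one_iff_pairwise_coprime'.mpr ?_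
    intro i j hij
    exact (Polynomial.pairwise_coprime_X_sub_C Subtype.val_injective hij).pow
  by_cases hS : S.Nonempty
  · obtain ⟨μ, hμ⟩ := hco ⟨⟨_, hS.choose_spec⟩, Finset.mem_univ _⟩
    -- `e α` carries every prime power of `p` except the one at `α`. The value `0` at non-roots
    -- makes the divisibility claims hold for all `α`.
    let e : ℂ → Polynomial ℂ := fun α =>
      if h : α ∈ S then μ ⟨α, h⟩ * ∏ j ∈ S.erase α, f j else 0
    refine ⟨e, ?_, ?_, ?_⟩
    · have : ∑ α ∈ S, e α = 1 := by
        rw [← hμ, ← Finset.sum_coe_sort S e]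
        refine Finset.sum_congr rfl fun i _ => ?_
        simp only [e, i.2, dif_pos]
        congr 1
        refine Finset.prod_bij' (fun a ha => ⟨a, Finset.mem_of_mem_erase ha⟩) (fun a _ => a.1)
          ?_ ?_ ?_ ?_ ?_
        · intro a ha; simp only [Finset.mem_compl, Finset.mem_singleton]
          intro h; exact Finset.ne_of_mem_erase ha (congrArg Subtype.val h)
        · intro a ha; simp only [Finset.mem_compl, Finset.mem_singleton] at ha
          exact Finset.mem_erase.mpr ⟨fun h => ha (Subtype.ext h), a.2⟩
        · intros; rfl
        · intros; rfl
        · intros; rfl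
      rw [this, sub_self]; exact dvd_zero _
    · intro α
      by_cases h : α ∈ S
      · rw [hdvd, ← Finset.mul_prod_erase S f h]
        simp only [e, h, dif_pos]
        exact ⟨μ ⟨α, h⟩, by simp only [f]; ring⟩
      · simp [e, h]
    · intro α α' h' hne
      by_cases h : α ∈ S
      · simp only [e, h, dif_pos]
        exact Dvd.dvd.mul_left (Finset.dvd_prod_of_mem f (Finset.mem_erase.mpr ⟨hne, h'⟩)) _
      · simp [e, h]
  -- Without roots `p` is a nonzero constant and divides everything.
  · rw [Finset.not_nonempty_iff_eq_empty] at hS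
    refine ⟨fun _ => 0, ?_, by simp, by simp⟩
    rw [hdvd, hS]; simp

/-- A polynomial in the first variable. -/
noncomputable def inZ : Polynomial ℂ →ₐ[ℂ] MvPolynomial (Fin 2) ℂ := Polynomial.aeval (X 0)

/-- A polynomial in the second variable. -/
noncomputable def inW : Polynomial ℂ →ₐ[ℂ] MvPolynomial (Fin 2) ℂ := Polynomial.aeval (X 1)

theorem inZ_X_sub_C_pow (a : ℂ) (m : ℕ) :
    inZ ((Polynomial.X - Polynomial.C a) ^ m) = (X 0 - C a) ^ m := by
  simp [inZ, algebraMap_eq]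

theorem inW_X_sub_C_pow (a : ℂ) (m : ℕ) :
    inW ((Polynomial.X - Polynomial.C a) ^ m) = (X 1 - C a) ^ m := by
  simp [inW, algebraMap_eq]

theorem inZ_mem_jetIdeal {p : Polynomial ℂ} {a : ℂ} {m : ℕ}
    (h : (Polynomial.X - Polynomial.C a) ^ m ∣ p) (b : ℂ) (n : ℕ) : inZ p ∈ jetIdeal a b m n := by
  obtain ⟨t, rfl⟩ := h
  rw [map_mul, inZ_X_sub_C_pow]
  exact Ideal.mul_mem_right _ _ (Ideal.subset_span (Set.mem_insert _ _))

theorem inW_mem_jetIdeal {q : Polynomial ℂ} {b : ℂ} {n : ℕ}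
    (h : (Polynomial.X - Polynomial.C b) ^ n ∣ q) (a : ℂ) (m : ℕ) : inW q ∈ jetIdeal a b m n := by
  obtain ⟨t, rfl⟩ := h
  rw [map_mul, inW_X_sub_C_pow]
  exact Ideal.mul_mem_right _ _ (Ideal.subset_span (Set.mem_insert_of_mem _ rfl))

/-- A polynomial all whose jets at the pairs of zeros vanish belongs to the ideal generated
by `p(z)` and `q(w)`. -/
theorem exists_combination_of_mem_jetIdeal {p q : Polynomial ℂ} (hp : p ≠ 0) (hq : q ≠ 0)
    {r : MvPolynomial (Fin 2) ℂ}
    (h : ∀ α β, p.IsRoot α → q.IsRoot β →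
      r ∈ jetIdeal α β (p.rootMultiplicity α) (q.rootMultiplicity β)) :
    ∃ u v, r = u * inZ p + v * inW q := by
  obtain ⟨e, he1, he2, -⟩ := exists_partition p hp
  obtain ⟨f, hf1, hf2, -⟩ := exists_partition q hq
  set I : Ideal (MvPolynomial (Fin 2) ℂ) := Ideal.span {inZ p, inW q}
  have hP : ∀ t, p ∣ t → inZ t ∈ I := fun t ht =>
    Ideal.mem_of_dvd _ (map_dvd inZ ht) (Ideal.subset_span (Set.mem_insert _ _))
  have hQ : ∀ t, q ∣ t → inW t ∈ I := fun t ht =>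
    Ideal.mem_of_dvd _ (map_dvd inW ht) (Ideal.subset_span (Set.mem_insert_of_mem _ rfl))
  -- In `r = u (z-α)^m + v (w-β)^n` the factor `e α` completes the first power to a multiple of `p`,
  -- and `f β` the second to a multiple of `q`.
  have hmem : ∀ α ∈ p.roots.toFinset, ∀ β ∈ q.roots.toFinset,
      inZ (e α) * inW (f β) * r ∈ I := by
    intro α hα β hβ
    have hα' : p.IsRoot α := Polynomial.isRoot_of_mem_roots (Multiset.mem_toFinset.mp hα)
    have hβ' : q.IsRoot β := Polynomial.isRoot_of_mem_roots (Multiset.mem_toFinset.mp hβ)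
    obtain ⟨u, v, huv⟩ := mem_jetIdeal.mp (h α β hα' hβ')
    have h1 := hP _ (he2 α)
    have h2 := hQ _ (hf2 β)
    rw [map_mul, inZ_X_sub_C_pow] at h1
    rw [map_mul, inW_X_sub_C_pow] at h2
    have h3 := I.add_mem (I.mul_mem_left (inW (f β) * u) h1) (I.mul_mem_left (inZ (e α) * v) h2)
    rw [← huv]
    convert h3 using 1
    ring
  -- Split `r = r(1 - Σe) + r Σe (1 - Σf) + ΣΣ e f r`; each part lies in the ideal.
  have hr : r ∈ I := by
    have h1 := I.mul_mem_left r (hP _ he1)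
    have h2 := I.mul_mem_left (r * inZ (∑ α ∈ p.roots.toFinset, e α)) (hQ _ hf1)
    have h3 : ∑ α ∈ p.roots.toFinset, ∑ β ∈ q.roots.toFinset, inZ (e α) * inW (f β) * r ∈ I :=
      I.sum_mem fun α hα => I.sum_mem fun β hβ => hmem α hα β hβ
    have h4 := I.add_mem (I.add_mem h1 h2) h3
    convert h4 using 1
    simp only [map_sub, map_one, map_sum]
    have h5 : ∑ α ∈ p.roots.toFinset, ∑ β ∈ q.roots.toFinset, inZ (e α) * inW (f β) * r =
      r * (∑ α ∈ p.roots.toFinset, inZ (e α)) * ∑ β ∈ q.roots.toFinset, inW (f β) := by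
      rw [mul_assoc, Finset.sum_mul_sum, Finset.mul_sum]
      refine Finset.sum_congr rfl fun α _ => ?_
      rw [Finset.mul_sum]
      exact Finset.sum_congr rfl fun β _ => by ring
    rw [h5]; ring
  obtain ⟨u, v, huv⟩ := Ideal.mem_span_pair.mp hr
  exact ⟨u, v, huv.symm⟩

/-- Hermite interpolation in two variables. -/
theorem exists_interpolation {p q : Polynomial ℂ} (hp : p ≠ 0) (hq : q ≠ 0)
    (c : ℂ → ℂ → ℕ → ℕ → ℂ) : ∃ s : MvPolynomial (Fin 2) ℂ, ∀ α β, p.IsRoot α → q.IsRoot β →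
      ∀ k < p.rootMultiplicity α, ∀ l < q.rootMultiplicity β, taylorCoeff s k l α β = c α β k l := by
  obtain ⟨e, he1, -, he3⟩ := exists_partition p hp
  obtain ⟨f, hf1, -, hf3⟩ := exists_partition q hq
  let t : ℂ → ℂ → MvPolynomial (Fin 2) ℂ := fun α β =>
    taylorPoly α β (p.rootMultiplicity α) (q.rootMultiplicity β) (c α β)
  refine ⟨∑ α ∈ p.roots.toFinset, ∑ β ∈ q.roots.toFinset, inZ (e α) * inW (f β) * t α β, ?_⟩
  intro α β hα hβ k hk l hl
  have hα' : α ∈ p.roots.toFinset := Multiset.mem_toFinset.mpr ((Polynomial.mem_roots hp).mpr hα)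
  have hβ' : β ∈ q.roots.toFinset := Multiset.mem_toFinset.mpr ((Polynomial.mem_roots hq).mpr hβ)
  rw [← taylorCoeff_taylorPoly α β _ _ (c α β) hk hl, ← sub_eq_zero, ← taylorCoeff_sub]
  refine mem_jetIdeal_iff.mp ?_ k hk l hl
  change _ - t α β ∈ _
  set I := jetIdeal α β (p.rootMultiplicity α) (q.rootMultiplicity β)
  have hP : ∀ x, (Polynomial.X - Polynomial.C α) ^ p.rootMultiplicity α ∣ x → inZ x ∈ I :=
    fun x hx => inZ_mem_jetIdeal hx _ _
  have hQ : ∀ x, (Polynomial.X - Polynomial.C β) ^ q.rootMultiplicity β ∣ x → inW x ∈ I :=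
    fun x hx => inW_mem_jetIdeal hx _ _
  have hz : ∀ a ∈ p.roots.toFinset, a ≠ α → inZ (e a) ∈ I := fun a _ ha =>
    hP _ (he3 a α hα' (Ne.symm ha))
  have hw : ∀ b ∈ q.roots.toFinset, b ≠ β → inW (f b) ∈ I := fun b _ hb =>
    hQ _ (hf3 b β hβ' (Ne.symm hb))
  -- Modulo the jet ideal at `(α, β)` all other members of the partition vanish, so `e α` is
  -- congruent to `1`; likewise `f β`. Only the local Taylor polynomial at `(α, β)` survives.
  have hz1 : 1 - inZ (e α) ∈ I := by
    have h1 := hP _ ((Polynomial.pow_rootMultiplicity_dvd p α).trans he1)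
    rw [← Finset.add_sum_erase _ _ hα'] at h1
    have h2 : ∑ a ∈ p.roots.toFinset.erase α, inZ (e a) ∈ I := I.sum_mem fun a ha =>
      hz a (Finset.mem_of_mem_erase ha) (Finset.ne_of_mem_erase ha)
    have h3 := I.add_mem h1 h2
    convert h3 using 1
    simp only [map_sub, map_add, map_one, map_sum]
    ring
  have hw1 : 1 - inW (f β) ∈ I := by
    have h1 := hQ _ ((Polynomial.pow_rootMultiplicity_dvd q β).trans hf1)
    rw [← Finset.add_sum_erase _ _ hβ'] at h1
    have h2 : ∑ b ∈ q.roots.toFinset.erase β, inW (f b) ∈ I := I.sum_mem fun b hb =>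
      hw b (Finset.mem_of_mem_erase hb) (Finset.ne_of_mem_erase hb)
    have h3 := I.add_mem h1 h2
    convert h3 using 1
    simp only [map_sub, map_add, map_one, map_sum]
    ring
  rw [← Finset.add_sum_erase _ _ hα', ← Finset.add_sum_erase _ _ hβ']
  have h1 : ∑ a ∈ p.roots.toFinset.erase α, ∑ b ∈ q.roots.toFinset,
      inZ (e a) * inW (f b) * t a b ∈ I :=
    I.sum_mem fun a ha => I.sum_mem fun b _ => I.mul_mem_right _ (I.mul_mem_right _
      (hz a (Finset.mem_of_mem_erase ha) (Finset.ne_of_mem_erase ha)))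
  have h2 : ∑ b ∈ q.roots.toFinset.erase β, inZ (e α) * inW (f b) * t α b ∈ I :=
    I.sum_mem fun b hb => I.mul_mem_right _ (I.mul_mem_left _
      (hw b (Finset.mem_of_mem_erase hb) (Finset.ne_of_mem_erase hb)))
  have h3 : inZ (e α) * inW (f β) * t α β - t α β ∈ I := by
    have h4 := I.add_mem (I.mul_mem_left (-t α β) hz1) (I.mul_mem_left (-t α β * inZ (e α)) hw1)
    convert h4 using 1
    ring
  have h5 := I.add_mem h3 (I.add_mem h2 h1)
  convert h5 using 1
  ring

end Polynomials

end KreinCalc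

namespace KreinCalc

/-! ### Integrals of bounded Borel functions with respect to the spectral measure -/

section SpectralIntegral

set_option linter.unusedSectionVars false

open MeasureTheory Filter

variable {V : Type*} [NormedAddCommGroup V] [InnerProductSpace ℂ V] [CompleteSpace V]

theorem scalarFunctional_apply (D : V →L[ℂ] V) (x : V) (f : C_c(ℂ, ℝ)) :
    scalarFunctional D x f = (⟪x, cfc (fun z => (f z : ℂ)) D x⟫_ℂ).re := rfl

instance (D : V →L[ℂ] V) (x : V) : (scalarMeasure D x).Regular := by
  unfold scalarMeasure; infer_instance

/-- By inner regularity it suffices to treat compact sets off the spectrum. A Urysohn function equal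
to `1` on such a set and `0` on the spectrum has zero functional calculus and dominates its measure.
-/
theorem scalarMeasure_compl_spectrum (D : V →L[ℂ] V) (x : V) :
    scalarMeasure D x (spectrum ℂ D)ᶜ = 0 := by
  have hclosed : IsClosed (spectrum ℂ D) := spectrum.isClosed D
  rw [hclosed.isOpen_compl.measure_eq_iSup_isCompact, ← nonpos_iff_eq_zero]
  refine iSup₂_le fun C hC => iSup_le fun hcomp => ?_
  obtain ⟨f, hf1, hf0, hfc, hf01⟩ := exists_continuous_one_zero_of_isCompact hcomp hclosed
    (Set.disjoint_left.mpr fun z hz => hC hz)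
  refine (RealRMK.rieszMeasure_le_of_eq_one (Λ := scalarFunctional D x) (f := ⟨f, hfc⟩)
    (fun z => (hf01 z).1) hcomp (fun z hz => hf1 hz)).trans ?_
  have h : cfc (fun z => ((f z : ℝ) : ℂ)) D = 0 := by
    rw [cfc_congr (g := fun _ => (0 : ℂ)) (fun z hz => by simpa using hf0 hz)]
    simp
  rw [scalarFunctional_apply]
  change ENNReal.ofReal (⟪x, cfc (fun z => ((f z : ℝ) : ℂ)) D x⟫_ℂ).re ≤ 0
  rw [h]; simp

instance (D : V →L[ℂ] V) (x : V) : IsFiniteMeasure (scalarMeasure D x) := by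
  refine ⟨?_⟩
  rw [← Set.union_compl_self (spectrum ℂ D)]
  refine (measure_union_le _ _).trans_lt ?_
  rw [scalarMeasure_compl_spectrum, add_zero]
  exact (spectrum.isCompact D).measure_lt_top

theorem ae_mem_spectrum (D : V →L[ℂ] V) (x : V) : ∀ᵐ z ∂(scalarMeasure D x), z ∈ spectrum ℂ D :=
  scalarMeasure_compl_spectrum D x

/-- Borel functions which are bounded on the spectrum of `D`. -/
structure IsSpectral (D : V →L[ℂ] V) (g : ℂ → ℂ) : Prop where
  measurable : Measurable g
  bounded : ∃ C : ℝ, ∀ z ∈ spectrum ℂ D, ‖g z‖ ≤ C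

namespace IsSpectral

variable {D : V →L[ℂ] V} {g h : ℂ → ℂ}

theorem of_continuous (D : V →L[ℂ] V) {f : ℂ → ℂ} (hf : Continuous f) : IsSpectral D f :=
  ⟨hf.measurable, (spectrum.isCompact D).exists_bound_of_continuousOn hf.continuousOn⟩

theorem add (hg : IsSpectral D g) (hh : IsSpectral D h) : IsSpectral D (fun z => g z + h z) := by
  obtain ⟨C, hC⟩ := hg.bounded
  obtain ⟨C', hC'⟩ := hh.bounded
  exact ⟨hg.measurable.add hh.measurable, C + C', fun z hz =>
    (norm_add_le _ _).trans (add_le_add (hC z hz) (hC' z hz))⟩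

theorem mul (hg : IsSpectral D g) (hh : IsSpectral D h) : IsSpectral D (fun z => g z * h z) := by
  obtain ⟨C, hC⟩ := hg.bounded
  obtain ⟨C', hC'⟩ := hh.bounded
  exact ⟨hg.measurable.mul hh.measurable, C * C', fun z hz => by
    rw [norm_mul]
    exact mul_le_mul (hC z hz) (hC' z hz) (norm_nonneg _) ((norm_nonneg _).trans (hC z hz))⟩

theorem const_mul (c : ℂ) (hg : IsSpectral D g) : IsSpectral D (fun z => c * g z) :=
  (of_continuous D continuous_const).mul hg

theorem indicator_one (D : V →L[ℂ] V) {Δ : Set ℂ} (hΔ : MeasurableSet Δ) :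
    IsSpectral D (Δ.indicator fun _ => 1) := by
  refine ⟨measurable_const.indicator hΔ, 1, fun z _ => ?_⟩
  by_cases hz : z ∈ Δ <;> simp [hz]

theorem integrable (hg : IsSpectral D g) (x : V) : Integrable g (scalarMeasure D x) := by
  obtain ⟨C, hC⟩ := hg.bounded
  exact Integrable.of_bound hg.measurable.aestronglyMeasurable C
    ((ae_mem_spectrum D x).mono fun z hz => hC z hz)

end IsSpectral

/-- The Riesz formula covers compact supports only; a cutoff equal to `1` on the spectrum changes
neither side. -/
theorem integral_real_scalarMeasure (D : V →L[ℂ] V) (x : V) {f : ℂ → ℝ} (hf : Continuous f) :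
    ∫ z, f z ∂(scalarMeasure D x) = (⟪x, cfc (fun z => (f z : ℂ)) D x⟫_ℂ).re := by
  obtain ⟨χ, hχ1, -, hχc, -⟩ := exists_continuous_one_zero_of_isCompact (spectrum.isCompact D)
    (isClosed_empty (X := ℂ)) (Set.disjoint_empty _)
  have hχ : ∀ z ∈ spectrum ℂ D, χ z = 1 := fun z hz => hχ1 hz
  let F : C_c(ℂ, ℝ) := ⟨⟨fun z => f z * χ z, hf.mul χ.continuous⟩, hχc.mul_left⟩
  have hF : ∀ z ∈ spectrum ℂ D, F z = f z := fun z hz => by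
    change f z * χ z = f z
    rw [hχ z hz, mul_one]
  have h := RealRMK.integral_rieszMeasure (scalarFunctional D x) F
  rw [scalarFunctional_apply] at h
  rw [cfc_congr (g := fun z => (F z : ℂ)) (fun z hz => by simp only [hF z hz]), ← h]
  exact integral_congr_ae ((ae_mem_spectrum D x).mono fun z hz => (hF z hz).symm)

/-- The defining functional records real parts. For real `f` nothing is lost, as the operator is
self-adjoint; the general case splits into real and imaginary part. -/
theorem integral_scalarMeasure (D : V →L[ℂ] V) (x : V) {f : ℂ → ℂ}
    (hf : Continuous f) : ∫ z, f z ∂(scalarMeasure D x) = ⟪x, cfc f D x⟫_ℂ := by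
  have hre : Continuous fun z => (f z).re := Complex.continuous_re.comp hf
  have him : Continuous fun z => (f z).im := Complex.continuous_im.comp hf
  have hsplit : cfc f D = cfc (fun z => ((f z).re : ℂ)) D +
      Complex.I • cfc (fun z => ((f z).im : ℂ)) D := by
    have h1 : Continuous fun z => ((f z).re : ℂ) := Complex.continuous_ofReal.comp hre
    have h2 : Continuous fun z => ((f z).im : ℂ) := Complex.continuous_ofReal.comp him
    rw [← cfc_const_mul (a := D) Complex.I _ h2.continuousOn,
      ← cfc_add (a := D) (fun z => ((f z).re : ℂ)) (fun z => Complex.I * ((f z).im : ℂ))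
        h1.continuousOn (continuous_const.mul h2).continuousOn]
    congr 1
    ext z
    conv_lhs => rw [← Complex.re_add_im (f z)]
    simp [mul_comm]
  have hreal : ∀ g : ℂ → ℝ, Continuous g → (⟪x, cfc (fun z => (g z : ℂ)) D x⟫_ℂ).im = 0 := by
    intro g hg
    have hsa : IsSelfAdjoint (cfc (fun z => (g z : ℂ)) D) := by
      rw [IsSelfAdjoint, ← cfc_star]
      simp
    rw [← Complex.conj_eq_iff_im, inner_conj_symm,
      ← ContinuousLinearMap.adjoint_inner_right, hsa.adjoint_eq]
  have hofReal : ∀ g : ℂ → ℝ, Continuous g →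
      ∫ z, (g z : ℂ) ∂(scalarMeasure D x) = ⟪x, cfc (fun z => (g z : ℂ)) D x⟫_ℂ := by
    intro g hg
    rw [integral_complex_ofReal, integral_real_scalarMeasure D x hg]
    exact Complex.ext rfl (by simp [hreal g hg])
  rw [hsplit]
  simp only [add_apply, smul_apply, inner_add_right, inner_smul_right]
  rw [← hofReal _ hre, ← hofReal _ him, ← integral_const_mul, ← integral_add]
  · congr 1
    ext z
    conv_lhs => rw [← Complex.re_add_im (f z)]
    ring
  · exact (IsSpectral.of_continuous D (Complex.continuous_ofReal.comp hre)).integrable x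
  · exact ((IsSpectral.of_continuous D (Complex.continuous_ofReal.comp him)).integrable x).const_mul _

theorem scalarMeasure_univ (D : V →L[ℂ] V) [IsStarNormal D] (x : V) :
    (scalarMeasure D x).real Set.univ = ‖x‖ ^ 2 := by
  have h := integral_real_scalarMeasure D x (f := fun _ => 1) continuous_const
  rw [integral_const, smul_eq_mul, mul_one] at h
  rw [h]
  simp only [Complex.ofReal_one]
  rw [cfc_const_one ℂ D, one_apply_eq_self, inner_self_eq_norm_sq_to_K]
  norm_cast

/-- Continuous functions are dense in `L¹` of the sum of the finitely many measures, so one sequence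
serves all `x ∈ F`; the multiplier `f` is bounded on the spectrum. -/
theorem exists_tendsto_integral (D : V →L[ℂ] V) {g : ℂ → ℂ} (hg : IsSpectral D g) (F : Finset V) :
    ∃ h : ℕ → ℂ → ℂ, (∀ n, Continuous (h n)) ∧ ∀ x ∈ F, ∀ f : ℂ → ℂ, Continuous f →
      Tendsto (fun n => ∫ z, h n z * f z ∂(scalarMeasure D x)) atTop
        (𝓝 (∫ z, g z * f z ∂(scalarMeasure D x))) := by
  let μ : Measure ℂ := ∑ x ∈ F, scalarMeasure D x
  have hμi : Integrable g μ := integrable_finsetSum_measure.mpr fun x _ => hg.integrable x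
  have hμf : IsFiniteMeasure μ := inferInstance
  choose h hh hhi using fun n : ℕ =>
    hμi.exists_boundedContinuous_integral_sub_le (ε := 1 / ((n : ℝ) + 1)) Nat.one_div_pos_of_nat
  refine ⟨fun n => h n, fun n => (h n).continuous, fun x hx f hf => ?_⟩
  obtain ⟨C, hC⟩ := (IsSpectral.of_continuous D hf).bounded
  have hC0 : ∀ z ∈ spectrum ℂ D, ‖f z‖ ≤ |C| := fun z hz => (hC z hz).trans (le_abs_self C)
  rw [tendsto_iff_norm_sub_tendsto_zero]
  refine squeeze_zero (fun _ => norm_nonneg _) (g := fun n : ℕ => |C| * (1 / ((n : ℝ) + 1)))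
    (fun n => ?_) ?_
  · have hcs := IsSpectral.of_continuous D (h n).continuous
    have hfs := IsSpectral.of_continuous D hf
    rw [← integral_sub ((hcs.mul hfs).integrable x) ((hg.mul hfs).integrable x)]
    have hle : scalarMeasure D x ≤ μ :=
      Finset.single_le_sum (f := fun x => scalarMeasure D x) (fun _ _ => bot_le) hx
    have hint : Integrable (fun z => ‖g z - h n z‖) μ := (hμi.sub (hhi n)).norm
    calc ‖∫ z, (h n z * f z - g z * f z) ∂(scalarMeasure D x)‖
        ≤ ∫ z, |C| * ‖g z - h n z‖ ∂(scalarMeasure D x) := by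
          refine norm_integral_le_of_norm_le ((hint.mono_measure hle).const_mul _) ?_
          filter_upwards [ae_mem_spectrum D x] with z hz
          rw [← sub_mul, norm_mul, mul_comm, norm_sub_rev]
          exact mul_le_mul_of_nonneg_right (hC0 z hz) (norm_nonneg _)
      _ = |C| * ∫ z, ‖g z - h n z‖ ∂(scalarMeasure D x) := integral_const_mul _ _
      _ ≤ |C| * ∫ z, ‖g z - h n z‖ ∂μ := by
          refine mul_le_mul_of_nonneg_left ?_ (abs_nonneg C)
          exact integral_mono_measure hle (Eventually.of_forall fun z => norm_nonneg _) hint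
      _ ≤ |C| * (1 / ((n : ℝ) + 1)) := mul_le_mul_of_nonneg_left (hh n) (abs_nonneg C)
  · have h := (tendsto_one_div_add_atTop_nhds_zero_nat (𝕜 := ℝ)).const_mul |C|
    rwa [mul_zero] at h

/-! ### The sesquilinear form of a bounded Borel function -/

/-- The polarization of `x ↦ ∫ g d⟨E x, x⟩`. -/
noncomputable def polInt (D : V →L[ℂ] V) (g : ℂ → ℂ) (x y : V) : ℂ :=
  (1 / 4) * ∑ k : Fin 4, (-Complex.I) ^ (k : ℕ) *
    ∫ z, g z ∂(scalarMeasure D (x + Complex.I ^ (k : ℕ) • y))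

theorem inner_eq_polarization (X : V →L[ℂ] V) (x y : V) :
    ⟪x, X y⟫_ℂ = (1 / 4) * ∑ k : Fin 4, (-Complex.I) ^ (k : ℕ) *
      ⟪x + Complex.I ^ (k : ℕ) • y, X (x + Complex.I ^ (k : ℕ) • y)⟫_ℂ := by
  simp only [Fin.sum_univ_four, map_add, map_smul, inner_add_left, inner_add_right, inner_smul_left,
    inner_smul_right, map_pow, Complex.conj_I]
  have h3 : Complex.I ^ 3 = -Complex.I := by rw [pow_succ, Complex.I_sq]; ring
  have h3' : (-Complex.I) ^ 3 = Complex.I := by rw [neg_pow, h3]; norm_num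
  have h2' : (-Complex.I) ^ 2 = -1 := by rw [neg_sq, Complex.I_sq]
  simp only [Fin.val_zero, Fin.val_one, Fin.val_two, show ((3 : Fin 4) : ℕ) = 3 from rfl, pow_zero,
    pow_one, Complex.I_sq, h3, h3', h2']
  ring_nf
  simp only [Complex.I_sq]
  ring

/-- The transfer principle: any identity among finitely many inner products that holds for
continuous functions passes to `g` in the limit. The finite set contains the four vectors `x + i^k
y` needed for polarization. -/
theorem exists_tendsto_inner (D : V →L[ℂ] V) {g : ℂ → ℂ} (hg : IsSpectral D g)
    (F : Finset (V × V)) :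
    ∃ h : ℕ → ℂ → ℂ, (∀ n, Continuous (h n)) ∧ ∀ xy ∈ F,
      (∀ f : ℂ → ℂ, Continuous f → Tendsto (fun n => ⟪xy.1, cfc (fun z => h n z * f z) D xy.2⟫_ℂ)
        atTop (𝓝 (polInt D (fun z => g z * f z) xy.1 xy.2))) ∧
      Tendsto (fun n => ⟪xy.1, cfc (h n) D xy.2⟫_ℂ) atTop (𝓝 (polInt D g xy.1 xy.2)) ∧
      Tendsto (fun n => ⟪xy.1, cfc (h n) D xy.1⟫_ℂ) atTop
        (𝓝 (∫ z, g z ∂(scalarMeasure D xy.1))) := by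
  classical
  obtain ⟨h, hc, hh⟩ := exists_tendsto_integral D hg (F.image Prod.fst ∪
    F.biUnion fun xy => Finset.univ.image fun k : Fin 4 => xy.1 + Complex.I ^ (k : ℕ) • xy.2)
  have key : ∀ xy ∈ F, ∀ f : ℂ → ℂ, Continuous f →
      Tendsto (fun n => ⟪xy.1, cfc (fun z => h n z * f z) D xy.2⟫_ℂ)
        atTop (𝓝 (polInt D (fun z => g z * f z) xy.1 xy.2)) := by
    intro xy hxy f hf
    refine Tendsto.congr (fun n => (inner_eq_polarization _ xy.1 xy.2).symm) ?_
    unfold polInt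
    refine Tendsto.const_mul _ (tendsto_finsetSum _ fun k _ => Tendsto.const_mul _ ?_)
    refine Tendsto.congr (fun n => integral_scalarMeasure D _ ((hc n).mul hf)) ?_
    refine hh _ (Finset.mem_union_right _ (Finset.mem_biUnion.mpr ⟨xy, hxy, ?_⟩)) f hf
    exact Finset.mem_image_of_mem _ (Finset.mem_univ k)
  refine ⟨h, hc, fun xy hxy => ⟨key xy hxy, ?_, ?_⟩⟩
  · have := key xy hxy (fun _ => 1) continuous_const
    simpa using this
  · have := hh xy.1 (Finset.mem_union_left _ (Finset.mem_image_of_mem _ hxy)) (fun _ => 1)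
      continuous_const
    simpa [integral_scalarMeasure D _ (hc _)] using this

theorem polInt_self (D : V →L[ℂ] V) {g : ℂ → ℂ} (hg : IsSpectral D g) (x : V) :
    polInt D g x x = ∫ z, g z ∂(scalarMeasure D x) := by
  obtain ⟨h, -, hh⟩ := exists_tendsto_inner D hg {(x, x)}
  obtain ⟨-, h1, h2⟩ := hh (x, x) (by simp)
  exact tendsto_nhds_unique h1 h2

theorem polInt_add_right (D : V →L[ℂ] V) {g : ℂ → ℂ} (hg : IsSpectral D g) (x y y' : V) :
    polInt D g x (y + y') = polInt D g x y + polInt D g x y' := by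
  classical
  obtain ⟨h, -, hh⟩ := exists_tendsto_inner D hg {(x, y + y'), (x, y), (x, y')}
  have h1 := (hh (x, y + y') (by simp)).2.1
  have h2 := (hh (x, y) (by simp)).2.1
  have h3 := (hh (x, y') (by simp)).2.1
  simp only [map_add, inner_add_right] at h1
  exact tendsto_nhds_unique h1 (h2.add h3)

theorem polInt_smul_right (D : V →L[ℂ] V) {g : ℂ → ℂ} (hg : IsSpectral D g) (c : ℂ) (x y : V) :
    polInt D g x (c • y) = c * polInt D g x y := by
  classical
  obtain ⟨h, -, hh⟩ := exists_tendsto_inner D hg {(x, c • y), (x, y)}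
  have h1 := (hh (x, c • y) (by simp)).2.1
  have h2 := (hh (x, y) (by simp)).2.1
  simp only [map_smul, inner_smul_right] at h1
  exact tendsto_nhds_unique h1 (h2.const_mul c)

theorem polInt_add_left (D : V →L[ℂ] V) {g : ℂ → ℂ} (hg : IsSpectral D g) (x x' y : V) :
    polInt D g (x + x') y = polInt D g x y + polInt D g x' y := by
  classical
  obtain ⟨h, -, hh⟩ := exists_tendsto_inner D hg {(x + x', y), (x, y), (x', y)}
  have h1 := (hh (x + x', y) (by simp)).2.1
  have h2 := (hh (x, y) (by simp)).2.1
  have h3 := (hh (x', y) (by simp)).2.1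
  simp only [inner_add_left] at h1
  exact tendsto_nhds_unique h1 (h2.add h3)

theorem polInt_smul_left (D : V →L[ℂ] V) {g : ℂ → ℂ} (hg : IsSpectral D g) (c : ℂ) (x y : V) :
    polInt D g (c • x) y = (starRingEnd ℂ) c * polInt D g x y := by
  classical
  obtain ⟨h, -, hh⟩ := exists_tendsto_inner D hg {(c • x, y), (x, y)}
  have h1 := (hh (c • x, y) (by simp)).2.1
  have h2 := (hh (x, y) (by simp)).2.1
  simp only [inner_smul_left] at h1
  exact tendsto_nhds_unique h1 (h2.const_mul _)

/-- Each of the four measures has mass `‖x + i^k y‖² ≤ 4`, and polarization averages the four terms.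
-/
theorem norm_polInt_le_of_unit (D : V →L[ℂ] V) [IsStarNormal D] {g : ℂ → ℂ} {C : ℝ}
    (hC : ∀ z ∈ spectrum ℂ D, ‖g z‖ ≤ C) (hC0 : 0 ≤ C) {x y : V} (hx : ‖x‖ = 1) (hy : ‖y‖ = 1) :
    ‖polInt D g x y‖ ≤ 4 * C := by
  have h : ∀ k : Fin 4, ‖(-Complex.I) ^ (k : ℕ) *
      ∫ z, g z ∂(scalarMeasure D (x + Complex.I ^ (k : ℕ) • y))‖ ≤ C * 4 := by
    intro k
    rw [norm_mul, norm_pow, norm_neg, Complex.norm_I, one_pow, one_mul]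
    refine (norm_integral_le_of_norm_le_const ((ae_mem_spectrum D _).mono hC)).trans ?_
    rw [scalarMeasure_univ]
    refine mul_le_mul_of_nonneg_left ?_ hC0
    have h2 : ‖x + Complex.I ^ (k : ℕ) • y‖ ≤ 2 := by
      refine (norm_add_le _ _).trans ?_
      rw [norm_smul, norm_pow, Complex.norm_I, one_pow, one_mul, hx, hy]; norm_num
    nlinarith [norm_nonneg (x + Complex.I ^ (k : ℕ) • y)]
  rw [polInt, norm_mul]
  have h2 := (norm_sum_le Finset.univ fun k : Fin 4 => (-Complex.I) ^ (k : ℕ) *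
      ∫ z, g z ∂(scalarMeasure D (x + Complex.I ^ (k : ℕ) • y))).trans
      (Finset.sum_le_sum fun k _ => h k)
  simp only [Finset.sum_const, Finset.card_univ, Fintype.card_fin, nsmul_eq_mul] at h2
  norm_num at h2 ⊢
  linarith

theorem exists_norm_polInt_le (D : V →L[ℂ] V) [IsStarNormal D] {g : ℂ → ℂ} (hg : IsSpectral D g) :
    ∃ C : ℝ, ∀ x y, ‖polInt D g x y‖ ≤ C * ‖x‖ * ‖y‖ := by
  obtain ⟨C, hC⟩ := hg.bounded
  refine ⟨4 * |C|, fun x y => ?_⟩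
  rcases eq_or_ne x 0 with rfl | hx
  · have h := polInt_smul_left D hg 0 0 y
    rw [zero_smul, map_zero, zero_mul] at h
    simp [h]
  rcases eq_or_ne y 0 with rfl | hy
  · have h := polInt_smul_right D hg 0 x 0
    rw [zero_smul, zero_mul] at h
    simp [h]
  have hx' := norm_ne_zero_iff.mpr hx
  have hy' := norm_ne_zero_iff.mpr hy
  have h := norm_polInt_le_of_unit D (fun z hz => (hC z hz).trans (le_abs_self C)) (abs_nonneg C)
    (x := ((‖x‖⁻¹ : ℝ) : ℂ) • x) (y := ((‖y‖⁻¹ : ℝ) : ℂ) • y)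
    (by rw [norm_smul]; simp [hx']) (by rw [norm_smul]; simp [hy'])
  rw [polInt_smul_left D hg, polInt_smul_right D hg, norm_mul, norm_mul] at h
  simp only [RCLike.norm_conj, Complex.norm_real, norm_inv, norm_norm] at h
  rw [inv_mul_le_iff₀ (by positivity), inv_mul_le_iff₀ (by positivity)] at h
  linarith

theorem exists_inner_eq_polInt (D : V →L[ℂ] V) [IsStarNormal D] {g : ℂ → ℂ}
    (hg : IsSpectral D g) : ∃ X : V →L[ℂ] V, ∀ x y, ⟪x, X y⟫_ℂ = polInt D g x y := by
  obtain ⟨C, hC⟩ := exists_norm_polInt_le D hg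
  let B : V →ₗ⋆[ℂ] V →ₗ[ℂ] ℂ := LinearMap.mk₂'ₛₗ (starRingEnd ℂ) (RingHom.id ℂ) (polInt D g)
    (polInt_add_left D hg) (fun c x y => polInt_smul_left D hg c x y)
    (polInt_add_right D hg) (fun c x y => polInt_smul_right D hg c x y)
  let B' : V →L⋆[ℂ] V →L[ℂ] ℂ := B.mkContinuous₂ C hC
  -- The representing operator acts in the first slot; the adjoint moves it to the second.
  refine ⟨ContinuousLinearMap.adjoint (InnerProductSpace.continuousLinearMapOfBilin B'), ?_⟩
  intro x y
  rw [ContinuousLinearMap.adjoint_inner_right, InnerProductSpace.continuousLinearMapOfBilin_apply]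
  rfl

theorem eq_of_inner_self_eq {X Y : V →L[ℂ] V} (h : ∀ x, ⟪x, X x⟫_ℂ = ⟪x, Y x⟫_ℂ) : X = Y := by
  ext y
  refine ext_inner_left ℂ fun x => ?_
  rw [inner_eq_polarization X, inner_eq_polarization Y]
  simp only [h]

variable (D : V →L[ℂ] V) [IsStarNormal D]

/-- Justifies the choice in `spectralIntegral`: the operator representing the polarized form has the
required diagonal. -/
theorem inner_spectralIntegral_self {g : ℂ → ℂ} (hg : IsSpectral D g) (x : V) :
    ⟪x, spectralIntegral D g x⟫_ℂ = ∫ z, g z ∂(scalarMeasure D x) := by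
  obtain ⟨X, hX⟩ := exists_inner_eq_polInt D hg
  have h : ∃ X : V →L[ℂ] V, ∀ x : V, ⟪x, X x⟫_ℂ = ∫ z, g z ∂(scalarMeasure D x) :=
    ⟨X, fun x => by rw [hX, polInt_self D hg]⟩
  exact Classical.epsilon_spec h x

theorem spectralIntegral_eq {g : ℂ → ℂ} (hg : IsSpectral D g) {X : V →L[ℂ] V}
    (h : ∀ x : V, ⟪x, X x⟫_ℂ = ∫ z, g z ∂(scalarMeasure D x)) : spectralIntegral D g = X :=
  eq_of_inner_self_eq fun x => by rw [h, inner_spectralIntegral_self D hg]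

theorem inner_spectralIntegral {g : ℂ → ℂ} (hg : IsSpectral D g) (x y : V) :
    ⟪x, spectralIntegral D g y⟫_ℂ = polInt D g x y := by
  rw [inner_eq_polarization]
  simp only [inner_spectralIntegral_self D hg, polInt]

theorem spectralIntegral_of_continuous {f : ℂ → ℂ} (hf : Continuous f) :
    spectralIntegral D f = cfc f D :=
  spectralIntegral_eq D (IsSpectral.of_continuous D hf) fun x => (integral_scalarMeasure D x hf).symm

theorem spectralIntegral_congr {g h : ℂ → ℂ} (hg : IsSpectral D g) (hh : IsSpectral D h)
    (hgh : ∀ z ∈ spectrum ℂ D, g z = h z) : spectralIntegral D g = spectralIntegral D h :=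
  spectralIntegral_eq D hg fun x => by
    rw [inner_spectralIntegral_self D hh]
    exact integral_congr_ae ((ae_mem_spectrum D x).mono fun z hz => (hgh z hz).symm)

theorem spectralIntegral_add {g h : ℂ → ℂ} (hg : IsSpectral D g) (hh : IsSpectral D h) :
    spectralIntegral D (fun z => g z + h z) = spectralIntegral D g + spectralIntegral D h :=
  spectralIntegral_eq D (hg.add hh) fun x => by
    rw [add_apply, inner_add_right, inner_spectralIntegral_self D hg,
      inner_spectralIntegral_self D hh, integral_add (hg.integrable x) (hh.integrable x)]

theorem spectralIntegral_const_mul (c : ℂ) {g : ℂ → ℂ} (hg : IsSpectral D g) :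
    spectralIntegral D (fun z => c * g z) = c • spectralIntegral D g :=
  spectralIntegral_eq D (hg.const_mul c) fun x => by
    rw [smul_apply, inner_smul_right, inner_spectralIntegral_self D hg, integral_const_mul]

/-- Multiplicativity with one continuous factor is enough here. The same approximants are tested at
`(x, f(D)y)` and, multiplied by `f`, at `(x, y)`. -/
theorem spectralIntegral_mul_cfc {g f : ℂ → ℂ} (hg : IsSpectral D g) (hf : Continuous f) :
    spectralIntegral D g * cfc f D = spectralIntegral D (fun z => g z * f z) := by
  classical
  ext y
  refine ext_inner_left ℂ fun x => ?_
  have hgf := hg.mul (IsSpectral.of_continuous D hf)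
  obtain ⟨h, hc, hh⟩ := exists_tendsto_inner D hg {(x, cfc f D y), (x, y)}
  have h1 := (hh (x, cfc f D y) (by simp)).2.1
  have h2 := (hh (x, y) (by simp)).1 f hf
  rw [mul_apply_eq_comp, inner_spectralIntegral D hg, inner_spectralIntegral D hgf]
  refine tendsto_nhds_unique h1 (h2.congr fun n => ?_)
  rw [cfc_mul (h n) f D (hc n).continuousOn hf.continuousOn, mul_apply_eq_comp]

theorem cfc_mul_spectralIntegral {g f : ℂ → ℂ} (hg : IsSpectral D g) (hf : Continuous f) :
    cfc f D * spectralIntegral D g = spectralIntegral D (fun z => g z * f z) := by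
  classical
  ext y
  refine ext_inner_left ℂ fun x => ?_
  have hgf := hg.mul (IsSpectral.of_continuous D hf)
  obtain ⟨h, hc, hh⟩ := exists_tendsto_inner D hg {(ContinuousLinearMap.adjoint (cfc f D) x, y), (x, y)}
  have h1 := (hh (ContinuousLinearMap.adjoint (cfc f D) x, y) (by simp)).2.1
  have h2 := (hh (x, y) (by simp)).1 f hf
  rw [mul_apply_eq_comp, ← ContinuousLinearMap.adjoint_inner_left, inner_spectralIntegral D hg,
    inner_spectralIntegral D hgf]
  refine tendsto_nhds_unique h1 (h2.congr fun n => ?_)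
  rw [cfc_mul (h n) f D (hc n).continuousOn hf.continuousOn, cfc_commute_cfc (h n) f D,
    mul_apply_eq_comp, ContinuousLinearMap.adjoint_inner_left]

/-! ### Eigenprojections `E{w}` and kernels -/

theorem cfc_mul_spectralProj_singleton {f : ℂ → ℂ} (hf : Continuous f) (w : ℂ) :
    cfc f D * spectralProj D {w} = f w • spectralProj D {w} := by
  have hi := IsSpectral.indicator_one D (measurableSet_singleton w)
  rw [spectralProj, cfc_mul_spectralIntegral D hi hf, ← spectralIntegral_const_mul D _ hi]
  congr 1
  ext z
  by_cases hz : z = w <;> simp [hz]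

theorem spectralProj_singleton_mul_cfc {f : ℂ → ℂ} (hf : Continuous f) (w : ℂ) :
    spectralProj D {w} * cfc f D = f w • spectralProj D {w} := by
  have hi := IsSpectral.indicator_one D (measurableSet_singleton w)
  rw [← cfc_mul_spectralProj_singleton D hf w, spectralProj, spectralIntegral_mul_cfc D hi hf,
    cfc_mul_spectralIntegral D hi hf]

theorem norm_cfc_apply_sq (D : V →L[ℂ] V) {f : ℂ → ℂ} (hf : Continuous f) (x : V) :
    ‖cfc f D x‖ ^ 2 = ∫ z, ‖f z‖ ^ 2 ∂(scalarMeasure D x) := by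
  have hn : Continuous fun z => ‖f z‖ ^ 2 := (continuous_norm.comp hf).pow 2
  rw [integral_real_scalarMeasure D x hn]
  have h : cfc (fun z => ((‖f z‖ ^ 2 : ℝ) : ℂ)) D = star (cfc f D) * cfc f D := by
    rw [← cfc_star f D, ← cfc_mul (fun z => star (f z)) f D (hf.star).continuousOn hf.continuousOn]
    congr 1
    ext z
    rw [Complex.star_def, mul_comm, Complex.mul_conj, Complex.normSq_eq_norm_sq]
  rw [h, mul_apply_eq_comp, ContinuousLinearMap.star_eq_adjoint,
    ContinuousLinearMap.adjoint_inner_right, inner_self_eq_norm_sq_to_K]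
  norm_cast

theorem ae_eq_zero_of_cfc_apply_eq_zero {f : ℂ → ℂ} (hf : Continuous f) {x : V}
    (hx : cfc f D x = 0) : ∀ᵐ z ∂(scalarMeasure D x), f z = 0 := by
  have h := norm_cfc_apply_sq D hf x
  rw [hx, norm_zero, zero_pow two_ne_zero] at h
  have hint : Integrable (fun z => ‖f z‖ ^ 2) (scalarMeasure D x) := by
    have := ((IsSpectral.of_continuous D hf).mul (IsSpectral.of_continuous D hf)).integrable x
    simpa [sq] using this.norm
  have h2 := (integral_eq_zero_iff_of_nonneg (fun z => by positivity) hint).mp h.symm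
  exact h2.mono fun z hz => by simpa using hz

/-- Eigenvectors of `D` are eigenvectors of `∫ g dE`. -/
theorem spectralIntegral_mul_spectralProj_singleton {g : ℂ → ℂ} (hg : IsSpectral D g) (w : ℂ) :
    spectralIntegral D g * spectralProj D {w} = g w • spectralProj D {w} := by
  classical
  ext y
  set u := spectralProj D {w} y with hu
  have hfu : ∀ f : ℂ → ℂ, Continuous f → cfc f D u = f w • u := fun f hf => by
    rw [hu, ← mul_apply_eq_comp, cfc_mul_spectralProj_singleton D hf]; rfl
  rw [mul_apply_eq_comp, smul_apply, ← hu]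
  rcases eq_or_ne u 0 with h0 | h0
  · rw [h0, map_zero, smul_zero]
  -- The measure of an eigenvector sits at its eigenvalue, because `(D - w)u = 0`.
  have hae : ∀ᵐ z ∂(scalarMeasure D u), z = w := by
    have h1 := ae_eq_zero_of_cfc_apply_eq_zero D (f := fun z => z - w) (by fun_prop) (x := u)
      (by rw [hfu _ (by fun_prop)]; simp)
    exact h1.mono fun z hz => sub_eq_zero.mp hz
  refine ext_inner_left ℂ fun x => ?_
  obtain ⟨h, hc, hh⟩ := exists_tendsto_inner D hg {(u, u), (x, u)}
  have h1 := (hh (u, u) (by simp)).2.2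
  have h2 := (hh (x, u) (by simp)).2.1
  simp only [hfu _ (hc _), inner_smul_right] at h1 h2
  have hint : ∫ z, g z ∂(scalarMeasure D u) = g w * ⟪u, u⟫_ℂ := by
    rw [integral_congr_ae (g := fun _ => g w) (hae.mono fun z hz => by simp only [hz]),
      integral_const, scalarMeasure_univ, inner_self_eq_norm_sq_to_K]
    simp [mul_comm]
  rw [hint] at h1
  have huu : ⟪u, u⟫_ℂ ≠ 0 := inner_self_ne_zero.mpr h0
  -- The approximants act on `u` as the scalars `h n w`. Testing against `u ≠ 0` itself shows that
  -- these converge to `g w`.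
  have h3 : Tendsto (fun n => h n w) atTop (𝓝 (g w)) := by
    have := h1.div_const ⟪u, u⟫_ℂ
    simpa only [mul_div_cancel_right₀ _ huu] using this
  rw [inner_spectralIntegral D hg, inner_smul_right]
  exact tendsto_nhds_unique h2 (h3.mul_const _)

/-- If `f` has finitely many zeros in the spectrum of `D`, then the kernel of `f(D)` is spanned by
the eigenspaces belonging to these zeros. -/
theorem eq_sum_spectralProj_of_cfc_apply_eq_zero {f : ℂ → ℂ} (hf : Continuous f) (S : Finset ℂ)
    (hS : ∀ z ∈ spectrum ℂ D, f z = 0 → z ∈ S) {x : V} (hx : cfc f D x = 0) :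
    x = ∑ w ∈ S, spectralProj D {w} x := by
  classical
  -- The difference to be killed is `E` of the complement of `S`. The measure of `x` lives on the
  -- zeros of `f` in the spectrum, hence on `S`.
  let χ : ℂ → ℂ := (↑S : Set ℂ)ᶜ.indicator fun _ => 1
  have hχ : IsSpectral D χ := IsSpectral.indicator_one D S.measurableSet.compl
  have hsum : ∀ y : V, y - ∑ w ∈ S, spectralProj D {w} y = spectralIntegral D χ y := by
    have h : spectralIntegral D χ = 1 - ∑ w ∈ S, spectralProj D {w} := by
      refine spectralIntegral_eq D hχ fun y => ?_
      have hi : ∀ w : ℂ, IsSpectral D (({w} : Set ℂ).indicator fun _ => 1) := fun w =>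
        IsSpectral.indicator_one D (measurableSet_singleton w)
      have h1 : ⟪y, (1 : V →L[ℂ] V) y⟫_ℂ = ∫ z, (1 : ℂ) ∂(scalarMeasure D y) := by
        rw [integral_scalarMeasure D y continuous_const, cfc_const_one ℂ D]
      rw [sub_apply, inner_sub_right, h1, sum_apply, inner_sum]
      simp only [spectralProj, inner_spectralIntegral_self D (hi _)]
      rw [← integral_finsetSum _ fun w _ => (hi w).integrable y, ← integral_sub
        ((IsSpectral.of_continuous D continuous_const).integrable y)
        (integrable_finsetSum _ fun w _ => (hi w).integrable y)]
      congr 1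
      ext z
      by_cases hz : z ∈ S <;> simp [χ, hz, Set.indicator_apply]
    intro y
    rw [h, sub_apply, sum_apply, one_apply_eq_self]
  have hreal : ∀ y : V, ⟪y, spectralIntegral D χ y⟫_ℂ =
      (((scalarMeasure D y).real (↑S : Set ℂ)ᶜ : ℝ) : ℂ) := by
    intro y
    rw [inner_spectralIntegral_self D hχ, integral_indicator S.measurableSet.compl]
    simp [Measure.real]
  have hpos : (0 : V →L[ℂ] V) ≤ spectralIntegral D χ := by
    rw [ContinuousLinearMap.nonneg_iff_isPositive, ContinuousLinearMap.isPositive_iff_complex]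
    intro y
    rw [← inner_conj_symm, hreal]
    simp
  -- A positive operator with vanishing quadratic form at `x` annihilates `x`, by way of its square
  -- root.
  have hG : CFC.sqrt (spectralIntegral D χ) * CFC.sqrt (spectralIntegral D χ) =
      spectralIntegral D χ := CFC.sqrt_mul_sqrt_self _ hpos
  set G := CFC.sqrt (spectralIntegral D χ)
  have hGa : IsSelfAdjoint G := (CFC.sqrt_nonneg _).isSelfAdjoint
  have h0 : ⟪x, spectralIntegral D χ x⟫_ℂ = 0 := by
    rw [inner_spectralIntegral_self D hχ]
    refine integral_eq_zero_of_ae ?_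
    filter_upwards [ae_eq_zero_of_cfc_apply_eq_zero D hf hx, ae_mem_spectrum D x] with z hz hzs
    simp [χ, hS z hzs hz]
  have hGx : G x = 0 := by
    rw [← hG, mul_apply_eq_comp, ← ContinuousLinearMap.adjoint_inner_left, hGa.adjoint_eq] at h0
    exact inner_self_eq_zero.mp h0
  have h1 := hsum x
  rw [← hG, mul_apply_eq_comp, hGx, map_zero, sub_eq_zero] at h1
  exact h1

end SpectralIntegral

end KreinCalc

namespace KreinCalc

/-! ### Operators on Krein spaces and the Hilbert spaces over them -/

section KreinOperators

set_option linter.unusedSectionVars false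

variable {K : Type*} [NormedAddCommGroup K] [InnerProductSpace ℂ K] [CompleteSpace K]
variable {V : Type*} [NormedAddCommGroup V] [InnerProductSpace ℂ V] [CompleteSpace V]
variable {W : Type*} [NormedAddCommGroup W] [InnerProductSpace ℂ W] [CompleteSpace W]

namespace FundamentalSymmetry

variable (J : FundamentalSymmetry K)

theorem ext_form {x y : K} (h : ∀ z, J.form x z = J.form y z) : x = y := by
  rw [← J.op_op x, ← J.op_op y]
  congr 1
  exact ext_inner_left ℂ fun z => h z

theorem adj_adj (C : K →L[ℂ] K) : J.adj (J.adj C) = C := by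
  have h : ContinuousLinearMap.adjoint J.op = J.op := J.isSelfAdjoint.adjoint_eq
  have h2 : J.op * J.op = 1 := J.sq_eq_one
  simp only [adj, ← ContinuousLinearMap.star_eq_adjoint, star_mul] at h ⊢
  rw [h, star_star]
  simp only [← mul_assoc, h2, one_mul]
  rw [mul_assoc, h2, mul_one]

theorem adj_mul (C D : K →L[ℂ] K) : J.adj (C * D) = J.adj D * J.adj C := by
  have h2 : J.op * J.op = 1 := J.sq_eq_one
  simp only [adj, ← ContinuousLinearMap.star_eq_adjoint, star_mul]
  calc J.op * (star D * star C) * J.op = J.op * star D * 1 * (star C * J.op) := by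
        simp only [mul_assoc, one_mul]
    _ = _ := by rw [← h2]; simp only [mul_assoc]

theorem rePart_add_imPart (N : K →L[ℂ] K) : J.rePart N + Complex.I • J.imPart N = N := by
  simp only [rePart, imPart, smul_smul]
  have h : Complex.I * (1 / (2 * Complex.I)) = 1 / 2 := by field_simp
  rw [h, ← smul_add, add_add_sub_cancel, ← two_smul ℂ N, smul_smul]
  norm_num

theorem rePart_sub_imPart (N : K →L[ℂ] K) : J.rePart N - Complex.I • J.imPart N = J.adj N := by
  simp only [rePart, imPart, smul_smul]
  have h : Complex.I * (1 / (2 * Complex.I)) = 1 / 2 := by field_simp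
  rw [h, ← smul_sub, add_sub_sub_cancel, ← two_smul ℂ (J.adj N), smul_smul]
  norm_num

theorem rePart_mul_imPart {N : K →L[ℂ] K} (h : N * J.adj N = J.adj N * N) :
    J.rePart N * J.imPart N = J.imPart N * J.rePart N := by
  simp only [rePart, imPart, smul_mul_smul_comm]
  rw [mul_comm (1 / 2 : ℂ)]
  congr 1
  simp only [mul_sub, add_mul, mul_add, sub_mul]
  rw [h]; abel

theorem isUnit_adj {C : K →L[ℂ] K} (h : IsUnit C) : IsUnit (J.adj C) := by
  have hJ : IsUnit J.op := ⟨⟨J.op, J.op, J.sq_eq_one, J.sq_eq_one⟩, rfl⟩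
  exact (hJ.mul (by simpa [← ContinuousLinearMap.star_eq_adjoint] using h.star)).mul hJ

end FundamentalSymmetry

variable {J : FundamentalSymmetry K} {T : V →L[ℂ] K}

/-- The orthogonal complement of the range of `T^*` is the kernel of `T`. Operators on `V` are thus
determined by their values on vectors `T^* x`. -/
theorem denseRange_adjFrom (hT : Function.Injective T) : DenseRange (J.adjFrom T) := by
  have h : (LinearMap.range (J.adjFrom T : K →ₗ[ℂ] V)).topologicalClosure = ⊤ := by
    rw [Submodule.topologicalClosure_eq_top_iff, Submodule.eq_bot_iff]
    intro v hv
    have h1 : T v = 0 := by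
      refine J.ext_form fun x => ?_
      rw [J.form_adjFrom]
      have := (Submodule.mem_orthogonal _ _).mp hv (J.adjFrom T x) ⟨x, rfl⟩
      rw [this]
      simp [FundamentalSymmetry.form]
    exact hT (h1.trans (map_zero T).symm)
  have h2 := (Submodule.dense_iff_topologicalClosure_eq_top).mpr h
  exact h2

theorem eq_of_comp_adjFrom_eq {X Y : V →L[ℂ] W} (hT : Function.Injective T)
    (h : ∀ x, X (J.adjFrom T x) = Y (J.adjFrom T x)) : X = Y := by
  have h1 := (denseRange_adjFrom (J := J) hT).equalizer X.continuous Y.continuous (funext h)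
  exact DFunLike.coe_injective h1

/-! ### Boundedness of `Θ(C)` by iterated Cauchy–Schwarz -/

/-- If `ρ = b 0 / (t s) > 1`, the recursion gives `ρ^(2^n) ≤ b n / (t s^(2^n)) ≤ M / t` for all `n`,
which is absurd. The constant `M` therefore drops out of the conclusion. -/
theorem le_of_sq_le_mul {b : ℕ → ℝ} {t s M : ℝ} (ht : 0 ≤ t) (hs : 0 < s)
    (hb : ∀ n, b n ^ 2 ≤ t * b (n + 1)) (hM : ∀ n, b n ≤ M * s ^ 2 ^ n) : b 0 ≤ t * s := by
  rcases ht.eq_or_lt with rfl | ht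
  · have := hb 0
    nlinarith
  by_contra! hlt
  have hts : 0 < t * s := mul_pos ht hs
  have hr : 1 < b 0 / (t * s) := (one_lt_div hts).mpr hlt
  have key : ∀ n, (b 0 / (t * s)) ^ 2 ^ n ≤ b n / (t * s ^ 2 ^ n) := by
    intro n
    induction n with
    | zero => simp
    | succ n ih =>
      rw [pow_succ 2 n, pow_mul, pow_mul]
      refine (pow_le_pow_left₀ (by positivity) ih 2).trans ?_
      rw [div_pow, div_le_div_iff₀ (by positivity) (by positivity)]
      have h1 := mul_le_mul_of_nonneg_right (hb n) (show 0 ≤ t * (s ^ 2 ^ n) ^ 2 by positivity)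
      calc _ ≤ _ := h1
        _ = _ := by ring
  obtain ⟨n, hn⟩ := pow_unbounded_of_one_lt (M / t) hr
  have h1 : (b 0 / (t * s)) ^ n ≤ (b 0 / (t * s)) ^ 2 ^ n :=
    pow_le_pow_right₀ hr.le n.lt_two_pow_self.le
  have h2 : b n / (t * s ^ 2 ^ n) ≤ M / t := by
    rw [div_le_div_iff₀ (by positivity) ht]
    have := mul_le_mul_of_nonneg_right (hM n) ht.le
    linarith
  linarith [key n]

theorem inner_adjFrom_adjFrom (x y : K) :
    ⟪J.adjFrom T x, J.adjFrom T y⟫_ℂ = J.form (T.comp (J.adjFrom T) y) x := by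
  rw [← J.form_adjFrom]; rfl

theorem form_comp_adjFrom_symm (x y : K) :
    J.form (T.comp (J.adjFrom T) x) y = J.form x (T.comp (J.adjFrom T) y) := by
  rw [← inner_adjFrom_adjFrom, ← inner_conj_symm, inner_adjFrom_adjFrom]
  simp only [FundamentalSymmetry.form]
  rw [inner_conj_symm, J.inner_op]

theorem adj_comp_adjFrom : J.adj (T.comp (J.adjFrom T)) = T.comp (J.adjFrom T) := by
  ext x
  refine J.ext_form fun z => ?_
  rw [J.form_adj, J.adj_adj, form_comp_adjFrom_symm]

/-- Operators commuting with `T T^*` are bounded with respect to the seminorm `x ↦ ‖T^* x‖`. -/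
theorem exists_norm_adjFrom_adj_le {C : K →L[ℂ] K}
    (hC : C * T.comp (J.adjFrom T) = T.comp (J.adjFrom T) * C) :
    ∃ c : ℝ, ∀ x, ‖J.adjFrom T (J.adj C x)‖ ≤ c * ‖J.adjFrom T x‖ := by
  set P := T.comp (J.adjFrom T) with hP
  have hC' : J.adj C * P = P * J.adj C := by
    have h := congrArg J.adj hC
    rw [J.adj_mul, J.adj_mul, hP, adj_comp_adjFrom, ← hP] at h
    exact h.symm
  -- `S = C C^*` is Krein self-adjoint and commutes with `P`, hence is symmetric for the
  -- semidefinite product `[P x, y]`.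
  set S : K →L[ℂ] K := C * J.adj C with hS
  have hSP : S * P = P * S := by
    rw [hS, mul_assoc, hC', ← mul_assoc, hC, mul_assoc]
  have hSadj : J.adj S = S := by rw [hS, J.adj_mul, J.adj_adj]
  have happ : ∀ (X Y : K →L[ℂ] K) x, X * Y = Y * X → X (Y x) = Y (X x) := fun X Y x h =>
    congrArg (fun Z : K →L[ℂ] K => Z x) h
  have hsym : ∀ n : ℕ, ∀ x y,
      ⟪J.adjFrom T ((S ^ n) x), J.adjFrom T y⟫_ℂ = ⟪J.adjFrom T x, J.adjFrom T ((S ^ n) y)⟫_ℂ := by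
    intro n
    induction n with
    | zero => simp
    | succ n ih =>
      intro x y
      rw [pow_succ', mul_apply_eq_comp, inner_adjFrom_adjFrom]
      nth_rewrite 1 [← hSadj]
      rw [← J.form_adj, ← hP, happ S P y hSP, hP, ← inner_adjFrom_adjFrom, ih,
        ← mul_apply_eq_comp, ← pow_succ, ← pow_succ']
  have h1 : ∀ x, ‖J.adjFrom T (J.adj C x)‖ ^ 2 ≤ ‖J.adjFrom T x‖ * ‖J.adjFrom T (S x)‖ := by
    intro x
    have h : ⟪J.adjFrom T (J.adj C x), J.adjFrom T (J.adj C x)⟫_ℂ =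
        ⟪J.adjFrom T x, J.adjFrom T (S x)⟫_ℂ := by
      rw [inner_adjFrom_adjFrom, ← J.form_adj, ← hP, happ C P _ hC, hP, inner_adjFrom_adjFrom]
      rfl
    rw [inner_self_eq_norm_sq_to_K] at h
    have h2 := norm_inner_le_norm (𝕜 := ℂ) (J.adjFrom T x) (J.adjFrom T (S x))
    rw [← h] at h2
    simpa using h2
  -- The summand `1` makes the growth rate strictly positive.
  have hs : 0 < ‖S‖ + 1 := by positivity
  -- Symmetry and Cauchy–Schwarz give the recursion for `b n = ‖T^* S^(2^n) x‖`; the operator norm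
  -- of `S` gives the crude growth bound.
  have h2 : ∀ x, ‖J.adjFrom T (S x)‖ ≤ ‖J.adjFrom T x‖ * (‖S‖ + 1) := by
    intro x
    have h := le_of_sq_le_mul (b := fun n => ‖J.adjFrom T ((S ^ 2 ^ n) x)‖)
      (M := ‖J.adjFrom T‖ * ‖x‖) (norm_nonneg (J.adjFrom T x)) hs ?_ ?_
    · simpa using h
    · intro n
      have h3 := hsym (2 ^ n) x ((S ^ 2 ^ n) x)
      rw [inner_self_eq_norm_sq_to_K, ← mul_apply_eq_comp, ← pow_add, ← two_mul, ← pow_succ'] at h3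
      have h4 := norm_inner_le_norm (𝕜 := ℂ) (J.adjFrom T x) (J.adjFrom T ((S ^ 2 ^ (n + 1)) x))
      rw [← h3] at h4
      simpa using h4
    · intro n
      calc ‖J.adjFrom T ((S ^ 2 ^ n) x)‖ ≤ ‖J.adjFrom T‖ * (‖S ^ 2 ^ n‖ * ‖x‖) :=
            (ContinuousLinearMap.le_opNorm _ _).trans (mul_le_mul_of_nonneg_left
              (ContinuousLinearMap.le_opNorm _ _) (norm_nonneg _))
        _ ≤ ‖J.adjFrom T‖ * ((‖S‖ + 1) ^ 2 ^ n * ‖x‖) := by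
            gcongr
            refine (norm_pow_le' S (by positivity)).trans ?_
            exact pow_le_pow_left₀ (norm_nonneg _) (by linarith) _
        _ = _ := by ring
  refine ⟨Real.sqrt (‖S‖ + 1), fun x => ?_⟩
  refine le_of_sq_le_sq ?_ (by positivity)
  rw [mul_pow, Real.sq_sqrt hs.le]
  refine (h1 x).trans ?_
  have := mul_le_mul_of_nonneg_left (h2 x) (norm_nonneg (J.adjFrom T x))
  linarith

/-- The operator sought is the adjoint of the extension of `T^* x ↦ T^* C^* x`, a map that is well
defined and bounded by `exists_norm_adjFrom_adj_le`. -/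
theorem comp_theta (hT : Function.Injective T) {C : K →L[ℂ] K}
    (hC : C * T.comp (J.adjFrom T) = T.comp (J.adjFrom T) * C) :
    T.comp (theta T C) = C.comp T := by
  obtain ⟨c, hc⟩ := exists_norm_adjFrom_adj_le hC
  let L : V →L[ℂ] V := LinearMap.extendOfNorm ((J.adjFrom T).comp (J.adj C) : K →ₗ[ℂ] V)
    (J.adjFrom T : K →ₗ[ℂ] V)
  have hL : ∀ x, L (J.adjFrom T x) = J.adjFrom T (J.adj C x) := fun x =>
    LinearMap.extendOfNorm_eq (e := (J.adjFrom T : K →ₗ[ℂ] V)) (denseRange_adjFrom hT) ⟨c, hc⟩ x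
  have hex : ∃ D : V →L[ℂ] V, T.comp D = C.comp T := by
    refine ⟨ContinuousLinearMap.adjoint L, ?_⟩
    ext v
    refine J.ext_form fun x => ?_
    rw [ContinuousLinearMap.comp_apply, ContinuousLinearMap.comp_apply, J.form_adjFrom,
      ContinuousLinearMap.adjoint_inner_right, hL, J.form_adj, J.form_adjFrom]
  exact Classical.epsilon_spec hex

theorem adjoint_adjFrom_of_comp_eq {C : K →L[ℂ] K} {D : V →L[ℂ] V} (h : T.comp D = C.comp T)
    (x : K) : ContinuousLinearMap.adjoint D (J.adjFrom T x) = J.adjFrom T (J.adj C x) := by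
  refine ext_inner_right ℂ fun v => ?_
  rw [ContinuousLinearMap.adjoint_inner_left, ← J.form_adjFrom, ← J.form_adjFrom, ← J.form_adj]
  exact congrArg (fun S : V →L[ℂ] K => J.form (S v) x) h

/-- As `D^* T^* = T^* C^*`, on the dense range of `T^*` this says that `C^*` commutes with `T T^*`.
It yields normality of `Θ(N)`. -/
theorem comp_adjoint_of_comp_eq (hT : Function.Injective T) {C : K →L[ℂ] K} {D : V →L[ℂ] V}
    (hC : C * T.comp (J.adjFrom T) = T.comp (J.adjFrom T) * C) (h : T.comp D = C.comp T) :
    T.comp (ContinuousLinearMap.adjoint D) = (J.adj C).comp T := by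
  refine eq_of_comp_adjFrom_eq (J := J) hT fun x => ?_
  have h2 := congrArg J.adj hC
  rw [J.adj_mul, J.adj_mul, adj_comp_adjFrom] at h2
  rw [ContinuousLinearMap.comp_apply, adjoint_adjFrom_of_comp_eq h]
  exact congrArg (fun S : K →L[ℂ] K => S x) h2

/-! ### The contractions `R_j` -/

variable {S : W →L[ℂ] K}

theorem extendOfNorm_adjFrom (hT : Function.Injective T)
    (hle : ∀ x, ‖J.adjFrom S x‖ ≤ ‖J.adjFrom T x‖) (x : K) :
    LinearMap.extendOfNorm (J.adjFrom S : K →ₗ[ℂ] W) (J.adjFrom T : K →ₗ[ℂ] V) (J.adjFrom T x) =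
      J.adjFrom S x :=
  LinearMap.extendOfNorm_eq (e := (J.adjFrom T : K →ₗ[ℂ] V)) (denseRange_adjFrom hT)
    ⟨1, fun x => by simpa using hle x⟩ x

/-- With `S = T R` this is `T R R^* T^* = S S^*`. The norm inequality makes `T^* x ↦ S^* x` a
well-defined contraction. -/
theorem comp_transferSq (hT : Function.Injective T)
    (hle : ∀ x, ‖J.adjFrom S x‖ ≤ ‖J.adjFrom T x‖) (x : K) :
    T (transferSq J T S (J.adjFrom T x)) = S (J.adjFrom S x) := by
  refine J.ext_form fun y => ?_
  rw [J.form_adjFrom, J.form_adjFrom, transferSq, transfer, ContinuousLinearMap.adjoint_adjoint,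
    ContinuousLinearMap.comp_apply, ContinuousLinearMap.adjoint_inner_right,
    extendOfNorm_adjFrom hT hle, extendOfNorm_adjFrom hT hle]

theorem norm_transferSq_apply_le (hT : Function.Injective T)
    (hle : ∀ x, ‖J.adjFrom S x‖ ≤ ‖J.adjFrom T x‖) (v : V) : ‖transferSq J T S v‖ ≤ ‖v‖ := by
  have h : ‖LinearMap.extendOfNorm (J.adjFrom S : K →ₗ[ℂ] W) (J.adjFrom T : K →ₗ[ℂ] V)‖ ≤ 1 :=
    LinearMap.opNorm_extendOfNorm_le (denseRange_adjFrom hT) zero_le_one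
      fun x => by simpa using hle x
  have h1 : ‖transfer J T S‖ ≤ 1 := by
    rw [transfer]
    exact (LinearIsometryEquiv.norm_map _ _).trans_le h
  rw [transferSq, ContinuousLinearMap.comp_apply]
  refine (ContinuousLinearMap.le_of_opNorm_le _ h1 _).trans ?_
  rw [one_mul, transfer, ContinuousLinearMap.adjoint_adjoint]
  exact (ContinuousLinearMap.le_of_opNorm_le _ h _).trans_eq (one_mul _)

/-- The evaluation of polynomials in two variables at a pair of commuting operators. -/
theorem exists_polyOp₂_hom {A B : K →L[ℂ] K} (h : A * B = B * A) :
    ∃ Ψ : MvPolynomial (Fin 2) ℂ →ₐ[ℂ] (K →L[ℂ] K), (∀ s, polyOp₂ s A B = Ψ s) ∧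
      Ψ (MvPolynomial.X 0) = A ∧ Ψ (MvPolynomial.X 1) = B := by
  have hcomm : ∀ a ∈ ({A, B} : Set (K →L[ℂ] K)), ∀ b ∈ ({A, B} : Set (K →L[ℂ] K)),
      a * b = b * a := by
    rintro a (rfl | rfl) b (rfl | rfl) <;> simp [h]
  -- Evaluation of polynomials needs a commutative target: the algebra generated by `A` and `B`.
  let _ : CommRing (Algebra.adjoin ℂ ({A, B} : Set (K →L[ℂ] K))) :=
    { (inferInstance : Ring (Algebra.adjoin ℂ ({A, B} : Set (K →L[ℂ] K)))) with
      mul_comm := (Algebra.isMulCommutative_adjoin ℂ hcomm).is_comm.comm }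
  let a : Algebra.adjoin ℂ ({A, B} : Set (K →L[ℂ] K)) := ⟨A, Algebra.subset_adjoin (by simp)⟩
  let b : Algebra.adjoin ℂ ({A, B} : Set (K →L[ℂ] K)) := ⟨B, Algebra.subset_adjoin (by simp)⟩
  let Φ : MvPolynomial (Fin 2) ℂ →ₐ[ℂ] Algebra.adjoin ℂ ({A, B} : Set (K →L[ℂ] K)) :=
    MvPolynomial.aeval ![a, b]
  refine ⟨(Algebra.adjoin ℂ ({A, B} : Set (K →L[ℂ] K))).val.comp Φ, fun s => ?_, ?_, ?_⟩
  · simp only [AlgHom.comp_apply, Φ, MvPolynomial.aeval_def, MvPolynomial.eval₂_eq', map_sum,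
      map_mul, map_pow, Fin.prod_univ_two, Matrix.cons_val_zero, Matrix.cons_val_one]
    refine Finset.sum_congr rfl fun m _ => ?_
    rw [Algebra.smul_def]
    rfl
  · simp [Φ, a]
  · simp [Φ, b]

end KreinOperators

end KreinCalc

namespace KreinCalc

/-! ### The functional calculus for polynomials -/

section PolyFun

/-- The function `z ↦ s(Re z, Im z)`. -/
noncomputable def polyFun (s : MvPolynomial (Fin 2) ℂ) (z : ℂ) : ℂ :=
  MvPolynomial.eval ![(z.re : ℂ), (z.im : ℂ)] s

theorem continuous_polyFun (s : MvPolynomial (Fin 2) ℂ) : Continuous (polyFun s) := by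
  refine (MvPolynomial.continuous_eval s).comp (continuous_pi fun i => ?_)
  fin_cases i
  · exact Complex.continuous_ofReal.comp Complex.continuous_re
  · exact Complex.continuous_ofReal.comp Complex.continuous_im

theorem eval_inZ (t : Polynomial ℂ) (x y : ℂ) : MvPolynomial.eval ![x, y] (inZ t) = t.eval x := by
  have h : (MvPolynomial.aeval ![x, y]).comp inZ = Polynomial.aeval (R := ℂ) x := by
    ext; simp [inZ]
  simpa using congrArg (fun f : Polynomial ℂ →ₐ[ℂ] ℂ => f t) h

theorem eval_inW (t : Polynomial ℂ) (x y : ℂ) : MvPolynomial.eval ![x, y] (inW t) = t.eval y := by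
  have h : (MvPolynomial.aeval ![x, y]).comp inW = Polynomial.aeval (R := ℂ) y := by
    ext; simp [inW]
  simpa using congrArg (fun f : Polynomial ℂ →ₐ[ℂ] ℂ => f t) h

theorem sumPoly_eq (p q : Polynomial ℝ) : sumPoly p q = inZ (cpoly p) + inW (cpoly q) := rfl

theorem polyFun_add (s t : MvPolynomial (Fin 2) ℂ) (z : ℂ) :
    polyFun (s + t) z = polyFun s z + polyFun t z := by simp [polyFun]

theorem polyFun_mul (s t : MvPolynomial (Fin 2) ℂ) (z : ℂ) :
    polyFun (s * t) z = polyFun s z * polyFun t z := by simp [polyFun]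

theorem polyFun_inZ (p : Polynomial ℝ) (z : ℂ) : polyFun (inZ (cpoly p)) z = p.eval z.re := by
  rw [polyFun, eval_inZ, cpoly, Polynomial.eval_map_algebraMap]
  exact Polynomial.aeval_algebraMap_apply ℂ z.re p

theorem polyFun_inW (q : Polynomial ℝ) (z : ℂ) : polyFun (inW (cpoly q)) z = q.eval z.im := by
  rw [polyFun, eval_inW, cpoly, Polynomial.eval_map_algebraMap]
  exact Polynomial.aeval_algebraMap_apply ℂ z.im q

theorem cpoly_ne_zero {p : Polynomial ℝ} (hp : p ≠ 0) : cpoly p ≠ 0 :=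
  (Polynomial.map_ne_zero_iff (algebraMap ℝ ℂ).injective).mpr hp

theorem cpoly_isRoot_ofReal {p : Polynomial ℝ} {a : ℝ} : (cpoly p).IsRoot (a : ℂ) ↔ p.IsRoot a := by
  rw [cpoly, Polynomial.IsRoot, Polynomial.eval_map_algebraMap]
  have h : Polynomial.aeval (a : ℂ) p = ((p.eval a : ℝ) : ℂ) :=
    Polynomial.aeval_algebraMap_apply ℂ a p
  rw [h, Complex.ofReal_eq_zero]
  rfl

theorem polyFun_inZ_eq_zero {p q : Polynomial ℝ} {z : ℂ} (hz : z ∈ crit p q) :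
    polyFun (inZ (cpoly p)) z = 0 := by
  rw [polyFun_inZ, hz.1, Complex.ofReal_zero]

theorem polyFun_inW_eq_zero {p q : Polynomial ℝ} {z : ℂ} (hz : z ∈ crit p q) :
    polyFun (inW (cpoly q)) z = 0 := by
  rw [polyFun_inW, hz.2, Complex.ofReal_zero]

theorem mult_pos {p : Polynomial ℝ} (hp : p ≠ 0) {w : ℂ} (hw : (cpoly p).IsRoot w) :
    0 < mult p w := (Polynomial.rootMultiplicity_pos (cpoly_ne_zero hp)).mpr hw

theorem crit_finite {p q : Polynomial ℝ} (hp : p ≠ 0) (hq : q ≠ 0) : (crit p q).Finite := by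
  have h : (crit p q) ⊆ (fun x : ℝ × ℝ => (⟨x.1, x.2⟩ : ℂ)) '' ({a | p.IsRoot a} ×ˢ {b | q.IsRoot b}) :=
    fun z hz => ⟨(z.re, z.im), hz, rfl⟩
  exact (((Polynomial.finite_setOfPred_isRoot hp).prod (Polynomial.finite_setOfPred_isRoot hq)).image _).subset h

end PolyFun

namespace Model

set_option linter.unusedSectionVars false

variable {K : Type*} [NormedAddCommGroup K] [InnerProductSpace ℂ K] [CompleteSpace K]
variable {V : Type*} [NormedAddCommGroup V] [InnerProductSpace ℂ V] [CompleteSpace V]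
variable {V₁ : Type*} [NormedAddCommGroup V₁] [InnerProductSpace ℂ V₁] [CompleteSpace V₁]
variable {V₂ : Type*} [NormedAddCommGroup V₂] [InnerProductSpace ℂ V₂] [CompleteSpace V₂]
variable {J : FundamentalSymmetry K} (M : Model J V V₁ V₂)

/-- The evaluation of polynomials in two variables at the pair `(A, B)`. -/
noncomputable def evalOp : MvPolynomial (Fin 2) ℂ →ₐ[ℂ] (K →L[ℂ] K) :=
  (exists_polyOp₂_hom (J.rePart_mul_imPart M.normal)).choose

theorem polyOp₂_eq (s : MvPolynomial (Fin 2) ℂ) :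
    polyOp₂ s (J.rePart M.N) (J.imPart M.N) = M.evalOp s :=
  (exists_polyOp₂_hom (J.rePart_mul_imPart M.normal)).choose_spec.1 s

theorem evalOp_X_zero : M.evalOp (MvPolynomial.X 0) = J.rePart M.N :=
  (exists_polyOp₂_hom (J.rePart_mul_imPart M.normal)).choose_spec.2.1

theorem evalOp_X_one : M.evalOp (MvPolynomial.X 1) = J.imPart M.N :=
  (exists_polyOp₂_hom (J.rePart_mul_imPart M.normal)).choose_spec.2.2

theorem evalOp_C (c : ℂ) : M.evalOp (MvPolynomial.C c) = c • 1 := by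
  rw [← MvPolynomial.algebraMap_eq, AlgHom.commutes, Algebra.algebraMap_eq_smul_one]

theorem evalOp_inZ (t : Polynomial ℂ) : M.evalOp (inZ t) = Polynomial.aeval (J.rePart M.N) t := by
  rw [inZ, ← Polynomial.aeval_algHom_apply, evalOp_X_zero]

theorem evalOp_inW (t : Polynomial ℂ) : M.evalOp (inW t) = Polynomial.aeval (J.imPart M.N) t := by
  rw [inW, ← Polynomial.aeval_algHom_apply, evalOp_X_one]

theorem evalOp_sumPoly : M.evalOp (sumPoly M.p M.q) = M.fac.T.comp (J.adjFrom M.fac.T) := by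
  rw [M.fac.factor, sumPoly_eq, map_add, evalOp_inZ, evalOp_inW]; rfl

theorem evalOp_N : M.evalOp (MvPolynomial.X 0 + MvPolynomial.C Complex.I * MvPolynomial.X 1) = M.N := by
  rw [map_add, map_mul, evalOp_C, evalOp_X_zero, evalOp_X_one, smul_mul_assoc, one_mul,
    J.rePart_add_imPart]

theorem evalOp_adj_N :
    M.evalOp (MvPolynomial.X 0 - MvPolynomial.C Complex.I * MvPolynomial.X 1) = J.adj M.N := by
  rw [map_sub, map_mul, evalOp_C, evalOp_X_zero, evalOp_X_one, smul_mul_assoc, one_mul,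
    J.rePart_sub_imPart]

theorem evalOp_comm (s t : MvPolynomial (Fin 2) ℂ) :
    M.evalOp s * M.evalOp t = M.evalOp t * M.evalOp s := by
  rw [← map_mul, mul_comm, map_mul]

theorem N_comm : M.N * M.fac.T.comp (J.adjFrom M.fac.T) = M.fac.T.comp (J.adjFrom M.fac.T) * M.N := by
  rw [← evalOp_sumPoly, ← M.evalOp_N, evalOp_comm]

theorem comp_thetaN : M.fac.T.comp M.thetaN = M.N.comp M.fac.T :=
  comp_theta (J := J) M.fac.injective M.N_comm

theorem comp_adjoint_thetaN :
    M.fac.T.comp (ContinuousLinearMap.adjoint M.thetaN) = (J.adj M.N).comp M.fac.T :=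
  comp_adjoint_of_comp_eq M.fac.injective M.N_comm M.comp_thetaN

theorem T_thetaN (v : V) : M.fac.T (M.thetaN v) = M.N (M.fac.T v) :=
  congrArg (fun S : V →L[ℂ] K => S v) M.comp_thetaN

theorem T_adjoint_thetaN (v : V) :
    M.fac.T (ContinuousLinearMap.adjoint M.thetaN v) = J.adj M.N (M.fac.T v) :=
  congrArg (fun S : V →L[ℂ] K => S v) M.comp_adjoint_thetaN

instance : IsStarNormal M.thetaN := by
  refine ⟨?_⟩
  ext v
  apply M.fac.injective
  simp only [ContinuousLinearMap.star_eq_adjoint, mul_apply_eq_comp, T_thetaN, T_adjoint_thetaN]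
  exact (congrArg (fun S : K →L[ℂ] K => S (M.fac.T v)) M.normal).symm

/-- The operator `s(Θ(A), Θ(B))`. -/
noncomputable def polyTheta (s : MvPolynomial (Fin 2) ℂ) : V →L[ℂ] V := cfc (polyFun s) M.thetaN

theorem cfc_re : cfc (fun z : ℂ => (z.re : ℂ)) M.thetaN =
    (1 / 2 : ℂ) • (M.thetaN + ContinuousLinearMap.adjoint M.thetaN) := by
  have h : (fun z : ℂ => (z.re : ℂ)) = fun z => (1 / 2 : ℂ) * (z + star z) := by
    ext z
    rw [Complex.re_eq_add_conj]; simp; ring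
  have h1 := cfc_star_id (R := ℂ) M.thetaN
  rw [h, cfc_const_mul (a := M.thetaN) _ _ (by fun_prop), cfc_add (a := M.thetaN) (fun z : ℂ => z)
    (fun z : ℂ => star z) (by fun_prop) (by fun_prop), h1, cfc_id' ℂ M.thetaN]
  rfl

theorem cfc_im : cfc (fun z : ℂ => (z.im : ℂ)) M.thetaN =
    (1 / (2 * Complex.I) : ℂ) • (M.thetaN - ContinuousLinearMap.adjoint M.thetaN) := by
  have h : (fun z : ℂ => (z.im : ℂ)) = fun z => (1 / (2 * Complex.I) : ℂ) * (z - star z) := by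
    ext z
    rw [Complex.im_eq_sub_conj]
    change _ = 1 / (2 * Complex.I) * (z - (starRingEnd ℂ) z)
    ring
  have h1 := cfc_star_id (R := ℂ) M.thetaN
  rw [h, cfc_const_mul (a := M.thetaN) _ _ (by fun_prop), cfc_sub (a := M.thetaN) (fun z : ℂ => z)
    (fun z : ℂ => star z) (by fun_prop) (by fun_prop), h1, cfc_id' ℂ M.thetaN]
  rfl

theorem polyTheta_mul (s t : MvPolynomial (Fin 2) ℂ) :
    M.polyTheta (s * t) = M.polyTheta s * M.polyTheta t := by
  rw [polyTheta, polyTheta, polyTheta, ← cfc_mul (polyFun s) (polyFun t) M.thetaN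
    (continuous_polyFun s).continuousOn (continuous_polyFun t).continuousOn]
  congr 1
  ext z
  exact polyFun_mul s t z

theorem polyTheta_add (s t : MvPolynomial (Fin 2) ℂ) :
    M.polyTheta (s + t) = M.polyTheta s + M.polyTheta t := by
  rw [polyTheta, polyTheta, polyTheta, ← cfc_add (a := M.thetaN) (polyFun s) (polyFun t)
    (continuous_polyFun s).continuousOn (continuous_polyFun t).continuousOn]
  congr 1
  ext z
  exact polyFun_add s t z

/-- Only constants and the two variables need checking; the latter become the real and imaginary
part of `Θ(N)`, and `T` intertwines `Θ(N)` with `N` and its adjoint with `N^*`. -/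
theorem T_polyTheta (s : MvPolynomial (Fin 2) ℂ) (v : V) :
    M.fac.T (M.polyTheta s v) = M.evalOp s (M.fac.T v) := by
  induction s using MvPolynomial.induction_on generalizing v with
  | C c =>
    have h : polyFun (MvPolynomial.C c) = fun _ => c := by ext z; simp [polyFun]
    rw [polyTheta, h, cfc_const c M.thetaN, evalOp_C, Algebra.algebraMap_eq_smul_one]
    simp
  | add s t hs ht => rw [polyTheta_add, map_add, add_apply, map_add, hs, ht]; rfl
  | mul_X s j hs =>
    rw [polyTheta_mul, map_mul, mul_apply_eq_comp, mul_apply_eq_comp, hs]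
    congr 1
    fin_cases j
    · have h : polyFun (MvPolynomial.X 0) = fun z => (z.re : ℂ) := by ext z; simp [polyFun]
      change M.fac.T (M.polyTheta (MvPolynomial.X 0) v) = M.evalOp (MvPolynomial.X 0) _
      rw [polyTheta, h, cfc_re, evalOp_X_zero]
      simp only [FundamentalSymmetry.rePart, smul_apply, add_apply, map_smul, map_add, T_thetaN,
        T_adjoint_thetaN]
    · have h : polyFun (MvPolynomial.X 1) = fun z => (z.im : ℂ) := by ext z; simp [polyFun]
      change M.fac.T (M.polyTheta (MvPolynomial.X 1) v) = M.evalOp (MvPolynomial.X 1) _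
      rw [polyTheta, h, cfc_im, evalOp_X_one]
      simp only [FundamentalSymmetry.imPart, smul_apply, sub_apply, map_smul, map_sub, T_thetaN, T_adjoint_thetaN]

theorem polyTheta_adjFrom (s : MvPolynomial (Fin 2) ℂ) (x : K) :
    M.polyTheta s (J.adjFrom M.fac.T x) = J.adjFrom M.fac.T (M.evalOp s x) := by
  apply M.fac.injective
  have h := congrArg (fun S : K →L[ℂ] K => S x) (M.evalOp_comm s (sumPoly M.p M.q))
  rw [T_polyTheta]
  rw [evalOp_sumPoly] at h
  exact h

/-- `T(T^* T) = (T T^*)T = (p+q)(A,B) T`, and `T` is injective. -/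
theorem adjFrom_T (v : V) : J.adjFrom M.fac.T (M.fac.T v) = M.polyTheta (sumPoly M.p M.q) v := by
  apply M.fac.injective
  rw [T_polyTheta, evalOp_sumPoly]
  rfl

/-! ### The operators `R_j R_j^*` and the size of `p + q` on the spectrum -/

/-- The operator `R₁ R₁^*`. -/
noncomputable def G₁ : V →L[ℂ] V := transferSq J M.fac.T M.fac₁.T

/-- The operator `R₂ R₂^*`. -/
noncomputable def G₂ : V →L[ℂ] V := transferSq J M.fac.T M.fac₂.T

theorem norm_adjFrom_sq {U : Type*} [NormedAddCommGroup U] [InnerProductSpace ℂ U]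
    [CompleteSpace U] (S : U →L[ℂ] K) (x : K) :
    ((‖J.adjFrom S x‖ ^ 2 : ℝ) : ℂ) = J.form (S.comp (J.adjFrom S) x) x := by
  rw [← inner_adjFrom_adjFrom, inner_self_eq_norm_sq_to_K]
  norm_cast

theorem norm_adjFrom_sq_add (x : K) : ‖J.adjFrom M.fac.T x‖ ^ 2 =
    ‖J.adjFrom M.fac₁.T x‖ ^ 2 + ‖J.adjFrom M.fac₂.T x‖ ^ 2 := by
  apply Complex.ofReal_injective
  rw [Complex.ofReal_add, norm_adjFrom_sq, norm_adjFrom_sq, norm_adjFrom_sq, M.fac.factor,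
    M.fac₁.factor, M.fac₂.factor]
  simp [FundamentalSymmetry.form]

theorem norm_adjFrom₁_le (x : K) : ‖J.adjFrom M.fac₁.T x‖ ≤ ‖J.adjFrom M.fac.T x‖ := by
  have h := M.norm_adjFrom_sq_add x
  exact le_of_sq_le_sq (by nlinarith [sq_nonneg ‖J.adjFrom M.fac₂.T x‖]) (norm_nonneg _)

theorem norm_adjFrom₂_le (x : K) : ‖J.adjFrom M.fac₂.T x‖ ≤ ‖J.adjFrom M.fac.T x‖ := by
  have h := M.norm_adjFrom_sq_add x
  exact le_of_sq_le_sq (by nlinarith [sq_nonneg ‖J.adjFrom M.fac₁.T x‖]) (norm_nonneg _)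

theorem T_G₁_adjFrom (x : K) :
    M.fac.T (M.G₁ (J.adjFrom M.fac.T x)) = M.evalOp (inZ (cpoly M.p)) x := by
  rw [G₁, comp_transferSq M.fac.injective M.norm_adjFrom₁_le, evalOp_inZ]
  exact congrArg (fun S : K →L[ℂ] K => S x) M.fac₁.factor

theorem T_G₂_adjFrom (x : K) :
    M.fac.T (M.G₂ (J.adjFrom M.fac.T x)) = M.evalOp (inW (cpoly M.q)) x := by
  rw [G₂, comp_transferSq M.fac.injective M.norm_adjFrom₂_le, evalOp_inW]
  exact congrArg (fun S : K →L[ℂ] K => S x) M.fac₂.factor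

/-- `T G T^*` determines `G`, since `T` is injective and `T^*` has dense range. Used for `G₁` with
`p(z)` and for `G₂` with `q(w)`. -/
theorem commute_of_T_adjFrom {G : V →L[ℂ] V} {t : MvPolynomial (Fin 2) ℂ}
    (hG : ∀ x, M.fac.T (G (J.adjFrom M.fac.T x)) = M.evalOp t x) (s : MvPolynomial (Fin 2) ℂ) :
    G * M.polyTheta s = M.polyTheta s * G := by
  refine eq_of_comp_adjFrom_eq (J := J) M.fac.injective fun x => M.fac.injective ?_
  rw [mul_apply_eq_comp, mul_apply_eq_comp, polyTheta_adjFrom, hG, T_polyTheta, hG]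
  exact congrArg (fun S : K →L[ℂ] K => S x) (M.evalOp_comm t s)

/-- The operator form of `G = t/(p+q)`: insert `T^* T = (p+q)(Θ)` into `T G T^* = t(A,B)`. -/
theorem mul_polyTheta_sumPoly {G : V →L[ℂ] V} {t : MvPolynomial (Fin 2) ℂ}
    (hG : ∀ x, M.fac.T (G (J.adjFrom M.fac.T x)) = M.evalOp t x) :
    G * M.polyTheta (sumPoly M.p M.q) = M.polyTheta t := by
  ext v
  apply M.fac.injective
  rw [mul_apply_eq_comp, ← adjFrom_T, hG, T_polyTheta]

/-- A contraction `G` with `G (p+q)(Θ) = t(Θ)` makes the functional calculus of `|p+q|² - |t|²` a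
positive operator, so this function is nonnegative on the spectrum. -/
theorem norm_le_norm_of_mem_σΘ {G : V →L[ℂ] V} {t : MvPolynomial (Fin 2) ℂ}
    (hG : ∀ x, M.fac.T (G (J.adjFrom M.fac.T x)) = M.evalOp t x) (hG1 : ∀ v, ‖G v‖ ≤ ‖v‖)
    {z : ℂ} (hz : z ∈ M.σΘ) : ‖polyFun t z‖ ≤ ‖polyFun (sumPoly M.p M.q) z‖ := by
  have ht := continuous_polyFun t
  have hs := continuous_polyFun (sumPoly M.p M.q)
  let d : ℂ → ℝ := fun z => ‖polyFun (sumPoly M.p M.q) z‖ ^ 2 - ‖polyFun t z‖ ^ 2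
  have hd : Continuous d := (hs.norm.pow 2).sub (ht.norm.pow 2)
  have hdc : Continuous fun z => (d z : ℂ) := Complex.continuous_ofReal.comp hd
  have hint : ∀ {f : ℂ → ℂ}, Continuous f → ∀ x,
      MeasureTheory.Integrable (fun z => ‖f z‖ ^ 2) (scalarMeasure M.thetaN x) := fun hf x => by
    have := ((IsSpectral.of_continuous M.thetaN hf).mul
      (IsSpectral.of_continuous M.thetaN hf)).integrable x
    simpa [sq] using this.norm
  have h0 : (0 : V →L[ℂ] V) ≤ cfc (fun z => (d z : ℂ)) M.thetaN := by
    rw [ContinuousLinearMap.nonneg_iff_isPositive, ContinuousLinearMap.isPositive_iff_complex]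
    intro x
    have h1 : ⟪x, cfc (fun z => (d z : ℂ)) M.thetaN x⟫_ℂ =
        ((‖M.polyTheta (sumPoly M.p M.q) x‖ ^ 2 - ‖M.polyTheta t x‖ ^ 2 : ℝ) : ℂ) := by
      rw [← integral_scalarMeasure _ _ hdc, integral_complex_ofReal, polyTheta, polyTheta,
        norm_cfc_apply_sq _ hs, norm_cfc_apply_sq _ ht,
        MeasureTheory.integral_sub (hint hs x) (hint ht x)]
    rw [← inner_conj_symm, h1, Complex.conj_ofReal]
    refine ⟨rfl, ?_⟩
    have h2 : ‖M.polyTheta t x‖ ≤ ‖M.polyTheta (sumPoly M.p M.q) x‖ := by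
      rw [← M.mul_polyTheta_sumPoly hG]
      exact hG1 _
    have h3 := pow_le_pow_left₀ (norm_nonneg _) h2 2
    exact sub_nonneg.mpr h3
  have h1 := (cfc_nonneg_iff (fun z => (d z : ℂ)) M.thetaN hdc.continuousOn).mp h0 z hz
  have h2 : 0 ≤ d z := by exact_mod_cast h1
  exact le_of_sq_le_sq (sub_nonneg.mp h2) (norm_nonneg _)

theorem norm_inZ_le {z : ℂ} (hz : z ∈ M.σΘ) :
    ‖polyFun (inZ (cpoly M.p)) z‖ ≤ ‖polyFun (sumPoly M.p M.q) z‖ :=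
  M.norm_le_norm_of_mem_σΘ M.T_G₁_adjFrom
    (norm_transferSq_apply_le M.fac.injective M.norm_adjFrom₁_le) hz

theorem norm_inW_le {z : ℂ} (hz : z ∈ M.σΘ) :
    ‖polyFun (inW (cpoly M.q)) z‖ ≤ ‖polyFun (sumPoly M.p M.q) z‖ :=
  M.norm_le_norm_of_mem_σΘ M.T_G₂_adjFrom
    (norm_transferSq_apply_le M.fac.injective M.norm_adjFrom₂_le) hz

theorem mem_crit_of_sumPoly_eq_zero {z : ℂ} (hz : z ∈ M.σΘ)
    (h : polyFun (sumPoly M.p M.q) z = 0) : z ∈ crit M.p M.q := by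
  have h1 := M.norm_inZ_le hz
  have h2 := M.norm_inW_le hz
  rw [h, norm_zero, norm_le_zero_iff, polyFun_inZ, Complex.ofReal_eq_zero] at h1
  rw [h, norm_zero, norm_le_zero_iff, polyFun_inW, Complex.ofReal_eq_zero] at h2
  exact ⟨h1, h2⟩

end Model

end KreinCalc

namespace KreinCalc

/-! ### Independence of the decomposition -/

section Decompositions

variable {p q : Polynomial ℝ} {σ : Set ℂ}

theorem ofPoly_reg (s : MvPolynomial (Fin 2) ℂ) (z : ↥(σ \ crit p q)) :
    (MFun.ofPoly p q σ s).reg z = polyFun s z := rfl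

theorem InR.taylorCoeff_eq {φ : MFun p q σ} {s : MvPolynomial (Fin 2) ℂ}
    (h : (φ - MFun.ofPoly p q σ s).InR) (z : crit p q) (k : Fin (mult p (z : ℂ).re))
    (l : Fin (mult q (z : ℂ).im)) :
    taylorCoeff s k l (z : ℂ).re (z : ℂ).im = (φ.jet z).1 (k, l) := by
  have h1 := congrFun (h.1 z) (k, l)
  exact (sub_eq_zero.mp h1).symm

theorem InR.taylorCoeff_eq_nonreal {φ : MFun p q σ} {s : MvPolynomial (Fin 2) ℂ}
    (h : (φ - MFun.ofPoly p q σ s).InR) (ζ : nonrealPairs p q) (k : Fin (mult p (ζ : ℂ × ℂ).1))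
    (l : Fin (mult q (ζ : ℂ × ℂ).2)) :
    taylorCoeff s k l (ζ : ℂ × ℂ).1 (ζ : ℂ × ℂ).2 = φ.nonreal ζ (k, l) := by
  have h1 := congrFun (h.2 ζ) (k, l)
  exact (sub_eq_zero.mp h1).symm

/-- `Z` and `Z^i` together exhaust the pairs of complex zeros of `p` and `q`. -/
theorem inR_zero_sub_iff {s : MvPolynomial (Fin 2) ℂ} :
    (0 - MFun.ofPoly p q σ s : MFun p q σ).InR ↔ ∀ α β, (cpoly p).IsRoot α → (cpoly q).IsRoot β →
      s ∈ jetIdeal α β (mult p α) (mult q β) := by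
  constructor
  · intro h α β hα hβ
    rw [mem_jetIdeal_iff]
    intro k hk l hl
    by_cases hreal : α.im = 0 ∧ β.im = 0
    · obtain ⟨a, rfl⟩ : ∃ a : ℝ, α = a := ⟨α.re, Complex.ext rfl (by simpa using hreal.1)⟩
      obtain ⟨b, rfl⟩ : ∃ b : ℝ, β = b := ⟨β.re, Complex.ext rfl (by simpa using hreal.2)⟩
      exact InR.taylorCoeff_eq h ⟨⟨a, b⟩, cpoly_isRoot_ofReal.mp hα, cpoly_isRoot_ofReal.mp hβ⟩
        ⟨k, hk⟩ ⟨l, hl⟩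
    · exact InR.taylorCoeff_eq_nonreal h ⟨(α, β), hα, hβ, hreal⟩ ⟨k, hk⟩ ⟨l, hl⟩
  · intro h
    constructor
    · intro z
      have hz := h _ _ (cpoly_isRoot_ofReal.mpr z.2.1) (cpoly_isRoot_ofReal.mpr z.2.2)
      ext ⟨k, l⟩
      have h1 := mem_jetIdeal_iff.mp hz k k.2 l l.2
      change 0 - taylorCoeff s k l (z : ℂ).re (z : ℂ).im = 0
      rw [h1, sub_zero]
    · intro ζ
      have hz := h _ _ ζ.2.1 ζ.2.2.1
      ext ⟨k, l⟩
      have h1 := mem_jetIdeal_iff.mp hz k k.2 l l.2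
      change 0 - taylorCoeff s k l (ζ : ℂ × ℂ).1 (ζ : ℂ × ℂ).2 = 0
      rw [h1, sub_zero]

/-- `c` and `d` are the values at `a`, `b` of the cofactors of the full root powers. They do not
depend on `u`, `v`, so `u = v = 1` gives the entries of `p + q`, and dividing by them recovers
`u(a,b)` and `v(a,b)`. -/
theorem taylorCoeff_inZ_add_inW {P Q : Polynomial ℂ}
    (hP : P ≠ 0) (hQ : Q ≠ 0) {a b : ℂ} (ha : P.IsRoot a) (hb : Q.IsRoot b) :
    ∃ c d : ℂ, c ≠ 0 ∧ d ≠ 0 ∧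
      ∀ u v, taylorCoeff (u * inZ P + v * inW Q) (P.rootMultiplicity a) 0 a b =
        c * MvPolynomial.eval ![a, b] u ∧
      taylorCoeff (u * inZ P + v * inW Q) 0 (Q.rootMultiplicity b) a b =
        d * MvPolynomial.eval ![a, b] v := by
  obtain ⟨P', hP', hPa⟩ := Polynomial.exists_eq_pow_rootMultiplicity_mul_and_not_dvd P hP a
  obtain ⟨Q', hQ', hQb⟩ := Polynomial.exists_eq_pow_rootMultiplicity_mul_and_not_dvd Q hQ b
  have hm := (Polynomial.rootMultiplicity_pos hP).mpr ha
  have hn := (Polynomial.rootMultiplicity_pos hQ).mpr hb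
  refine ⟨P'.eval a, Q'.eval b, fun h => hPa (Polynomial.dvd_iff_isRoot.mpr h),
    fun h => hQb (Polynomial.dvd_iff_isRoot.mpr h), fun u v => ?_⟩
  have h : u * inZ P + v * inW Q =
      (u * inZ P') * (MvPolynomial.X 0 - MvPolynomial.C a) ^ P.rootMultiplicity a +
      (v * inW Q') * (MvPolynomial.X 1 - MvPolynomial.C b) ^ Q.rootMultiplicity b := by
    conv_lhs => rw [hP', hQ']
    rw [map_mul, map_mul, inZ_X_sub_C_pow, inW_X_sub_C_pow]
    ring
  rw [h, taylorCoeff_combination, taylorCoeff_combination]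
  simp [hm.ne', hn.ne', taylorCoeff_zero_zero, eval_inZ, eval_inW, mul_comm]

/-- The product of a polynomial with a function on the spectrum. -/
noncomputable def GFun.polyMul (r : MvPolynomial (Fin 2) ℂ) (g : GFun p q σ) : GFun p q σ where
  reg z := polyFun r z * g.reg z
  pair z := (polyFun r z * (g.pair z).1, polyFun r z * (g.pair z).2)

/-- The difference of two functions on the spectrum. -/
def GFun.diff (g h : GFun p q σ) : GFun p q σ where
  reg z := g.reg z - h.reg z
  pair z := ((g.pair z).1 - (h.pair z).1, (g.pair z).2 - (h.pair z).2)

theorem IsDecomposition.diff {φ ψ : MFun p q σ} {s t : MvPolynomial (Fin 2) ℂ}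
    {g h : GFun p q σ} (hφ : IsDecomposition φ s g) (hψ : IsDecomposition ψ t h) :
    IsDecomposition (φ - ψ) (s - t) (g.diff h) := by
  obtain ⟨C, hC⟩ := hφ.bounded
  obtain ⟨C', hC'⟩ := hψ.bounded
  refine ⟨⟨fun z => ?_, fun ζ => ?_⟩, hφ.measurable.sub hψ.measurable,
    ⟨C + C', fun z => (norm_sub_le _ _).trans (add_le_add (hC z) (hC' z))⟩, fun z => ?_, fun z => ?_⟩
  · ext ⟨k, l⟩
    change (φ.jet z).1 (k, l) - (ψ.jet z).1 (k, l) - taylorCoeff (s - t) k l _ _ = 0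
    rw [taylorCoeff_sub, InR.taylorCoeff_eq hφ.sub_mem, InR.taylorCoeff_eq hψ.sub_mem, sub_self]
  · ext ⟨k, l⟩
    change φ.nonreal ζ (k, l) - ψ.nonreal ζ (k, l) - taylorCoeff (s - t) k l _ _ = 0
    rw [taylorCoeff_sub, InR.taylorCoeff_eq_nonreal hφ.sub_mem,
      InR.taylorCoeff_eq_nonreal hψ.sub_mem, sub_self]
  · have h1 := hφ.eq_reg z
    have h2 := hψ.eq_reg z
    change φ.reg z - ψ.reg z = polyFun (s - t) z + polyFun (sumPoly p q) z * (g.reg z - h.reg z)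
    rw [h1, h2]
    simp only [ofPoly_reg]
    simp only [polyFun, map_sub]
    ring
  · have h1 := hφ.eq_jet z
    have h2 := hψ.eq_jet z
    change φ.jet ⟨z, z.2.2⟩ - ψ.jet ⟨z, z.2.2⟩ = _
    rw [h1, h2]
    refine Prod.ext (funext fun kl => ?_) (Prod.ext ?_ ?_)
    · simp only [MFun.ofPoly, Prod.fst_sub, Prod.fst_add, Pi.sub_apply, Pi.add_apply,
        taylorCoeff_sub, Pi.zero_apply]
      ring
    · simp only [MFun.ofPoly, Prod.fst_sub, Prod.snd_sub, Prod.fst_add, Prod.snd_add,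
        taylorCoeff_sub, GFun.diff]
      ring
    · simp only [MFun.ofPoly, Prod.snd_sub, Prod.snd_add,
        taylorCoeff_sub, GFun.diff]
      ring

/-- If `r s` has vanishing jets, then the product of `r` with a decomposition `(s, g)` of a function
which vanishes on `σ` is a decomposition of zero. -/
theorem IsDecomposition.polyMul {χ : MFun p q σ} {s r : MvPolynomial (Fin 2) ℂ} {g : GFun p q σ}
    (hp : p ≠ 0) (hq : q ≠ 0) (hσ : IsCompact σ) (h : IsDecomposition χ s g)
    (hreg : ∀ z, χ.reg z = 0) (hjet : ∀ z : crit p q, (z : ℂ) ∈ σ → χ.jet z = 0)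
    (hr : ∀ α β, (cpoly p).IsRoot α → (cpoly q).IsRoot β →
      r * s ∈ jetIdeal α β (mult p α) (mult q β)) :
    IsDecomposition (0 : MFun p q σ) (r * s) (g.polyMul r) := by
  obtain ⟨C, hC⟩ := h.bounded
  obtain ⟨C', hC'⟩ := hσ.exists_bound_of_continuousOn (continuous_polyFun r).continuousOn
  refine ⟨inR_zero_sub_iff.mpr hr, ?_, ⟨C' * C, fun z => ?_⟩, fun z => ?_, fun z => ?_⟩
  · exact ((continuous_polyFun r).measurable.comp measurable_subtype_coe).mul h.measurable
  · rw [GFun.polyMul, norm_mul]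
    exact mul_le_mul (hC' z z.2.1) (hC z) (norm_nonneg _) ((norm_nonneg _).trans (hC' z z.2.1))
  · have h1 := h.eq_reg z
    rw [hreg] at h1
    simp only [ofPoly_reg] at h1 ⊢
    change 0 = polyFun (r * s) z + polyFun (sumPoly p q) z * (polyFun r z * g.reg z)
    rw [polyFun_mul]
    linear_combination polyFun r z * h1
  · have hcrit := z.2.2
    have hrt := hr _ _ (cpoly_isRoot_ofReal.mpr hcrit.1) (cpoly_isRoot_ofReal.mpr hcrit.2)
    have hm := mult_pos hp (cpoly_isRoot_ofReal.mpr hcrit.1)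
    have hn := mult_pos hq (cpoly_isRoot_ofReal.mpr hcrit.2)
    have h1 := h.eq_jet z
    rw [hjet ⟨z, z.2.2⟩ z.2.1] at h1
    -- On `σ ∩ Z` already `s` has vanishing lower jet, so multiplication by `r` scales the entries
    -- `(m,0)` and `(0,n)` by the value of `r`, without Leibniz terms.
    have hs : s ∈ jetIdeal (z : ℂ).re (z : ℂ).im (mult p (z : ℂ).re) (mult q (z : ℂ).im) := by
      rw [mem_jetIdeal_iff]
      intro k hk l hl
      rw [InR.taylorCoeff_eq h.sub_mem ⟨z, hcrit⟩ ⟨k, hk⟩ ⟨l, hl⟩, hjet _ z.2.1]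
      rfl
    obtain ⟨u, v, huv⟩ := mem_jetIdeal.mp hs
    have hmul : r * s = (r * u) * (MvPolynomial.X 0 - MvPolynomial.C ((z : ℂ).re : ℂ)) ^
          mult p (z : ℂ).re +
        (r * v) * (MvPolynomial.X 1 - MvPolynomial.C ((z : ℂ).im : ℂ)) ^ mult q (z : ℂ).im := by
      rw [← huv]; ring
    have h10 : taylorCoeff (r * s) (mult p (z : ℂ).re) 0 (z : ℂ).re (z : ℂ).im =
        polyFun r z * taylorCoeff s (mult p (z : ℂ).re) 0 (z : ℂ).re (z : ℂ).im := by
      rw [hmul, ← huv, taylorCoeff_combination, taylorCoeff_combination]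
      simp [hn.ne', taylorCoeff_zero_zero, polyFun]
    have h01 : taylorCoeff (r * s) 0 (mult q (z : ℂ).im) (z : ℂ).re (z : ℂ).im =
        polyFun r z * taylorCoeff s 0 (mult q (z : ℂ).im) (z : ℂ).re (z : ℂ).im := by
      rw [hmul, ← huv, taylorCoeff_combination, taylorCoeff_combination]
      simp [hm.ne', taylorCoeff_zero_zero, polyFun]
    refine Prod.ext (funext fun kl => ?_) (Prod.ext ?_ ?_)
    · change 0 = taylorCoeff (r * s) kl.1 kl.2 _ _ + 0
      rw [mem_jetIdeal_iff.mp hrt _ kl.1.2 _ kl.2.2, add_zero]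
    · have h2 := congrArg (fun x => x.2.1) h1
      simp only [MFun.ofPoly, Prod.snd_add, Prod.fst_add, GFun.polyMul] at h2 ⊢
      change 0 = _ at h2
      change 0 = _
      rw [h10]
      linear_combination polyFun r z * h2
    · have h2 := congrArg (fun x => x.2.2) h1
      simp only [MFun.ofPoly, Prod.snd_add, GFun.polyMul] at h2 ⊢
      change 0 = _ at h2
      change 0 = _
      rw [h01]
      linear_combination polyFun r z * h2

end Decompositions

/-! ### A vanishing criterion for operators on `V` -/

section SpectralProjections

variable {V : Type*} [NormedAddCommGroup V] [InnerProductSpace ℂ V] [CompleteSpace V]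
variable (D : V →L[ℂ] V) [IsStarNormal D]

theorem adjoint_spectralProj_singleton (w : ℂ) :
    ContinuousLinearMap.adjoint (spectralProj D {w}) = spectralProj D {w} := by
  have hi := IsSpectral.indicator_one D (measurableSet_singleton w)
  refine eq_of_inner_self_eq fun x => ?_
  rw [ContinuousLinearMap.adjoint_inner_right, ← inner_conj_symm, spectralProj,
    inner_spectralIntegral_self D hi, ← integral_conj]
  congr 1
  ext z
  by_cases hz : z = w <;> simp [hz]

theorem spectralProj_singleton_mul (w w' : ℂ) [Decidable (w = w')] :
    spectralProj D {w'} * spectralProj D {w} = if w = w' then spectralProj D {w} else 0 := by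
  have hi := IsSpectral.indicator_one D (measurableSet_singleton w')
  have h := spectralIntegral_mul_spectralProj_singleton D hi w
  rw [spectralProj, h]
  split_ifs with hw <;> simp [hw]

/-- An operator `Y` vanishes if `Y f(D) = 0` and if `Y` vanishes on the eigenspaces of `D` which
belong to the finitely many zeros of `f`. -/
theorem eq_zero_of_mul_cfc_eq_zero {Y : V →L[ℂ] V} {f : ℂ → ℂ} (hf : Continuous f) (S : Finset ℂ)
    (hS : ∀ z ∈ spectrum ℂ D, f z = 0 → z ∈ S) (hY : Y * cfc f D = 0)
    (hYS : ∀ w ∈ S, Y * spectralProj D {w} = 0) : Y = 0 := by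
  -- Adjoints turn `Y f(D) = 0` into: the range of `Y^*` lies in the kernel of the conjugate of `f`
  -- at `D`, which the eigenspaces span. There `E{w} Y^* = (Y E{w})^* = 0`.
  have h : ContinuousLinearMap.adjoint Y = 0 := by
    ext x
    have h1 : cfc (fun z => star (f z)) D (ContinuousLinearMap.adjoint Y x) = 0 := by
      have h2 := congrArg (fun Z : V →L[ℂ] V => star Z x) hY
      simp only [star_mul, star_zero] at h2
      rw [cfc_star]
      exact h2
    rw [eq_sum_spectralProj_of_cfc_apply_eq_zero D hf.star S
      (fun z hz h0 => hS z hz (star_eq_zero.mp h0)) h1]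
    refine Finset.sum_eq_zero fun w hw => ?_
    have h2 := congrArg (fun Z : V →L[ℂ] V => star Z x) (hYS w hw)
    simp only [star_mul, star_zero] at h2
    rw [← adjoint_spectralProj_singleton]
    exact h2
  rw [← ContinuousLinearMap.adjoint_adjoint Y, h, map_zero]

end SpectralProjections

namespace Model

set_option linter.unusedSectionVars false

variable {K : Type*} [NormedAddCommGroup K] [InnerProductSpace ℂ K] [CompleteSpace K]
variable {V : Type*} [NormedAddCommGroup V] [InnerProductSpace ℂ V] [CompleteSpace V]
variable {V₁ : Type*} [NormedAddCommGroup V₁] [InnerProductSpace ℂ V₁] [CompleteSpace V₁]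
variable {V₂ : Type*} [NormedAddCommGroup V₂] [InnerProductSpace ℂ V₂] [CompleteSpace V₂]
variable {J : FundamentalSymmetry K} (M : Model J V V₁ V₂)

theorem p_ne_zero : M.p ≠ 0 := M.definitizing_re.1

theorem q_ne_zero : M.q ≠ 0 := M.definitizing_im.1

theorem finite_inter_crit : (M.σΘ ∩ crit M.p M.q).Finite :=
  (crit_finite M.p_ne_zero M.q_ne_zero).subset Set.inter_subset_right

theorem isCompact_σΘ : IsCompact M.σΘ := spectrum.isCompact M.thetaN

/-- The extension by zero. -/
noncomputable def extendReg (g : GFun M.p M.q M.σΘ) : ℂ → ℂ := Function.extend Subtype.val g.reg 0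

theorem extendReg_apply (g : GFun M.p M.q M.σΘ) {z : ℂ} (hz : z ∈ M.σΘ \ crit M.p M.q) :
    M.extendReg g z = g.reg ⟨z, hz⟩ :=
  Subtype.val_injective.extend_apply g.reg 0 ⟨z, hz⟩

/-- The value `0` on `Z` confines the integral against `E` to `σ(Θ(N)) \ Z`. -/
theorem extendReg_of_mem_crit (g : GFun M.p M.q M.σΘ) {z : ℂ} (hz : z ∈ crit M.p M.q) :
    M.extendReg g z = 0 := by
  refine Function.extend_apply' _ _ _ ?_
  rintro ⟨y, rfl⟩
  exact y.2.2 hz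

theorem isSpectral_extendReg {g : GFun M.p M.q M.σΘ} (hm : Measurable g.reg)
    (hb : ∃ C : ℝ, ∀ z, ‖g.reg z‖ ≤ C) : IsSpectral M.thetaN (M.extendReg g) := by
  obtain ⟨C, hC⟩ := hb
  have hmeas : MeasurableSet (M.σΘ \ crit M.p M.q) := M.isCompact_σΘ.measurableSet.diff
    (crit_finite M.p_ne_zero M.q_ne_zero).measurableSet
  refine ⟨(MeasurableEmbedding.subtype_coe hmeas).measurable_extend hm measurable_const, max C 0,
    fun z hz => ?_⟩
  by_cases hc : z ∈ crit M.p M.q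
  · rw [M.extendReg_of_mem_crit g hc, norm_zero]; exact le_max_right _ _
  · rw [M.extendReg_apply g ⟨hz, hc⟩]; exact (hC _).trans (le_max_left _ _)

theorem integral_eq [Fintype ↥(M.σΘ ∩ crit M.p M.q)] (g : GFun M.p M.q M.σΘ) :
    M.integral g = spectralIntegral M.thetaN (M.extendReg g) +
    ∑ w : ↥(M.σΘ ∩ crit M.p M.q),
      ((g.pair w).1 • (M.G₁ * spectralProj M.thetaN {(w : ℂ)}) +
        (g.pair w).2 • (M.G₂ * spectralProj M.thetaN {(w : ℂ)})) := by
  rw [integral, finsum_eq_sum_of_fintype]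
  rfl

theorem integral_diff {g h : GFun M.p M.q M.σΘ} (hg : IsSpectral M.thetaN (M.extendReg g))
    (hh : IsSpectral M.thetaN (M.extendReg h)) :
    M.integral (g.diff h) = M.integral g - M.integral h := by
  have := M.finite_inter_crit.fintype
  have hfun : M.extendReg (g.diff h) = fun z => M.extendReg g z + (-1) * M.extendReg h z := by
    ext z
    by_cases hz : z ∈ M.σΘ \ crit M.p M.q
    · rw [M.extendReg_apply _ hz, M.extendReg_apply _ hz, M.extendReg_apply _ hz, GFun.diff]
      ring
    · have h0 : ∀ k : GFun M.p M.q M.σΘ, M.extendReg k z = 0 := fun k =>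
        Function.extend_apply' _ _ _ fun ⟨y, hy⟩ => hz (hy ▸ y.2)
      rw [h0, h0, h0]; ring
  rw [integral_eq, integral_eq, integral_eq, hfun, spectralIntegral_add M.thetaN hg (hh.const_mul _),
    spectralIntegral_const_mul M.thetaN _ hh, add_sub_add_comm, ← Finset.sum_sub_distrib]
  congr 1
  · rw [neg_one_smul, sub_eq_add_neg]
  · refine Finset.sum_congr rfl fun w _ => ?_
    simp only [GFun.diff, sub_smul]
    abel

/-- In the point terms `r(Θ)` passes through `G₁` and `G₂` and acts on `E{w}` as the scalar `r(w)`.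
-/
theorem integral_polyMul {g : GFun M.p M.q M.σΘ} (hg : IsSpectral M.thetaN (M.extendReg g))
    (r : MvPolynomial (Fin 2) ℂ) : M.integral (g.polyMul r) = M.polyTheta r * M.integral g := by
  have := M.finite_inter_crit.fintype
  have hfun : M.extendReg (g.polyMul r) = fun z => M.extendReg g z * polyFun r z := by
    ext z
    by_cases hz : z ∈ M.σΘ \ crit M.p M.q
    · rw [M.extendReg_apply _ hz, M.extendReg_apply _ hz, GFun.polyMul, mul_comm]
    · have h0 : ∀ k : GFun M.p M.q M.σΘ, M.extendReg k z = 0 := fun k =>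
        Function.extend_apply' _ _ _ fun ⟨y, hy⟩ => hz (hy ▸ y.2)
      rw [h0, h0, zero_mul]
  have hE : ∀ (G : V →L[ℂ] V), G * M.polyTheta r = M.polyTheta r * G → ∀ w : ℂ,
      M.polyTheta r * (G * spectralProj M.thetaN {w}) =
        polyFun r w • (G * spectralProj M.thetaN {w}) := by
    intro G hG w
    rw [← mul_assoc, ← hG, mul_assoc, polyTheta,
      cfc_mul_spectralProj_singleton _ (continuous_polyFun r), mul_smul_comm]
  rw [integral_eq, integral_eq, mul_add, hfun]
  congr 1
  · rw [polyTheta, cfc_mul_spectralIntegral _ hg (continuous_polyFun r)]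
  · rw [Finset.mul_sum]
    refine Finset.sum_congr rfl fun w _ => ?_
    rw [mul_add, mul_smul_comm, mul_smul_comm, hE _ (M.commute_of_T_adjFrom M.T_G₁_adjFrom r),
      hE _ (M.commute_of_T_adjFrom M.T_G₂_adjFrom r)]
    simp only [GFun.polyMul, smul_smul, mul_comm]

/-! ### Values of decompositions -/

/-- The operator `s(A, B) + T (∫ g dE) T^*`. -/
noncomputable def value (s : MvPolynomial (Fin 2) ℂ) (g : GFun M.p M.q M.σΘ) : K →L[ℂ] K :=
  M.evalOp s + M.fac.T.comp ((M.integral g).comp (J.adjFrom M.fac.T))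

theorem value_apply (s : MvPolynomial (Fin 2) ℂ) (g : GFun M.p M.q M.σΘ) (x : K) :
    M.value s g x = M.evalOp s x + M.fac.T (M.integral g (J.adjFrom M.fac.T x)) := rfl

theorem isValue_iff {φ : M.Fun} {X : K →L[ℂ] K} :
    M.IsValue φ X ↔ ∃ s g, IsDecomposition φ s g ∧ X = M.value s g := by
  simp only [IsValue, polyOp₂_eq, value]

/-- The core of independence. The value equals `T Y T^*`, and `Y` is zero by
`eq_zero_of_mul_cfc_eq_zero` applied to `p + q`, whose zeros in the spectrum all lie in `Z`. -/
theorem value_eq_zero {s : MvPolynomial (Fin 2) ℂ} {g : GFun M.p M.q M.σΘ}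
    (h : IsDecomposition (0 : M.Fun) s g) : M.value s g = 0 := by
  classical
  have := M.finite_inter_crit.fintype
  have hg := M.isSpectral_extendReg h.measurable h.bounded
  obtain ⟨u, v, rfl⟩ := exists_combination_of_mem_jetIdeal (cpoly_ne_zero M.p_ne_zero)
    (cpoly_ne_zero M.q_ne_zero) (inR_zero_sub_iff.mp h.sub_mem)
  set f := sumPoly M.p M.q with hf
  have hfc := continuous_polyFun f
  have hG₁ := M.commute_of_T_adjFrom M.T_G₁_adjFrom
  have hG₂ := M.commute_of_T_adjFrom M.T_G₂_adjFrom
  -- The entries `(m,0)` and `(0,n)` of `s + (p+q) g = 0` at `w`, divided by the nonzero entries of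
  -- `p + q`.
  have hpair : ∀ w : ↥(M.σΘ ∩ crit M.p M.q),
      (g.pair w).1 = -polyFun u w ∧ (g.pair w).2 = -polyFun v w := by
    intro w
    obtain ⟨c, d, hc, hd, hcd⟩ := taylorCoeff_inZ_add_inW (cpoly_ne_zero M.p_ne_zero)
      (cpoly_ne_zero M.q_ne_zero) (cpoly_isRoot_ofReal.mpr w.2.2.1) (cpoly_isRoot_ofReal.mpr w.2.2.2)
    have h1 := hcd u v
    have h2 := hcd 1 1
    rw [one_mul, one_mul, ← sumPoly_eq, map_one, mul_one, mul_one] at h2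
    have h3 := h.eq_jet w
    have h4 := congrArg (fun x => x.2.1) h3
    have h5 := congrArg (fun x => x.2.2) h3
    simp only [MFun.ofPoly, Prod.snd_add, Prod.fst_add] at h4 h5
    change 0 = _ at h4
    change 0 = _ at h5
    simp only [mult] at h4 h5
    rw [h1.1, h2.1] at h4
    rw [h1.2, h2.2] at h5
    constructor
    · apply mul_left_cancel₀ hc
      rw [polyFun]
      linear_combination -h4
    · apply mul_left_cancel₀ hd
      rw [polyFun]
      linear_combination -h5
  set Y : V →L[ℂ] V := M.polyTheta u * M.G₁ + M.polyTheta v * M.G₂ + M.integral g with hYdef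
  -- Only the summand at `w` survives and cancels `u(w) G₁ + v(w) G₂`; the integral contributes `0`,
  -- since the extended `g` is `0` on `Z`.
  have hYE : ∀ w ∈ M.finite_inter_crit.toFinset, Y * spectralProj M.thetaN {w} = 0 := by
    intro w hw
    rw [Set.Finite.mem_toFinset] at hw
    have hsum : (∑ w' : ↥(M.σΘ ∩ crit M.p M.q),
        ((g.pair w').1 • (M.G₁ * spectralProj M.thetaN {(w' : ℂ)}) +
          (g.pair w').2 • (M.G₂ * spectralProj M.thetaN {(w' : ℂ)}))) * spectralProj M.thetaN {w} =
        (g.pair ⟨w, hw⟩).1 • (M.G₁ * spectralProj M.thetaN {w}) +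
          (g.pair ⟨w, hw⟩).2 • (M.G₂ * spectralProj M.thetaN {w}) := by
      rw [Finset.sum_mul, Finset.sum_eq_single ⟨w, hw⟩]
      · simp only [add_mul, smul_mul_assoc, mul_assoc, spectralProj_singleton_mul, if_true]
      · intro w' _ hne
        have hne' : w ≠ (w' : ℂ) := fun h => hne (Subtype.ext h.symm)
        simp only [add_mul, smul_mul_assoc, mul_assoc, spectralProj_singleton_mul, if_neg hne',
          mul_zero, smul_zero, add_zero]
      · exact fun h => absurd (Finset.mem_univ _) h
    rw [hYdef, integral_eq, add_mul, add_mul, add_mul, hsum, ← hG₁, ← hG₂, mul_assoc, mul_assoc,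
      polyTheta, polyTheta, cfc_mul_spectralProj_singleton _ (continuous_polyFun u),
      cfc_mul_spectralProj_singleton _ (continuous_polyFun v),
      spectralIntegral_mul_spectralProj_singleton _ hg, M.extendReg_of_mem_crit g hw.2,
      (hpair ⟨w, hw⟩).1, (hpair ⟨w, hw⟩).2]
    simp only [mul_smul_comm, neg_smul, zero_smul]
    abel
  have hYf : Y * cfc (polyFun f) M.thetaN = 0 := by
    have hEf : (∑ w : ↥(M.σΘ ∩ crit M.p M.q),
        ((g.pair w).1 • (M.G₁ * spectralProj M.thetaN {(w : ℂ)}) +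
          (g.pair w).2 • (M.G₂ * spectralProj M.thetaN {(w : ℂ)}))) * cfc (polyFun f) M.thetaN = 0 := by
      rw [Finset.sum_mul]
      refine Finset.sum_eq_zero fun w _ => ?_
      have h0 : polyFun f w = 0 := by
        rw [hf, sumPoly_eq, polyFun_add, polyFun_inZ_eq_zero w.2.2, polyFun_inW_eq_zero w.2.2,
          add_zero]
      simp only [add_mul, smul_mul_assoc, mul_assoc, spectralProj_singleton_mul_cfc _ hfc, h0,
        zero_smul, mul_zero, smul_zero, add_zero]
    have h1 : M.G₁ * cfc (polyFun f) M.thetaN = M.polyTheta (inZ (cpoly M.p)) :=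
      M.mul_polyTheta_sumPoly M.T_G₁_adjFrom
    have h2 : M.G₂ * cfc (polyFun f) M.thetaN = M.polyTheta (inW (cpoly M.q)) :=
      M.mul_polyTheta_sumPoly M.T_G₂_adjFrom
    have hs : IsSpectral M.thetaN (polyFun (u * inZ (cpoly M.p) + v * inW (cpoly M.q))) :=
      IsSpectral.of_continuous _ (continuous_polyFun _)
    have hgf := hg.mul (IsSpectral.of_continuous M.thetaN hfc)
    rw [hYdef, integral_eq, add_mul, add_mul, add_mul, hEf, add_zero, mul_assoc, mul_assoc, h1, h2,
      ← polyTheta_mul, ← polyTheta_mul, ← polyTheta_add, spectralIntegral_mul_cfc _ hg hfc, polyTheta,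
      ← spectralIntegral_of_continuous _ (continuous_polyFun _), ← spectralIntegral_add _ hs hgf,
      spectralIntegral_congr _ (hs.add hgf) (IsSpectral.of_continuous _ (continuous_const (y := 0))),
      spectralIntegral_of_continuous _ continuous_const, cfc_const_zero]
    -- The integrand is `up + vq + g(p+q)`: on `Z` every term is zero, elsewhere it vanishes by the
    -- decomposition.
    intro z hz
    by_cases hc : z ∈ crit M.p M.q
    · rw [M.extendReg_of_mem_crit g hc, polyFun_add, polyFun_mul, polyFun_mul,
        polyFun_inZ_eq_zero hc, polyFun_inW_eq_zero hc]
      ring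
    · have h3 := h.eq_reg ⟨z, hz, hc⟩
      change 0 = _ at h3
      simp only [ofPoly_reg] at h3
      rw [M.extendReg_apply g ⟨hz, hc⟩]
      linear_combination -h3
  have hY : Y = 0 := eq_zero_of_mul_cfc_eq_zero M.thetaN hfc M.finite_inter_crit.toFinset
    (fun z hz h0 => M.finite_inter_crit.mem_toFinset.mpr
      ⟨hz, M.mem_crit_of_sumPoly_eq_zero hz h0⟩) hYf hYE
  ext x
  have h1 := congrArg (fun Z : V →L[ℂ] V => M.fac.T (Z (J.adjFrom M.fac.T x))) hY
  simp only [hYdef, add_apply, mul_apply_eq_comp, map_add, T_polyTheta, T_G₁_adjFrom,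
    T_G₂_adjFrom, zero_apply, map_zero] at h1
  rw [value_apply, map_add, map_mul, map_mul]
  exact h1

theorem value_diff {s t : MvPolynomial (Fin 2) ℂ} {g h : GFun M.p M.q M.σΘ}
    (hg : IsSpectral M.thetaN (M.extendReg g)) (hh : IsSpectral M.thetaN (M.extendReg h)) :
    M.value (s - t) (g.diff h) = M.value s g - M.value t h := by
  ext x
  rw [sub_apply, value_apply, value_apply, value_apply, integral_diff M hg hh, map_sub, sub_apply,
    sub_apply, map_sub]
  abel

theorem value_polyMul (r s : MvPolynomial (Fin 2) ℂ) {g : GFun M.p M.q M.σΘ}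
    (hg : IsSpectral M.thetaN (M.extendReg g)) :
    M.value (r * s) (g.polyMul r) = M.evalOp r * M.value s g := by
  ext x
  rw [mul_apply_eq_comp, value_apply, value_apply, integral_polyMul M hg, map_mul, map_add,
    mul_apply_eq_comp, mul_apply_eq_comp, T_polyTheta]

/-! ### Removing pairs of zeros outside `σ_N` -/

/-- At `(A, B)` the polynomial takes the value `N - (α + iβ)`. -/
theorem isUnit_sub_of_notMem_spectrum {α β : ℂ} (h : α + Complex.I * β ∉ spectrum ℂ M.N) :
    IsUnit (M.evalOp ((MvPolynomial.X 0 - MvPolynomial.C α) +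
      MvPolynomial.C Complex.I * (MvPolynomial.X 1 - MvPolynomial.C β))) := by
  rw [spectrum.notMem_iff] at h
  have h1 : M.evalOp ((MvPolynomial.X 0 - MvPolynomial.C α) +
      MvPolynomial.C Complex.I * (MvPolynomial.X 1 - MvPolynomial.C β)) =
      -(algebraMap ℂ (K →L[ℂ] K) (α + Complex.I * β) - M.N) := by
    rw [← M.evalOp_N, ← AlgHom.commutes M.evalOp, ← map_sub, ← map_neg, MvPolynomial.algebraMap_eq]
    congr 1
    simp only [map_add, map_mul]
    ring
  rw [h1]
  exact h.neg

/-- At `(A, B)` the polynomial takes the value `N^* - (α - iβ)`, the Krein adjoint of `N - (ᾱ +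
iβ̄)`. This is where the second condition in `σ_N` comes from. -/
theorem isUnit_sub_of_conj_notMem_spectrum {α β : ℂ}
    (h : (starRingEnd ℂ) α + Complex.I * (starRingEnd ℂ) β ∉ spectrum ℂ M.N) :
    IsUnit (M.evalOp ((MvPolynomial.X 0 - MvPolynomial.C α) +
      MvPolynomial.C (-Complex.I) * (MvPolynomial.X 1 - MvPolynomial.C β))) := by
  rw [spectrum.notMem_iff] at h
  have h1 : M.evalOp ((MvPolynomial.X 0 - MvPolynomial.C α) +
      MvPolynomial.C (-Complex.I) * (MvPolynomial.X 1 - MvPolynomial.C β)) =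
      -(algebraMap ℂ (K →L[ℂ] K) (α - Complex.I * β) - J.adj M.N) := by
    rw [← M.evalOp_adj_N, ← AlgHom.commutes M.evalOp, ← map_sub, ← map_neg,
      MvPolynomial.algebraMap_eq]
    congr 1
    simp only [map_sub, map_mul, map_neg]
    ring
  have h2 : J.adj (algebraMap ℂ (K →L[ℂ] K)
      ((starRingEnd ℂ) α + Complex.I * (starRingEnd ℂ) β) - M.N) =
      algebraMap ℂ (K →L[ℂ] K) (α - Complex.I * β) - J.adj M.N := by
    have h3 : star (algebraMap ℂ (K →L[ℂ] K) ((starRingEnd ℂ) α + Complex.I * (starRingEnd ℂ) β)) =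
        algebraMap ℂ (K →L[ℂ] K) (α - Complex.I * β) := by
      rw [← algebraMap_star_comm]
      congr 1
      simp [sub_eq_add_neg]
    rw [FundamentalSymmetry.adj, FundamentalSymmetry.adj, ← ContinuousLinearMap.star_eq_adjoint,
      ← ContinuousLinearMap.star_eq_adjoint, star_sub, h3, mul_sub, sub_mul, ← Algebra.commutes,
      mul_assoc, J.sq_eq_one, mul_one]
  rw [h1, ← h2]
  exact (J.isUnit_adj h).neg

/-- Every binomial term of degree `m + n` has at least `m` factors of the first kind or `n` of the
second. -/
theorem pow_mem_jetIdeal (α β c : ℂ) (m n : ℕ) :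
    ((MvPolynomial.X 0 - MvPolynomial.C α) +
      MvPolynomial.C c * (MvPolynomial.X 1 - MvPolynomial.C β)) ^ (m + n) ∈ jetIdeal α β m n := by
  refine Ideal.add_pow_mem_of_pow_mem_of_le (m := m) (n := n) _
    (Ideal.subset_span (Set.mem_insert _ _)) ?_ (by omega)
  rw [mul_pow]
  exact Ideal.mul_mem_left _ _ (Ideal.subset_span (Set.mem_insert_of_mem _ rfl))

/-- If `χ` vanishes on `σ_N` and has the decomposition `(s, g)`, then at every pair of zeros `s` has
vanishing jets up to multiplication with a polynomial `r` for which `r(A, B)` is invertible. -/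
theorem exists_isUnit_mul_mem {χ : M.Fun} (hχ : χ.EqOn 0 M.sigmaN) {s : MvPolynomial (Fin 2) ℂ}
    (hs : (χ - MFun.ofPoly M.p M.q M.σΘ s).InR) {α β : ℂ} (hα : (cpoly M.p).IsRoot α)
    (hβ : (cpoly M.q).IsRoot β) : ∃ r : MvPolynomial (Fin 2) ℂ, IsUnit (M.evalOp r) ∧
      r * s ∈ jetIdeal α β (mult M.p α) (mult M.q β) := by
  have hN : α + Complex.I * β ∉ spectrum ℂ M.N → ∃ r : MvPolynomial (Fin 2) ℂ,
      IsUnit (M.evalOp r) ∧ r * s ∈ jetIdeal α β (mult M.p α) (mult M.q β) := fun h =>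
    ⟨_, by rw [map_pow]; exact (M.isUnit_sub_of_notMem_spectrum h).pow _,
      Ideal.mul_mem_right _ _ (pow_mem_jetIdeal α β _ (mult M.p α) (mult M.q β))⟩
  have hN' : (starRingEnd ℂ) α + Complex.I * (starRingEnd ℂ) β ∉ spectrum ℂ M.N →
      ∃ r : MvPolynomial (Fin 2) ℂ,
      IsUnit (M.evalOp r) ∧ r * s ∈ jetIdeal α β (mult M.p α) (mult M.q β) := fun h =>
    ⟨_, by rw [map_pow]; exact (M.isUnit_sub_of_conj_notMem_spectrum h).pow _,
      Ideal.mul_mem_right _ _ (pow_mem_jetIdeal α β _ (mult M.p α) (mult M.q β))⟩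
  by_cases h1 : α + Complex.I * β ∈ spectrum ℂ M.N
  swap
  · exact hN h1
  by_cases h2 : (starRingEnd ℂ) α + Complex.I * (starRingEnd ℂ) β ∈ spectrum ℂ M.N
  swap
  · exact hN' h2
  -- Both points are spectral, so the pair belongs to `σ_N`, seen as a point of `Z` if it is real,
  -- and the lower jet of `s` agrees with that of `χ`, which is zero.
  refine ⟨1, by simp, ?_⟩
  rw [one_mul, mem_jetIdeal_iff]
  intro k hk l hl
  by_cases hreal : α.im = 0 ∧ β.im = 0
  · obtain ⟨a, rfl⟩ : ∃ a : ℝ, α = a := ⟨α.re, Complex.ext rfl (by simpa using hreal.1)⟩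
    obtain ⟨b, rfl⟩ : ∃ b : ℝ, β = b := ⟨β.re, Complex.ext rfl (by simpa using hreal.2)⟩
    have hc : (⟨a, b⟩ : ℂ) ∈ crit M.p M.q :=
      ⟨cpoly_isRoot_ofReal.mp hα, cpoly_isRoot_ofReal.mp hβ⟩
    have hab : (a : ℂ) + Complex.I * b = ⟨a, b⟩ := by
      apply Complex.ext <;> simp
    rw [hab] at h1
    have h3 := hχ.2.1 ⟨⟨a, b⟩, hc⟩ (Or.inl ⟨_, Or.inr ⟨hc, h1⟩, rfl⟩)
    have h4 := InR.taylorCoeff_eq hs ⟨⟨a, b⟩, hc⟩ ⟨k, hk⟩ ⟨l, hl⟩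
    rw [h3] at h4
    exact h4
  · have hζ : (α, β) ∈ nonrealPairs M.p M.q := ⟨hα, hβ, hreal⟩
    have h3 := hχ.2.2 ⟨(α, β), hζ⟩ (Or.inr ⟨_, ⟨hζ, h1, h2⟩, rfl⟩)
    have h4 := InR.taylorCoeff_eq_nonreal hs ⟨(α, β), hζ⟩ ⟨k, hk⟩ ⟨l, hl⟩
    rw [h3] at h4
    exact h4

/-- Multiply by the product of the local factors over all pairs of zeros: all jets of the polynomial
vanish, the value becomes `0` by `value_eq_zero`, and the product is invertible at `(A, B)`. -/
theorem value_eq_zero_of_eqOn {χ : M.Fun} (hχ : χ.EqOn 0 M.sigmaN) {s : MvPolynomial (Fin 2) ℂ}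
    {g : GFun M.p M.q M.σΘ} (h : IsDecomposition χ s g) : M.value s g = 0 := by
  classical
  have hP := cpoly_ne_zero M.p_ne_zero
  have hQ := cpoly_ne_zero M.q_ne_zero
  have hex : ∀ αβ : ℂ × ℂ, ∃ r : MvPolynomial (Fin 2) ℂ, IsUnit (M.evalOp r) ∧
      ((cpoly M.p).IsRoot αβ.1 → (cpoly M.q).IsRoot αβ.2 →
        r * s ∈ jetIdeal αβ.1 αβ.2 (mult M.p αβ.1) (mult M.q αβ.2)) := by
    intro αβ
    by_cases hr : (cpoly M.p).IsRoot αβ.1 ∧ (cpoly M.q).IsRoot αβ.2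
    · obtain ⟨r, hr1, hr2⟩ := M.exists_isUnit_mul_mem hχ h.sub_mem hr.1 hr.2
      exact ⟨r, hr1, fun _ _ => hr2⟩
    · exact ⟨1, by simp, fun h1 h2 => absurd ⟨h1, h2⟩ hr⟩
  choose r hr1 hr2 using hex
  let S := (cpoly M.p).roots.toFinset ×ˢ (cpoly M.q).roots.toFinset
  have hunit : IsUnit (M.evalOp (∏ αβ ∈ S, r αβ)) := by
    refine Finset.prod_induction r (fun t => IsUnit (M.evalOp t)) ?_ ?_ fun αβ _ => hr1 αβ
    · intro a b ha hb
      rw [map_mul]; exact ha.mul hb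
    · simp
  have hmem : ∀ α β, (cpoly M.p).IsRoot α → (cpoly M.q).IsRoot β →
      (∏ αβ ∈ S, r αβ) * s ∈ jetIdeal α β (mult M.p α) (mult M.q β) := by
    intro α β hα hβ
    have hS : (α, β) ∈ S := Finset.mem_product.mpr
      ⟨Multiset.mem_toFinset.mpr ((Polynomial.mem_roots hP).mpr hα),
        Multiset.mem_toFinset.mpr ((Polynomial.mem_roots hQ).mpr hβ)⟩
    rw [← Finset.mul_prod_erase S r hS, mul_right_comm]
    exact Ideal.mul_mem_right _ _ (hr2 (α, β) hα hβ)
  have hdec := h.polyMul M.p_ne_zero M.q_ne_zero M.isCompact_σΘ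
    (fun z => hχ.1 z (Or.inl ⟨_, Or.inl z.2.1, rfl⟩))
    (fun z hz => hχ.2.1 z (Or.inl ⟨_, Or.inl hz, rfl⟩)) hmem
  have h0 := M.value_eq_zero hdec
  rw [value_polyMul M _ _ (M.isSpectral_extendReg h.measurable h.bounded)] at h0
  exact hunit.mul_right_eq_zero.mp h0

theorem IsValue.eq_of_eqOn {φ ψ : M.Fun} {X Y : K →L[ℂ] K} (hX : M.IsValue φ X)
    (hY : M.IsValue ψ Y) (h : φ.EqOn ψ M.sigmaN) : X = Y := by
  obtain ⟨s, g, hφ, rfl⟩ := M.isValue_iff.mp hX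
  obtain ⟨t, k, hψ, rfl⟩ := M.isValue_iff.mp hY
  rw [← sub_eq_zero, ← M.value_diff (M.isSpectral_extendReg hφ.measurable hφ.bounded)
    (M.isSpectral_extendReg hψ.measurable hψ.bounded)]
  refine M.value_eq_zero_of_eqOn ⟨fun z hz => ?_, fun z hz => ?_, fun z hz => ?_⟩ (hφ.diff hψ)
  · exact sub_eq_zero.mpr (h.1 z hz)
  · exact sub_eq_zero.mpr (h.2.1 z hz)
  · exact sub_eq_zero.mpr (h.2.2 z hz)

end Model

end KreinCalc

namespace KreinCalc

/-! ### Existence of decompositions -/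

section Estimates

/-- The Taylor remainder lies in the jet ideal, so it is `u Re(z-w)^m + v Im(z-w)^n` with `u`, `v`
bounded near `w`. -/
theorem polyFun_sub_taylor_le (s : MvPolynomial (Fin 2) ℂ) (w : ℂ) (m n : ℕ) :
    ∃ C : ℝ, ∀ᶠ z in 𝓝 w, ‖polyFun s z - ∑ k : Fin m, ∑ l : Fin n,
      taylorCoeff s k l w.re w.im * ((z - w).re : ℂ) ^ (k : ℕ) * ((z - w).im : ℂ) ^ (l : ℕ)‖ ≤
      C * max (|(z - w).re| ^ m) (|(z - w).im| ^ n) := by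
  obtain ⟨u, v, huv⟩ := mem_jetIdeal.mp (sub_taylorPoly_mem s w.re w.im m n)
  have hcont : Continuous fun z => ‖polyFun u z‖ + ‖polyFun v z‖ :=
    (continuous_polyFun u).norm.add (continuous_polyFun v).norm
  refine ⟨‖polyFun u w‖ + ‖polyFun v w‖ + 1, ?_⟩
  filter_upwards [hcont.continuousAt.eventually_lt_const (lt_add_one _)] with z hz
  have h1 : polyFun s z - ∑ k : Fin m, ∑ l : Fin n,
      taylorCoeff s k l w.re w.im * ((z - w).re : ℂ) ^ (k : ℕ) * ((z - w).im : ℂ) ^ (l : ℕ) =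
      polyFun u z * ((z - w).re : ℂ) ^ m + polyFun v z * ((z - w).im : ℂ) ^ n := by
    have h2 := congrArg (fun t => polyFun t z) huv
    simp only [polyFun, taylorPoly, map_add, map_mul, map_sub, map_pow, map_sum,
      MvPolynomial.eval_X, MvPolynomial.eval_C, Matrix.cons_val_zero, Matrix.cons_val_one,
      Finset.sum_range] at h2
    simp only [Complex.sub_re, Complex.sub_im, Complex.ofReal_sub]
    exact h2.symm
  have hm : |(z - w).re| ^ m ≤ max (|(z - w).re| ^ m) (|(z - w).im| ^ n) := le_max_left _ _
  have hn : |(z - w).im| ^ n ≤ max (|(z - w).re| ^ m) (|(z - w).im| ^ n) := le_max_right _ _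
  have h0 : 0 ≤ max (|(z - w).re| ^ m) (|(z - w).im| ^ n) := le_trans (by positivity) hm
  rw [h1]
  calc _ ≤ ‖polyFun u z‖ * |(z - w).re| ^ m + ‖polyFun v z‖ * |(z - w).im| ^ n := by
        refine (norm_add_le _ _).trans_eq ?_
        rw [norm_mul, norm_mul, norm_pow, norm_pow, Complex.norm_real, Complex.norm_real,
          Real.norm_eq_abs, Real.norm_eq_abs]
    _ ≤ (‖polyFun u z‖ + ‖polyFun v z‖) * max (|(z - w).re| ^ m) (|(z - w).im| ^ n) := by
        rw [add_mul]
        gcongr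
    _ ≤ _ := by gcongr

/-- Split off the full root power; the cofactor is nonzero at `w` and keeps at least half its
modulus nearby. -/
theorem exists_le_norm_inZ {p : Polynomial ℝ} (hp : p ≠ 0) (w : ℂ) : ∃ c : ℝ, 0 < c ∧
    ∀ᶠ z in 𝓝 w, c * |(z - w).re| ^ mult p w.re ≤ ‖polyFun (inZ (cpoly p)) z‖ := by
  obtain ⟨p', hp', hpa⟩ := Polynomial.exists_eq_pow_rootMultiplicity_mul_and_not_dvd _
    (cpoly_ne_zero hp) (w.re : ℂ)
  have h0 : 0 < ‖polyFun (inZ p') w‖ := norm_pos_iff.mpr fun h =>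
    hpa (Polynomial.dvd_iff_isRoot.mpr (by rwa [polyFun, eval_inZ] at h))
  refine ⟨‖polyFun (inZ p') w‖ / 2, by positivity, ?_⟩
  filter_upwards [(continuous_polyFun (inZ p')).norm.continuousAt.eventually_const_lt
    (half_lt_self h0)] with z hz
  have h1 : polyFun (inZ (cpoly p)) z = ((z - w).re : ℂ) ^ mult p w.re * polyFun (inZ p') z := by
    rw [hp', map_mul, inZ_X_sub_C_pow, polyFun_mul]
    simp [polyFun, mult]
  rw [h1, norm_mul, norm_pow, Complex.norm_real, Real.norm_eq_abs, mul_comm]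
  gcongr

theorem exists_le_norm_inW {q : Polynomial ℝ} (hq : q ≠ 0) (w : ℂ) : ∃ c : ℝ, 0 < c ∧
    ∀ᶠ z in 𝓝 w, c * |(z - w).im| ^ mult q w.im ≤ ‖polyFun (inW (cpoly q)) z‖ := by
  obtain ⟨q', hq', hqa⟩ := Polynomial.exists_eq_pow_rootMultiplicity_mul_and_not_dvd _
    (cpoly_ne_zero hq) (w.im : ℂ)
  have h0 : 0 < ‖polyFun (inW q') w‖ := norm_pos_iff.mpr fun h =>
    hqa (Polynomial.dvd_iff_isRoot.mpr (by rwa [polyFun, eval_inW] at h))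
  refine ⟨‖polyFun (inW q') w‖ / 2, by positivity, ?_⟩
  filter_upwards [(continuous_polyFun (inW q')).norm.continuousAt.eventually_const_lt
    (half_lt_self h0)] with z hz
  have h1 : polyFun (inW (cpoly q)) z = ((z - w).im : ℂ) ^ mult q w.im * polyFun (inW q') z := by
    rw [hq', map_mul, inW_X_sub_C_pow, polyFun_mul]
    simp [polyFun, mult]
  rw [h1, norm_mul, norm_pow, Complex.norm_real, Real.norm_eq_abs, mul_comm]
  gcongr

theorem exists_ofPoly_sub_inR {p q : Polynomial ℝ} {σ : Set ℂ} (hp : p ≠ 0) (hq : q ≠ 0)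
    (φ : MFun p q σ) : ∃ s : MvPolynomial (Fin 2) ℂ, (φ - MFun.ofPoly p q σ s).InR := by
  classical
  let c : ℂ → ℂ → ℕ → ℕ → ℂ := fun α β k l =>
    if h : ∃ z : crit p q, α = (z : ℂ).re ∧ β = (z : ℂ).im ∧ k < mult p (z : ℂ).re ∧
        l < mult q (z : ℂ).im then
      (φ.jet h.choose).1 (⟨k, h.choose_spec.2.2.1⟩, ⟨l, h.choose_spec.2.2.2⟩)
    else if h : ∃ hζ : (α, β) ∈ nonrealPairs p q, k < mult p α ∧ l < mult q β then
      φ.nonreal ⟨(α, β), h.choose⟩ (⟨k, h.choose_spec.1⟩, ⟨l, h.choose_spec.2⟩)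
    else 0
  obtain ⟨s, hs⟩ := exists_interpolation (cpoly_ne_zero hp) (cpoly_ne_zero hq) c
  refine ⟨s, fun z => ?_, fun ζ => ?_⟩
  · ext ⟨k, l⟩
    have h1 := hs _ _ (cpoly_isRoot_ofReal.mpr z.2.1) (cpoly_isRoot_ofReal.mpr z.2.2) k k.2 l l.2
    have hex : ∃ z' : crit p q, ((z : ℂ).re : ℂ) = (z' : ℂ).re ∧ ((z : ℂ).im : ℂ) = (z' : ℂ).im ∧
        (k : ℕ) < mult p (z' : ℂ).re ∧ (l : ℕ) < mult q (z' : ℂ).im := ⟨z, rfl, rfl, k.2, l.2⟩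
    -- The chosen point has the coordinates of `z` and so equals it; substituting a general `z'`
    -- handles the dependent index types.
    have key : ∀ (z' : crit p q) (h : ((z : ℂ).re : ℂ) = (z' : ℂ).re ∧
        ((z : ℂ).im : ℂ) = (z' : ℂ).im ∧ (k : ℕ) < mult p (z' : ℂ).re ∧
        (l : ℕ) < mult q (z' : ℂ).im),
        (φ.jet z').1 (⟨k, h.2.2.1⟩, ⟨l, h.2.2.2⟩) = (φ.jet z).1 (k, l) := by
      intro z' h
      obtain rfl : z = z' := Subtype.ext (Complex.ext (Complex.ofReal_injective h.1)
        (Complex.ofReal_injective h.2.1))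
      rfl
    have h2 : c (z : ℂ).re (z : ℂ).im k l = (φ.jet z).1 (k, l) := by
      simp only [c]
      rw [dif_pos hex]
      exact key _ hex.choose_spec
    change (φ.jet z).1 (k, l) - taylorCoeff s k l _ _ = 0
    rw [h1, h2, sub_self]
  · ext ⟨k, l⟩
    have h1 := hs _ _ ζ.2.1 ζ.2.2.1 k k.2 l l.2
    have hnex : ¬ ∃ z' : crit p q, (ζ : ℂ × ℂ).1 = (z' : ℂ).re ∧ (ζ : ℂ × ℂ).2 = (z' : ℂ).im ∧
        (k : ℕ) < mult p (z' : ℂ).re ∧ (l : ℕ) < mult q (z' : ℂ).im := by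
      rintro ⟨z', h, h', -⟩
      exact ζ.2.2.2 ⟨by rw [h]; simp, by rw [h']; simp⟩
    have hex : ∃ _ : ((ζ : ℂ × ℂ).1, (ζ : ℂ × ℂ).2) ∈ nonrealPairs p q,
        (k : ℕ) < mult p (ζ : ℂ × ℂ).1 ∧ (l : ℕ) < mult q (ζ : ℂ × ℂ).2 := ⟨ζ.2, k.2, l.2⟩
    have h2 : c (ζ : ℂ × ℂ).1 (ζ : ℂ × ℂ).2 k l = φ.nonreal ζ (k, l) := by
      simp only [c]
      rw [dif_neg hnex, dif_pos hex]
    change φ.nonreal ζ (k, l) - taylorCoeff s k l _ _ = 0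
    rw [h1, h2, sub_self]

end Estimates

namespace Model

variable {K : Type*} [NormedAddCommGroup K] [InnerProductSpace ℂ K] [CompleteSpace K]
variable {V : Type*} [NormedAddCommGroup V] [InnerProductSpace ℂ V] [CompleteSpace V]
variable {V₁ : Type*} [NormedAddCommGroup V₁] [InnerProductSpace ℂ V₁] [CompleteSpace V₁]
variable {V₂ : Type*} [NormedAddCommGroup V₂] [InnerProductSpace ℂ V₂] [CompleteSpace V₂]
variable {J : FundamentalSymmetry K} (M : Model J V V₁ V₂)

/-- At a critical point, growth of `φ` and the Taylor estimate for `s` bound the numerator by a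
multiple of the maximum of powers, and `|p+q| ≥ |p|, |q|` bounds the denominator below by another.
Elsewhere `p + q` is nonzero. -/
theorem exists_local_bound {φ : M.Fun} (hφ : φ.InF) {s : MvPolynomial (Fin 2) ℂ}
    (hs : (φ - MFun.ofPoly M.p M.q M.σΘ s).InR) {w : ℂ} (hw : w ∈ M.σΘ) :
    ∃ C : ℝ, ∀ᶠ z in 𝓝 w, ∀ h : z ∈ M.σΘ \ crit M.p M.q,
      ‖(φ.reg ⟨z, h⟩ - polyFun s z) / polyFun (sumPoly M.p M.q) z‖ ≤ C := by
  by_cases hc : w ∈ crit M.p M.q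
  · obtain ⟨C₁, U, hU, hC₁⟩ := hφ.growth ⟨w, hc⟩ hw
    obtain ⟨C₂, hC₂⟩ := polyFun_sub_taylor_le s w (mult M.p w.re) (mult M.q w.im)
    obtain ⟨c₁, hc₁, h₁⟩ := exists_le_norm_inZ M.p_ne_zero w
    obtain ⟨c₂, hc₂, h₂⟩ := exists_le_norm_inW M.q_ne_zero w
    refine ⟨(C₁ + C₂) / min c₁ c₂, ?_⟩
    filter_upwards [hU, hC₂, h₁, h₂] with z hzU hz2 hz3 hz4 hz
    have hzw : z ≠ w := fun h => hz.2 (h ▸ hc)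
    set μ := max (|(z - w).re| ^ mult M.p w.re) (|(z - w).im| ^ mult M.q w.im) with hμ
    have hμ0 : 0 < μ := by
      by_contra! hle
      have h1 := (le_max_left _ _).trans hle
      have h2 := (le_max_right _ _).trans hle
      have h1' := eq_zero_of_pow_eq_zero (le_antisymm h1 (by positivity))
      have h2' := eq_zero_of_pow_eq_zero (le_antisymm h2 (by positivity))
      exact hzw (sub_eq_zero.mp (Complex.ext (abs_eq_zero.mp h1') (abs_eq_zero.mp h2')))
    have hden : min c₁ c₂ * μ ≤ ‖polyFun (sumPoly M.p M.q) z‖ := by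
      rcases max_choice (|(z - w).re| ^ mult M.p w.re) (|(z - w).im| ^ mult M.q w.im) with h | h
      · rw [hμ, h]
        exact ((mul_le_mul_of_nonneg_right (min_le_left _ _) (by positivity)).trans hz3).trans
          (M.norm_inZ_le hz.1)
      · rw [hμ, h]
        exact ((mul_le_mul_of_nonneg_right (min_le_right _ _) (by positivity)).trans hz4).trans
          (M.norm_inW_le hz.1)
    have hz1 := hC₁ ⟨z, hz⟩ hzU
    rw [div_le_iff₀ hμ0] at hz1
    have hnum : ‖φ.reg ⟨z, hz⟩ - polyFun s z‖ ≤ (C₁ + C₂) * μ := by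
      simp only [← InR.taylorCoeff_eq hs ⟨w, hc⟩] at hz1
      rw [add_mul]
      refine (norm_sub_le_norm_sub_add_norm_sub _ _ _).trans (add_le_add hz1 ?_)
      rw [norm_sub_rev]
      exact hz2
    have hmin : 0 < min c₁ c₂ := lt_min hc₁ hc₂
    have hpos : 0 < ‖polyFun (sumPoly M.p M.q) z‖ := (mul_pos hmin hμ0).trans_le hden
    have hC0 : 0 ≤ C₁ + C₂ := nonneg_of_mul_nonneg_left ((norm_nonneg _).trans hnum) hμ0
    rw [norm_div, div_le_div_iff₀ hpos hmin]
    calc _ ≤ (C₁ + C₂) * μ * min c₁ c₂ := by gcongr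
      _ = (C₁ + C₂) * (min c₁ c₂ * μ) := by ring
      _ ≤ _ := by gcongr
  · have h0 : 0 < ‖polyFun (sumPoly M.p M.q) w‖ := norm_pos_iff.mpr fun h =>
      hc (M.mem_crit_of_sumPoly_eq_zero hw h)
    obtain ⟨C, hC⟩ := hφ.bounded
    obtain ⟨C', hC'⟩ := M.isCompact_σΘ.exists_bound_of_continuousOn
      (continuous_polyFun s).continuousOn
    refine ⟨(C + C') / (‖polyFun (sumPoly M.p M.q) w‖ / 2), ?_⟩
    filter_upwards [(continuous_polyFun (sumPoly M.p M.q)).norm.continuousAt.eventually_const_lt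
      (half_lt_self h0)] with z hz h
    have h1 : ‖φ.reg ⟨z, h⟩ - polyFun s z‖ ≤ C + C' :=
      (norm_sub_le _ _).trans (add_le_add (hC _) (hC' z h.1))
    rw [norm_div]
    exact div_le_div₀ ((norm_nonneg _).trans h1) h1 (by positivity) hz.le

theorem exists_isDecomposition {φ : M.Fun} (hφ : φ.InF) :
    ∃ s g, IsDecomposition φ s g := by
  obtain ⟨s, hs⟩ := exists_ofPoly_sub_inR M.p_ne_zero M.q_ne_zero φ
  have hbound : ∃ C : ℝ, ∀ z, ∀ _ : z ∈ M.σΘ, ∀ h : z ∈ M.σΘ \ crit M.p M.q,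
      ‖(φ.reg ⟨z, h⟩ - polyFun s z) / polyFun (sumPoly M.p M.q) z‖ ≤ C := by
    -- Compactness of the spectrum turns the local bounds into a global one.
    refine M.isCompact_σΘ.induction_on (p := fun t => ∃ C : ℝ, ∀ z, ∀ _ : z ∈ t,
      ∀ h : z ∈ M.σΘ \ crit M.p M.q,
      ‖(φ.reg ⟨z, h⟩ - polyFun s z) / polyFun (sumPoly M.p M.q) z‖ ≤ C) ?_ ?_ ?_ ?_
    · exact ⟨0, fun z hz => absurd hz (Set.notMem_empty z)⟩
    · rintro t t' htt' ⟨C, hC⟩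
      exact ⟨C, fun z hz => hC z (htt' hz)⟩
    · rintro t t' ⟨C, hC⟩ ⟨C', hC'⟩
      refine ⟨max C C', fun z hz h => ?_⟩
      rcases hz with hz | hz
      · exact (hC z hz h).trans (le_max_left _ _)
      · exact (hC' z hz h).trans (le_max_right _ _)
    · intro w hw
      obtain ⟨C, hC⟩ := M.exists_local_bound hφ hs hw
      exact ⟨_, mem_nhdsWithin_of_mem_nhds hC, C, fun z hz => hz⟩
  obtain ⟨C, hC⟩ := hbound
  let c : ↥(M.σΘ ∩ crit M.p M.q) → ℂ × ℂ := fun w =>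
    ((MFun.ofPoly M.p M.q M.σΘ (sumPoly M.p M.q)).jet ⟨w, w.2.2⟩).2
  let g : GFun M.p M.q M.σΘ :=
    { reg := fun z => (φ.reg z - polyFun s z) / polyFun (sumPoly M.p M.q) z
      pair := fun w => (((φ.jet ⟨w, w.2.2⟩).2.1 -
          ((MFun.ofPoly M.p M.q M.σΘ s).jet ⟨w, w.2.2⟩).2.1) / (c w).1,
        ((φ.jet ⟨w, w.2.2⟩).2.2 - ((MFun.ofPoly M.p M.q M.σΘ s).jet ⟨w, w.2.2⟩).2.2) / (c w).2) }
  refine ⟨s, g, hs, ?_, ⟨C, fun z => hC z z.2.1 z.2⟩, fun z => ?_, fun w => ?_⟩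
  · have hm : ∀ t, Measurable fun z : ↥(M.σΘ \ crit M.p M.q) => polyFun t z := fun t =>
      (continuous_polyFun t).measurable.comp measurable_subtype_coe
    exact (hφ.measurable.sub (hm s)).div (hm _)
  · have h0 : polyFun (sumPoly M.p M.q) z ≠ 0 := fun h =>
      z.2.2 (M.mem_crit_of_sumPoly_eq_zero z.2.1 h)
    simp only [ofPoly_reg, g]
    field_simp
    ring
  · have hc : (c w).1 ≠ 0 ∧ (c w).2 ≠ 0 := by
      obtain ⟨c', d', hc', hd', hcd⟩ := taylorCoeff_inZ_add_inW (cpoly_ne_zero M.p_ne_zero)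
        (cpoly_ne_zero M.q_ne_zero) (cpoly_isRoot_ofReal.mpr w.2.2.1)
        (cpoly_isRoot_ofReal.mpr w.2.2.2)
      have h2 := hcd 1 1
      rw [one_mul, one_mul, ← sumPoly_eq, map_one, mul_one, mul_one] at h2
      refine ⟨?_, ?_⟩
      · change taylorCoeff _ _ _ _ _ ≠ 0
        exact h2.1.trans_ne hc'
      · change taylorCoeff _ _ _ _ _ ≠ 0
        exact h2.2.trans_ne hd'
    refine Prod.ext (funext fun kl => ?_) (Prod.ext ?_ ?_)
    · change _ = taylorCoeff s kl.1 kl.2 _ _ + 0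
      rw [add_zero]
      exact (InR.taylorCoeff_eq hs ⟨w, w.2.2⟩ kl.1 kl.2).symm
    · change _ = ((MFun.ofPoly M.p M.q M.σΘ s).jet ⟨w, w.2.2⟩).2.1 + (c w).1 * (_ / (c w).1)
      rw [mul_div_cancel₀ _ hc.1]
      ring
    · change _ = ((MFun.ofPoly M.p M.q M.σΘ s).jet ⟨w, w.2.2⟩).2.2 + (c w).2 * (_ / (c w).2)
      rw [mul_div_cancel₀ _ hc.2]
      ring

/-- Uniqueness is `IsValue.eq_of_eqOn` for a function compared with itself. -/
theorem existsUnique_isValue {φ : M.Fun} (hφ : φ.InF) : ∃! X, M.IsValue φ X := by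
  obtain ⟨s, g, h⟩ := M.exists_isDecomposition hφ
  refine ⟨_, M.isValue_iff.mpr ⟨s, g, h, rfl⟩, fun Y hY => ?_⟩
  exact IsValue.eq_of_eqOn M hY (M.isValue_iff.mpr ⟨s, g, h, rfl⟩)
    ⟨fun _ _ => rfl, fun _ _ => rfl, fun _ _ => rfl⟩

theorem isValue_funCalc {φ : M.Fun} (hφ : φ.InF) : M.IsValue φ (M.funCalc φ) :=
  Classical.epsilon_spec (M.existsUnique_isValue hφ).exists

theorem inF_zero : (0 : M.Fun).InF := by
  refine ⟨measurable_const, ⟨0, fun z => ?_⟩, fun w _ => ⟨0, Set.univ, Filter.univ_mem,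
    fun z _ => ?_⟩⟩
  · change ‖(0 : ℂ)‖ ≤ 0
    simp
  · change ‖(0 : ℂ) - ∑ k, ∑ l, (0 : ℂ) * _ * _‖ / _ ≤ 0
    simp

theorem funCalc_congr {φ ψ : M.Fun} (hφ : φ.InF) (hψ : ψ.InF) (h : φ.EqOn ψ M.sigmaN) :
    M.funCalc φ = M.funCalc ψ :=
  IsValue.eq_of_eqOn M (M.isValue_funCalc hφ) (M.isValue_funCalc hψ) h

theorem funCalc_zero : M.funCalc 0 = 0 := by
  obtain ⟨s, g, h, hX⟩ := M.isValue_iff.mp (M.isValue_funCalc M.inF_zero)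
  rw [hX, M.value_eq_zero h]

end Model

end KreinCalc

/-! ### The main theorem -/

theorem mainTheorem6 {K V V₁ V₂ : Type*}
    [NormedAddCommGroup K] [InnerProductSpace ℂ K] [CompleteSpace K]
    [NormedAddCommGroup V] [InnerProductSpace ℂ V] [CompleteSpace V]
    [NormedAddCommGroup V₁] [InnerProductSpace ℂ V₁] [CompleteSpace V₁]
    [NormedAddCommGroup V₂] [InnerProductSpace ℂ V₂] [CompleteSpace V₂]
    (J : KreinCalc.FundamentalSymmetry K) (M : KreinCalc.Model J V V₁ V₂) :
    (∀ φ : M.Fun, φ.InF → ∃! X, M.IsValue φ X) ∧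
    (∀ φ : M.Fun, φ.InF → φ.EqOn 0 M.sigmaN → M.funCalc φ = 0) ∧
    (∀ φ ψ : M.Fun, φ.InF → ψ.InF → φ.EqOn ψ M.sigmaN → M.funCalc φ = M.funCalc ψ) :=
  ⟨fun _ hφ => M.existsUnique_isValue hφ,
    fun _ hφ h => (M.funCalc_congr hφ M.inF_zero h).trans M.funCalc_zero,
    fun _ _ hφ hψ h => M.funCalc_congr hφ hψ h⟩
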